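/- Let $B$ be an $n$-dimensional integral affine manifold (without boundary; transition maps locally in $GL(n,\mathbb Z)\ltimes\mathbb R^n$) with affine coordinates $(x^j)$, and let $\Lambda=\bigoplus\mathbb Z\,\partial/\partial x^j\subset TB$, $\Lambda^*=\bigoplus\mathbb Z\,dx^j\subset T^*B$. Let $g$ be a Hessian-type Riemannian metric on $B$ (locally the Hessian, in affine coordinates, of a smooth convex function) and let $\hbar>0$. Put $X=T^*B/\Lambda^*$ with fibre coordinates $y_j$ and $\omega_\hbar=\hbar^{-1}\sum_j dy_j\wedge dx^j$, and $\check X=TB/\Lambda$ with fibre coordinates $\check y^j$ and the complex structure with holomorphic coordinates $z_j=\check y^j+i\hbar^{-1}x^j$. Let $\xi_1,\xi_2$ be smooth Lagrangian sections of $p:X\to B$ with images $L_1,L_2$. **The Witten complex.** Let $P(L_1,L_2)$ be the fibrewise geodesic path space: the covering of $B$ whose points over $x$ are the geodesics $\gamma$ of the torus $p^{-1}(x)$ from $\xi_1(x)$ to $\xi_2(x)$, i.e. the covectors $\dot\gamma\in T_x^*B$ with $\xi_1(x)+[\dot\gamma]=\xi_2(x)$. For local lifts $\xi^{(1)},\xi^{(2)}$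 of $\xi_1,\xi_2$ to $T^*B$ we have $\dot\gamma=\xi^{(2)}(x)-\xi^{(1)}(x)+m$ with $m\in\Lambda_x^*\cong\mathbb Z^n$, and we write $\gamma=(x,m)$. Let $A^\bullet_{r.d.}(P(L_1,L_2))$ be the complex vector space of smooth complex-valued forms $\alpha$ on $P(L_1,L_2)$ such that for all compact $K\subset B$ and all integers $k,l\ge0$ $$\lim_{|\dot\gamma|\to\infty}\ \sup_{x\in K}|\dot\gamma|^k\,|\nabla^l\alpha(x,\gamma)|=0,$$ where $\nabla$ is the flat affine connection and norms are taken with respect to $g$. The Witten differential is $d_{W,\hbar}=d+2\pi\hbar^{-1}\big(\sum_j\dot\gamma_j\,dx^j\big)\wedge$. **The Dolbeault complex.** Let $\mathcal P\to X\times_B\check X$ be the Poincaré line bundle, the quotient of $(T^*B\oplus TB)\times\mathbb C$ by the identifications $$(y,\check y,t)\sim(y+\lambda,\check y,e^{-i\pi(\lambda,\check y)}t),\qquad (y,\check y,t)\sim(y,\check y+\check\lambda,e^{i\pi(y,\check\lambda)}t)\qquad(\lambda\in\Lambda^*,\ \check\lambda\in\Lambda),$$ with the connection $d+i\pi\big((y,d\check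 y)-(\check y,dy)\big)$. Let $\check L_i=(\xi_i\times\mathrm{id})^*\mathcal P\to\check X$. A local lift of $\xi_i$ gives the local frame $\check 1_i$ of $\check L_i$, the class of $(y,\check y,e^{i\pi(y,\check y)})$, in which the connection is $d+2\pi i(\xi^{(i)},d\check y)$. Let $A^{0,\bullet}(\check X,\check L_1^*\otimes\check L_2)$ be the smooth $(0,\bullet)$-forms on $\check X$ with values in $\check L_1^*\otimes\check L_2$, and let $\bar\partial_\hbar$ be the Dolbeault operator given by the $(0,1)$-part of the induced connection; in the frame $\check 1_1^*\otimes\check 1_2$ it is $\bar\partial+i\pi\sum_k(\xi^{(2)}_k-\xi^{(1)}_k)\,d\bar z^k\wedge$. **Claim.** For a rapidly decaying form $\alpha=\sum_I\alpha_I(x,m)\,dx^I$ of degree $|\alpha|$ the series $$\mathcal F(\alpha)=\Big(-\frac{\hbar}{2i}\Big)^{|\alpha|}\sum_{m\in\mathbb Z^n}\sum_I\alpha_I(x,m)\,e^{2\pi i(m,\check y)}\,d\bar z^I\otimes\check 1_1^*\otimes\check 1_2$$ converges absolutely at every point and does not depend on the chosen lifts. Both $(A^\bullet_{r.d.}(P(L_1,L_2)),d_{W,\hbar})$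 and $(A^{0,\bullet}(\check X,\check L_1^*\otimes\check L_2),\bar\partial_\hbar)$ are cochain complexes of complex vector spaces; that is, each differential preserves its space and has square zero. The SYZ transform $$\mathcal F:(A^\bullet_{r.d.}(P(L_1,L_2)),d_{W,\hbar})\to(A^{0,\bullet}(\check X,\check L_1^*\otimes\check L_2),\bar\partial_\hbar)$$ is an isomorphism of differential graded vector spaces: in each degree it is a $\mathbb C$-linear bijection, and $\mathcal F\circ d_{W,\hbar}=\bar\partial_\hbar\circ\mathcal F$. -/

import Mathlib

open scoped Manifold ContDiff TensorProduct Topology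

noncomputable section

namespace SYZ

/-! ## Integral affine manifolds -/

/-- The model space `ℝⁿ` of affine coordinates. -/
abbrev Model (n : ℕ) : Type := Fin n → ℝ

/-- Maps that are locally of the form `x ↦ A x + b` with `A ∈ GL(n, ℤ)` and `b ∈ ℝⁿ`. -/
def integralAffinePregroupoid (n : ℕ) : Pregroupoid (Model n) where
  property f s := ∀ x ∈ s, ∃ (A : GL (Fin n) ℤ) (b : Model n),
    ∀ᶠ y in 𝓝 x, f y = ((A : Matrix (Fin n) (Fin n) ℤ).map (Int.cast : ℤ → ℝ)).mulVec y + b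
  comp := by
    intro f g u v hf hg _ _ _ x hx
    obtain ⟨A, b, hA⟩ := hf x hx.1
    obtain ⟨C, d, hC⟩ := hg (f x) hx.2
    have hcont : ContinuousAt f x := by
      have h1 : ContinuousAt (fun y : Model n =>
          ((A : Matrix (Fin n) (Fin n) ℤ).map (Int.cast : ℤ → ℝ)).mulVec y + b) x := by
        fun_prop
      exact h1.congr (hA.mono fun y hy => hy.symm)
    refine ⟨C * A, ((C : Matrix (Fin n) (Fin n) ℤ).map (Int.cast : ℤ → ℝ)).mulVec b + d, ?_⟩
    filter_upwards [hA, hcont.eventually hC] with y hy1 hy2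
    have hmul : (((C * A : GL (Fin n) ℤ) : Matrix (Fin n) (Fin n) ℤ).map (Int.cast : ℤ → ℝ))
        = (C : Matrix (Fin n) (Fin n) ℤ).map (Int.cast : ℤ → ℝ)
          * (A : Matrix (Fin n) (Fin n) ℤ).map (Int.cast : ℤ → ℝ) := by
      rw [Units.val_mul]
      exact Matrix.map_mul (f := Int.castRingHom ℝ)
    rw [Function.comp_apply, hy2, hy1, hmul, Matrix.mulVec_add, Matrix.mulVec_mulVec, add_assoc]
  id_mem := by
    intro x _
    refine ⟨1, 0, Filter.Eventually.of_forall fun y => ?_⟩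
    simp
  locality := by
    intro f u _ h x hx
    obtain ⟨v, _, hxv, hv⟩ := h x hx
    exact hv x ⟨hx, hxv⟩
  congr := by
    intro f g u hu hfg hf x hx
    obtain ⟨A, b, hA⟩ := hf x hx
    refine ⟨A, b, ?_⟩
    filter_upwards [hA, hu.mem_nhds hx] with y hy hyu
    rw [hfg y hyu, hy]

/-- The groupoid of integral affine changes of coordinates, `GL(n, ℤ) ⋉ ℝⁿ`. -/
def integralAffineGroupoid (n : ℕ) : StructureGroupoid (Model n) :=
  (integralAffinePregroupoid n).groupoid

section Base

variable (n : ℕ) {B : Type*} [TopologicalSpace B] [ChartedSpace (Model n) B]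

/-- The tangent space `T_x B`. -/
abbrev Tan (x : B) : Type := TangentSpace 𝓘(ℝ, Model n) x

/-- The cotangent space `T_x^* B`. -/
abbrev Cotan (x : B) : Type := Tan n x →L[ℝ] ℝ

variable {n}

/-- The derivative at `x` of a chart `e`, i.e. `(dx¹, …, dxⁿ) : T_x B → ℝⁿ`. -/
def toChart (e : OpenPartialHomeomorph B (Model n)) (x : B) : Tan n x →L[ℝ] Model n :=
  (NormedSpace.fromTangentSpace (𝕜 := ℝ) (e x)).toContinuousLinearMap.comp
    (mfderiv 𝓘(ℝ, Model n) 𝓘(ℝ, Model n) e x)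

/-- The inverse of `toChart`: it sends the standard basis of `ℝⁿ` to `∂/∂x¹, …, ∂/∂xⁿ`. -/
def fromChart (e : OpenPartialHomeomorph B (Model n)) (x : B) : Model n →L[ℝ] Tan n x :=
  (toChart e x).inverse

variable (n)

/-- The lattice `Λ_x = ⨁ ℤ ∂/∂xʲ ⊆ T_x B`. -/
def lattice (x : B) : AddSubgroup (Tan n x) where
  carrier := {v | ∀ j, ∃ k : ℤ, toChart (chartAt (Model n) x) x v j = k}
  zero_mem' := fun j => ⟨0, by simp⟩
  add_mem' := by
    intro a b ha hb j
    obtain ⟨k, hk⟩ := ha j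
    obtain ⟨l, hl⟩ := hb j
    exact ⟨k + l, by simp [hk, hl]⟩
  neg_mem' := by
    intro a ha j
    obtain ⟨k, hk⟩ := ha j
    exact ⟨-k, by simp [hk]⟩

/-- The dual lattice `Λ_x^* = ⨁ ℤ dxʲ ⊆ T_x^* B`. -/
def dualLattice (x : B) : AddSubgroup (Cotan n x) where
  carrier := {η | ∀ v ∈ lattice n x, ∃ k : ℤ, η v = k}
  zero_mem' := fun v _ => ⟨0, by simp⟩
  add_mem' := by
    intro a b ha hb v hv
    obtain ⟨k, hk⟩ := ha v hv
    obtain ⟨l, hl⟩ := hb v hv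
    exact ⟨k + l, by simp [hk, hl]⟩
  neg_mem' := by
    intro a ha v hv
    obtain ⟨k, hk⟩ := ha v hv
    exact ⟨-k, by simp [hk]⟩

/-- The fibre `p⁻¹(x) = T_x^* B / Λ_x^*` of `X = T^*B / Λ^*`. -/
abbrev Fiber (x : B) : Type := Cotan n x ⧸ dualLattice n x

/-- The fibre `T_x B / Λ_x` of `X̌ = TB / Λ`. -/
abbrev MirrorFiber (x : B) : Type := Tan n x ⧸ lattice n x

variable {n}

/-- The covector at `x` with components `a = (a₁, …, aₙ)` in the chart `e`, i.e. `∑ aⱼ dxʲ`. -/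
def covector (e : OpenPartialHomeomorph B (Model n)) (x : B) (a : Model n →L[ℝ] ℝ) : Cotan n x :=
  a.comp (toChart e x)

variable (n B)

/-- A Hessian-type Riemannian metric on `B`: around every point, in affine coordinates, it is the
Hessian of a smooth convex function. -/
structure HessianMetric where
  /-- The bilinear form on each tangent space. -/
  toFun : ∀ x : B, Tan n x →L[ℝ] Tan n x →L[ℝ] ℝ
  pos : ∀ (x : B) (v : Tan n x), v ≠ 0 → 0 < toFun x v v
  hessian : ∀ e ∈ atlas (Model n) B, ∀ x ∈ e.source, ∃ (U : Set (Model n)) (φ : Model n → ℝ),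
    IsOpen U ∧ e x ∈ U ∧ U ⊆ e.target ∧ ContDiffOn ℝ ∞ φ U ∧ ConvexOn ℝ U φ ∧
    ∀ u ∈ U, ∀ a b : Model n,
      toFun (e.symm u) (fromChart e (e.symm u) a) (fromChart e (e.symm u) b)
        = fderiv ℝ (fderiv ℝ φ) u a b

variable {n B}

/-- The norm of a covector with respect to `g`. -/
def HessianMetric.conorm (g : HessianMetric n B) (x : B) (η : Cotan n x) : ℝ :=
  sSup {r : ℝ | ∃ v : Tan n x, g.toFun x v v ≤ 1 ∧ r = |η v|}

end Base

/-! ## Lagrangian sections of `X = T^*B / Λ^*` -/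

/-- `ω_ħ = ħ⁻¹ ∑ dyⱼ ∧ dxʲ` on pairs (horizontal vector, vertical covector). -/
def symplecticForm (ħ : ℝ) {V : Type*} [AddCommGroup V] [Module ℝ V] [TopologicalSpace V]
    (a b : V × (V →L[ℝ] ℝ)) : ℝ :=
  ħ⁻¹ * (a.2 b.1 - b.2 a.1)

/-- The `1`-form `γ̇ ⌟ ω_ħ`, for a vertical tangent vector `γ̇` (a covector). -/
def areaForm (ħ : ℝ) {V : Type*} [AddCommGroup V] [Module ℝ V] [TopologicalSpace V]
    (γ : V →L[ℝ] ℝ) : V →L[ℝ] ℝ :=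
  ħ⁻¹ • γ

theorem areaForm_apply (ħ : ℝ) {V : Type*} [AddCommGroup V] [Module ℝ V] [TopologicalSpace V]
    (γ : V →L[ℝ] ℝ) (b : V × (V →L[ℝ] ℝ)) :
    areaForm ħ γ b.1 = symplecticForm ħ (0, γ) b := by
  simp [areaForm, symplecticForm]

section Sections

variable {n : ℕ} {B : Type*} [TopologicalSpace B] [ChartedSpace (Model n) B]

/-- `η : U → ℝⁿ` (components with respect to `dxʲ`) is a smooth lift, in the chart `e`, of the
section `ξ` of `X → B` over the coordinate patch `U`. -/
structure IsLocalLift (ξ : ∀ x : B, Fiber n x) (e : OpenPartialHomeomorph B (Model n))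
    (U : Set (Model n)) (η : Model n → (Model n →L[ℝ] ℝ)) : Prop where
  isOpen : IsOpen U
  subset : U ⊆ e.target
  smooth : ContDiffOn ℝ ∞ η U
  lift : ∀ u ∈ U, (QuotientAddGroup.mk (covector e (e.symm u) (η u)) : Fiber n (e.symm u))
    = ξ (e.symm u)

variable (n B)

/-- A smooth Lagrangian section of `(X, ω_ħ) → B`: it has local lifts to smooth sections of `T^*B`,
and `ω_ħ` vanishes on the tangent spaces of its image. -/
structure LagrangianSection (ħ : ℝ) where
  /-- The underlying section. -/
  toFun : ∀ x : B, Fiber n x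
  exists_lift : ∀ e ∈ atlas (Model n) B, ∀ x ∈ e.source,
    ∃ (U : Set (Model n)) (η : Model n → (Model n →L[ℝ] ℝ)), e x ∈ U ∧ IsLocalLift toFun e U η
  lagrangian : ∀ e ∈ atlas (Model n) B, ∀ (U : Set (Model n)) (η : Model n → (Model n →L[ℝ] ℝ)),
    IsLocalLift toFun e U η → ∀ u ∈ U, ∀ a b : Model n,
      symplecticForm ħ (a, fderiv ℝ η u a) (b, fderiv ℝ η u b) = 0

variable {n B}

/-- A local lift of `ξ` around `x`, in the preferred chart at `x`. -/
def LagrangianSection.liftAt {ħ : ℝ} (ξ : LagrangianSection n B ħ) (x : B) :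
    Model n → (Model n →L[ℝ] ℝ) :=
  (ξ.exists_lift (chartAt (Model n) x) (chart_mem_atlas _ x) x (mem_chart_source _ x)).choose_spec.choose

theorem LagrangianSection.liftAt_spec {ħ : ℝ} (ξ : LagrangianSection n B ħ) (x : B) :
    ∃ U : Set (Model n), chartAt (Model n) x x ∈ U ∧
      IsLocalLift ξ.toFun (chartAt (Model n) x) U (ξ.liftAt x) :=
  ⟨_, (ξ.exists_lift (chartAt (Model n) x) (chart_mem_atlas _ x) x
    (mem_chart_source _ x)).choose_spec.choose_spec⟩

theorem LagrangianSection.mk_liftAt {ħ : ℝ} (ξ : LagrangianSection n B ħ) (x : B) :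
    (QuotientAddGroup.mk (covector (chartAt (Model n) x) x
      (ξ.liftAt x (chartAt (Model n) x x))) : Fiber n x) = ξ.toFun x := by
  obtain ⟨U, hU, h⟩ := ξ.liftAt_spec x
  have := h.lift _ hU
  rwa [(chartAt (Model n) x).left_inv (mem_chart_source _ x)] at this

end Sections

/-! ## The fiberwise geodesic path space and the Witten complex -/

section Witten

variable {n : ℕ} {B : Type*} [TopologicalSpace B] [ChartedSpace (Model n) B] {ħ : ℝ}

/-- A point of `P(L₁, L₂)`: a point `x ∈ B` with a geodesic `t ↦ ξ₁(x) + t γ̇`, `0 ≤ t ≤ 1`, of the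
torus `p⁻¹(x)` from `ξ₁(x)` to `ξ₂(x)`, recorded by its velocity `γ̇ ∈ T_x^* B`. Every homotopy
class of paths in the torus with these end points contains exactly one such geodesic. -/
structure PathSpace (ξ₁ ξ₂ : LagrangianSection n B ħ) where
  base : B
  velocity : Cotan n base
  endpoint : ξ₁.toFun base + QuotientAddGroup.mk velocity = ξ₂.toFun base

variable (ξ₁ ξ₂ : LagrangianSection n B ħ)

/-- (Not necessarily smooth) complex-valued `q`-forms on `P(L₁, L₂)`; the covering `P(L₁, L₂) → B`
identifies the tangent space at `γ` with `T_x B`, where `x` is the base point of `γ`. -/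
abbrev PathForm (q : ℕ) : Type _ := ∀ γ : PathSpace ξ₁ ξ₂, Tan n γ.base [⋀^Fin q]→L[ℝ] ℂ

variable {ξ₁ ξ₂}

/-- `w : U → ℝⁿ` gives, in the chart `e`, the velocities of a smooth local section over `U` of the
covering `P(L₁, L₂) → B`; these sections are the inverses of the affine charts of `P(L₁, L₂)`. -/
structure IsBranch (ξ₁ ξ₂ : LagrangianSection n B ħ) (e : OpenPartialHomeomorph B (Model n))
    (U : Set (Model n)) (w : Model n → (Model n →L[ℝ] ℝ)) : Prop where
  isOpen : IsOpen U
  subset : U ⊆ e.target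
  smooth : ContDiffOn ℝ ∞ w U
  mem : ∀ u ∈ U, ξ₁.toFun (e.symm u) + QuotientAddGroup.mk (covector e (e.symm u) (w u))
    = ξ₂.toFun (e.symm u)

open Classical in
/-- The expression of a form on `P(L₁, L₂)` in affine coordinates, along a branch `w`. -/
def PathForm.localRep {q : ℕ} (α : PathForm ξ₁ ξ₂ q) (e : OpenPartialHomeomorph B (Model n))
    (w : Model n → (Model n →L[ℝ] ℝ)) (u : Model n) : Model n [⋀^Fin q]→L[ℝ] ℂ :=
  if h : ξ₁.toFun (e.symm u) + QuotientAddGroup.mk (covector e (e.symm u) (w u))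
      = ξ₂.toFun (e.symm u) then
    (α ⟨e.symm u, covector e (e.symm u) (w u), h⟩).compContinuousLinearMap
      (fromChart e (e.symm u))
  else 0

/-- Smooth forms on `P(L₁, L₂)`. -/
def PathForm.IsSmooth {q : ℕ} (α : PathForm ξ₁ ξ₂ q) : Prop :=
  ∀ e ∈ atlas (Model n) B, ∀ U w, IsBranch ξ₁ ξ₂ e U w → ContDiffOn ℝ ∞ (α.localRep e w) U

/-- Rapid decay: for all compact `K ⊆ B` and `k, l ≥ 0`, the supremum over `x ∈ K` of
`|γ̇|ᵏ |∇ˡ α (x, γ)|` tends to `0` as `|γ̇| → ∞`. In affine coordinates `∇ˡ` is the `l`-th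
derivative; its norm is the supremum of its values on vectors of `g`-length at most one. -/
def PathForm.RapidlyDecays {q : ℕ} (α : PathForm ξ₁ ξ₂ q) (g : HessianMetric n B) : Prop :=
  ∀ K : Set B, IsCompact K → ∀ k l : ℕ, ∀ ε > (0 : ℝ), ∃ R : ℝ,
    ∀ e ∈ atlas (Model n) B, ∀ U w, IsBranch ξ₁ ξ₂ e U w → ∀ u ∈ U, e.symm u ∈ K →
      R ≤ g.conorm (e.symm u) (covector e (e.symm u) (w u)) →
      ∀ (a : Fin l → Model n) (b : Fin q → Model n),
        (∀ i, g.toFun (e.symm u) (fromChart e (e.symm u) (a i)) (fromChart e (e.symm u) (a i)) ≤ 1) →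
        (∀ i, g.toFun (e.symm u) (fromChart e (e.symm u) (b i)) (fromChart e (e.symm u) (b i)) ≤ 1) →
        g.conorm (e.symm u) (covector e (e.symm u) (w u)) ^ k
          * ‖iteratedFDeriv ℝ l (α.localRep e w) u a b‖ ≤ ε

theorem PathForm.localRep_add {q : ℕ} (α β : PathForm ξ₁ ξ₂ q)
    (e : OpenPartialHomeomorph B (Model n)) (w : Model n → (Model n →L[ℝ] ℝ)) :
    (α + β).localRep e w = α.localRep e w + β.localRep e w := by
  funext u
  by_cases h : ξ₁.toFun (e.symm u) + QuotientAddGroup.mk (covector e (e.symm u) (w u))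
      = ξ₂.toFun (e.symm u)
  · simp only [PathForm.localRep, Pi.add_apply, dif_pos h]
    rfl
  · simp [PathForm.localRep, h]

theorem PathForm.localRep_smul {q : ℕ} (c : ℂ) (α : PathForm ξ₁ ξ₂ q)
    (e : OpenPartialHomeomorph B (Model n)) (w : Model n → (Model n →L[ℝ] ℝ)) :
    (c • α).localRep e w = c • α.localRep e w := by
  funext u
  by_cases h : ξ₁.toFun (e.symm u) + QuotientAddGroup.mk (covector e (e.symm u) (w u))
      = ξ₂.toFun (e.symm u)
  · simp only [PathForm.localRep, Pi.smul_apply, dif_pos h]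
    rfl
  · simp only [PathForm.localRep, Pi.smul_apply, dif_neg h]
    ext v
    exact (mul_zero c).symm

theorem PathForm.localRep_zero {q : ℕ}
    (e : OpenPartialHomeomorph B (Model n)) (w : Model n → (Model n →L[ℝ] ℝ)) :
    (0 : PathForm ξ₁ ξ₂ q).localRep e w = 0 := by
  funext u
  by_cases h : ξ₁.toFun (e.symm u) + QuotientAddGroup.mk (covector e (e.symm u) (w u))
      = ξ₂.toFun (e.symm u)
  · simp only [PathForm.localRep, dif_pos h]
    rfl
  · simp [PathForm.localRep, h]

variable (ξ₁ ξ₂)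

/-- The space `A^q_{r.d.}(P(L₁, L₂))` of smooth rapidly decaying `q`-forms. -/
def rapidForms (g : HessianMetric n B) (q : ℕ) : Submodule ℂ (PathForm ξ₁ ξ₂ q) where
  carrier := {α | α.IsSmooth ∧ α.RapidlyDecays g}
  zero_mem' := by
    refine ⟨fun e _ U w _ => ?_, fun K _ k l ε hε => ⟨0, ?_⟩⟩
    · rw [PathForm.localRep_zero]
      exact contDiffOn_const
    · intro e _ U w _ u _ _ _ a b _ _
      rw [PathForm.localRep_zero]
      have : iteratedFDeriv ℝ l (0 : Model n → Model n [⋀^Fin q]→L[ℝ] ℂ) u = 0 := by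
        exact congrFun (iteratedFDeriv_fun_zero (𝕜 := ℝ) (n := l)) u
      rw [this]
      simpa using hε.le
  add_mem' := by
    rintro α β ⟨hα, hα'⟩ ⟨hβ, hβ'⟩
    refine ⟨fun e he U w hw => ?_, fun K hK k l ε hε => ?_⟩
    · rw [PathForm.localRep_add]
      exact (hα e he U w hw).add (hβ e he U w hw)
    · obtain ⟨R, hR⟩ := hα' K hK k l (ε / 2) (half_pos hε)
      obtain ⟨S, hS⟩ := hβ' K hK k l (ε / 2) (half_pos hε)
      refine ⟨max R S, ?_⟩
      intro e he U w hw u hu huK hc a b ha hb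
      have h1 := hR e he U w hw u hu huK (le_trans (le_max_left _ _) hc) a b ha hb
      have h2 := hS e he U w hw u hu huK (le_trans (le_max_right _ _) hc) a b ha hb
      have s1 : ContDiffAt ℝ l (α.localRep e w) u :=
        ((hα e he U w hw).contDiffAt (hw.isOpen.mem_nhds hu)).of_le (by exact_mod_cast le_top)
      have s2 : ContDiffAt ℝ l (β.localRep e w) u :=
        ((hβ e he U w hw).contDiffAt (hw.isOpen.mem_nhds hu)).of_le (by exact_mod_cast le_top)
      have hc0 : 0 ≤ g.conorm (e.symm u) (covector e (e.symm u) (w u)) := by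
        apply Real.sSup_nonneg
        rintro r ⟨v, _, rfl⟩
        exact abs_nonneg _
      rw [PathForm.localRep_add, iteratedFDeriv_add_apply s1 s2]
      calc _ ≤ g.conorm (e.symm u) (covector e (e.symm u) (w u)) ^ k *
            (‖iteratedFDeriv ℝ l (α.localRep e w) u a b‖
              + ‖iteratedFDeriv ℝ l (β.localRep e w) u a b‖) :=
            mul_le_mul_of_nonneg_left (norm_add_le _ _) (pow_nonneg hc0 _)
        _ ≤ ε := by rw [mul_add]; linarith
  smul_mem' := by
    rintro c α ⟨hα, hα'⟩
    refine ⟨fun e he U w hw => ?_, fun K hK k l ε hε => ?_⟩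
    · rw [PathForm.localRep_smul]
      exact (hα e he U w hw).const_smul c
    · obtain ⟨R, hR⟩ := hα' K hK k l (ε / (‖c‖ + 1)) (by positivity)
      refine ⟨R, ?_⟩
      intro e he U w hw u hu huK hc a b ha hb
      have h1 := hR e he U w hw u hu huK hc a b ha hb
      have s1 : ContDiffAt ℝ l (α.localRep e w) u :=
        ((hα e he U w hw).contDiffAt (hw.isOpen.mem_nhds hu)).of_le (by exact_mod_cast le_top)
      rw [PathForm.localRep_smul, iteratedFDeriv_const_smul_apply s1]
      have h2 : ‖(c • iteratedFDeriv ℝ l (α.localRep e w) u) a b‖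
          = ‖c‖ * ‖iteratedFDeriv ℝ l (α.localRep e w) u a b‖ := norm_smul _ _
      rw [h2]
      have h3 : (0 : ℝ) < ‖c‖ + 1 := by positivity
      rw [le_div_iff₀ h3] at h1
      have hc0 : 0 ≤ g.conorm (e.symm u) (covector e (e.symm u) (w u)) := by
        apply Real.sSup_nonneg
        rintro r ⟨v, _, rfl⟩
        exact abs_nonneg _
      have h4 : 0 ≤ g.conorm (e.symm u) (covector e (e.symm u) (w u)) ^ k
          * ‖iteratedFDeriv ℝ l (α.localRep e w) u a b‖ := by positivity
      nlinarith

variable {ξ₁ ξ₂}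

/-- The branch of `P(L₁, L₂) → B` through `γ`, in the preferred chart at the base point. -/
def PathSpace.branchAt (γ : PathSpace ξ₁ ξ₂) : Model n → (Model n →L[ℝ] ℝ) :=
  fun u => (ξ₂.liftAt γ.base u - ξ₁.liftAt γ.base u)
    + (γ.velocity.comp (fromChart (chartAt (Model n) γ.base) γ.base)
      - (ξ₂.liftAt γ.base (chartAt (Model n) γ.base γ.base)
        - ξ₁.liftAt γ.base (chartAt (Model n) γ.base γ.base)))

/-- The Witten differential `d_{W,ħ} = d + 2π (γ̇ ⌟ ω_ħ) ∧`. -/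
def wittenD {q : ℕ} (α : PathForm ξ₁ ξ₂ q) : PathForm ξ₁ ξ₂ (q + 1) := fun γ =>
  let e := chartAt (Model n) γ.base
  let f := α.localRep e γ.branchAt
  let θ : Model n →L[ℝ] ℂ := Complex.ofRealCLM.comp
    ((2 * Real.pi) • areaForm ħ (γ.velocity.comp (fromChart e γ.base)))
  (ContinuousAlternatingMap.alternatizeUncurryFin
    (fderiv ℝ f (e γ.base) + θ.smulRight (f (e γ.base)))).compContinuousLinearMap
      (toChart e γ.base)

end Witten

/-! ## The mirror manifold and the mirror line bundles -/

section Mirror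

variable (n : ℕ) (B : Type*) [TopologicalSpace B] [ChartedSpace (Model n) B]

/-- The points of `X̌ = TB / Λ`. -/
structure Mirror where
  base : B
  fib : MirrorFiber n base

variable {n B}

/-- The tangent space of `X̌`: pairs (coefficients of `∂/∂xʲ`, coefficients of `∂/∂y̌ʲ`). -/
abbrev Mirror.Tan (z : Mirror n B) : Type := SYZ.Tan n z.base × SYZ.Tan n z.base

/-- The complex structure: `J(∂/∂xʲ) = -ħ⁻¹ ∂/∂y̌ʲ` and `J(∂/∂y̌ʲ) = ħ ∂/∂xʲ`. -/
def complexStructure (ħ : ℝ) (V : Type*) [AddCommGroup V] [Module ℝ V] [TopologicalSpace V]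
    [IsTopologicalAddGroup V] [ContinuousSMul ℝ V] : V × V →L[ℝ] V × V :=
  (ħ • ContinuousLinearMap.snd ℝ V V).prod (-(ħ⁻¹ • ContinuousLinearMap.fst ℝ V V))

/-- The `1`-form `dz̄ʲ = dy̌ʲ - i ħ⁻¹ dxʲ`, in the preferred affine coordinates at the point. -/
def dzbar (ħ : ℝ) (z : Mirror n B) (j : Fin n) : z.Tan →ₗ[ℝ] ℂ where
  toFun w := (toChart (chartAt (Model n) z.base) z.base w.2 j : ℂ)
    - Complex.I * (ħ : ℂ)⁻¹ * (toChart (chartAt (Model n) z.base) z.base w.1 j : ℂ)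
  map_add' v w := by simp; ring
  map_smul' c w := by simp; ring

/-- The determinant of complex row vectors as an `ℝ`-multilinear alternating map. -/
def realDet (q : ℕ) : (Fin q → ℂ) [⋀^Fin q]→ₗ[ℝ] ℂ where
  toMultilinearMap := MultilinearMap.restrictScalars ℝ
    (Matrix.detRowAlternating : (Fin q → ℂ) [⋀^Fin q]→ₗ[ℂ] ℂ).toMultilinearMap
  map_eq_zero_of_eq' v _ _ h hij :=
    (Matrix.detRowAlternating : (Fin q → ℂ) [⋀^Fin q]→ₗ[ℂ] ℂ).map_eq_zero_of_eq v h hij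

/-- `dz̄^I = dz̄^{I₁} ∧ ⋯ ∧ dz̄^{I_q}`. -/
def dzbarForm (ħ : ℝ) (z : Mirror n B) {q : ℕ} (I : Fin q → Fin n) :
    z.Tan [⋀^Fin q]→ₗ[ℝ] ℂ :=
  (realDet q).compLinearMap (LinearMap.pi fun a => dzbar ħ z (I a))

/-- The lifts to `T_x^* B` of a point of the torus `T_x^* B / Λ_x^*`. -/
abbrev Lift {x : B} (η : Fiber n x) : Type := {y : Cotan n x // (QuotientAddGroup.mk y : Fiber n x) = η}

/-- The lifts to `T_x B` of a point of the torus `T_x B / Λ_x`. -/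
abbrev MirrorLift {x : B} (v : MirrorFiber n x) : Type :=
  {y : Tan n x // (QuotientAddGroup.mk y : MirrorFiber n x) = v}

/-- The fibre of the Poincaré bundle `𝒫 = ((T^*B ⊕ TB) × ℂ) / (Λ^* ⊕ Λ)` at a point `(η, v)` of
`X ×_B X̌`. The lattices act by `λ • (y, y̌, t) = (y + λ, y̌, e^{-iπ(λ, y̌)} t)` and
`λ̌ • (y, y̌, t) = (y, y̌ + λ̌, e^{iπ(y, λ̌)} t)`; an orbit over `(η, v)` is the graph of a function
`(y, y̌) ↦ t` on the lifts of `(η, v)`, and these functions are the elements of the fibre. -/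
def poincareFiber {x : B} (η : Fiber n x) (v : MirrorFiber n x) :
    Submodule ℂ (Lift η → MirrorLift v → ℂ) where
  carrier := {f |
    (∀ (y y' : Lift η) (w : MirrorLift v),
      f y' w = Complex.exp (-(Complex.I * Real.pi * ((y'.1 - y.1) w.1 : ℝ))) * f y w) ∧
    (∀ (y : Lift η) (w w' : MirrorLift v),
      f y w' = Complex.exp (Complex.I * Real.pi * (y.1 (w'.1 - w.1) : ℝ)) * f y w)}
  zero_mem' := by simp
  add_mem' := by
    rintro f g ⟨hf, hf'⟩ ⟨hg, hg'⟩
    refine ⟨fun y y' w => ?_, fun y w w' => ?_⟩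
    · simp only [Pi.add_apply]
      rw [hf y y' w, hg y y' w, mul_add]
    · simp only [Pi.add_apply]
      rw [hf' y w w', hg' y w w', mul_add]
  smul_mem' := by
    rintro c f ⟨hf, hf'⟩
    refine ⟨fun y y' w => ?_, fun y w w' => ?_⟩
    · simp only [Pi.smul_apply, smul_eq_mul]
      rw [hf y y' w]; ring
    · simp only [Pi.smul_apply, smul_eq_mul]
      rw [hf' y w w']; ring

theorem mem_lattice_of_lifts {x : B} {v : MirrorFiber n x} (w w' : MirrorLift v) :
    w'.1 - w.1 ∈ lattice n x := by
  have h : (QuotientAddGroup.mk w.1 : MirrorFiber n x) = QuotientAddGroup.mk w'.1 :=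
    w.2.trans w'.2.symm
  rw [QuotientAddGroup.eq] at h
  rwa [sub_eq_neg_add]

theorem mem_dualLattice_of_lifts {x : B} {η : Fiber n x} (y y' : Lift η) :
    y'.1 - y.1 ∈ dualLattice n x := by
  have h : (QuotientAddGroup.mk y.1 : Fiber n x) = QuotientAddGroup.mk y'.1 :=
    y.2.trans y'.2.symm
  rw [QuotientAddGroup.eq] at h
  rwa [sub_eq_neg_add]

/-- The frame `1̌` of `𝒫` determined by a lift `y₀` of `η`: the class of `(y₀, y̌, e^{iπ(y₀, y̌)})`,
which does not depend on the lift `y̌`. -/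
def frame {x : B} {η : Fiber n x} (v : MirrorFiber n x) (y₀ : Lift η) : poincareFiber η v :=
  ⟨fun y w => Complex.exp (Complex.I * Real.pi * (((2 : ℝ) • y₀.1 - y.1) w.1 : ℝ)), by
    refine ⟨fun y y' w => ?_, fun y w w' => ?_⟩
    · rw [← Complex.exp_add]
      simp
      ring_nf
    · obtain ⟨k, hk⟩ := mem_dualLattice_of_lifts y y₀ _ (mem_lattice_of_lifts w w')
      rw [← Complex.exp_add, Complex.exp_eq_exp_iff_exists_int]
      refine ⟨k, ?_⟩
      have hk' : ((y₀.1 w'.1 : ℝ) : ℂ) - y₀.1 w.1 - (y.1 w'.1 - y.1 w.1) = k := by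
        have : y₀.1 w'.1 - y₀.1 w.1 - (y.1 w'.1 - y.1 w.1) = (k : ℝ) := by
          rw [← hk]; simp
        exact_mod_cast this
      rw [← hk']
      simp
      ring⟩

theorem frame_apply {x : B} {η : Fiber n x} (v : MirrorFiber n x) (y₀ : Lift η)
    (w : MirrorLift v) :
    (frame v y₀).1 y₀ w = Complex.exp (Complex.I * Real.pi * (y₀.1 w.1 : ℝ)) := by
  simp only [frame]
  congr 3
  rw [two_smul, add_sub_cancel_right]

/-- The dual frame `1̌^*`: the coefficient with respect to `frame v y₀`, computed with a lift `w`
of `v` (on which it does not depend). -/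
def coframe {x : B} {η : Fiber n x} {v : MirrorFiber n x} (y₀ : Lift η) (w : MirrorLift v) :
    poincareFiber η v →ₗ[ℂ] ℂ where
  toFun f := Complex.exp (-(Complex.I * Real.pi * (y₀.1 w.1 : ℝ))) * f.1 y₀ w
  map_add' f g := by simp [mul_add]
  map_smul' c f := by simp; ring

variable {ħ : ℝ}

/-- The fibre at `z = (x, v)` of the mirror bundle `Ľ = (ξ × id)^* 𝒫`. -/
abbrev mirrorBundle (ξ : LagrangianSection n B ħ) (z : Mirror n B) : Type :=
  poincareFiber (ξ.toFun z.base) z.fib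

/-- The fibre at `z` of `Ľ₁^* ⊗ Ľ₂`. -/
abbrev homBundle (ξ₁ ξ₂ : LagrangianSection n B ħ) (z : Mirror n B) : Type :=
  Module.Dual ℂ (mirrorBundle ξ₁ z) ⊗[ℂ] mirrorBundle ξ₂ z

variable {ξ₁ ξ₂ : LagrangianSection n B ħ}

/-- The frame `1̌₁^* ⊗ 1̌₂` of `Ľ₁^* ⊗ Ľ₂` at `z`. -/
def homFrame {z : Mirror n B} (y₁ : Lift (ξ₁.toFun z.base)) (y₂ : Lift (ξ₂.toFun z.base))
    (w : MirrorLift z.fib) : homBundle ξ₁ ξ₂ z :=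
  (coframe y₁ w : Module.Dual ℂ (mirrorBundle ξ₁ z)) ⊗ₜ[ℂ] (frame z.fib y₂ : mirrorBundle ξ₂ z)

/-- The coefficient of an element of `Ľ₁^* ⊗ Ľ₂` with respect to `1̌₁^* ⊗ 1̌₂`. -/
def homCoeff {z : Mirror n B} (y₁ : Lift (ξ₁.toFun z.base)) (y₂ : Lift (ξ₂.toFun z.base))
    (w : MirrorLift z.fib) : homBundle ξ₁ ξ₂ z →ₗ[ℂ] ℂ :=
  TensorProduct.lift ((LinearMap.lsmul ℂ (Module.Dual ℂ (mirrorBundle ξ₂ z))).flip (coframe y₂ w)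
    ∘ₗ LinearMap.applyₗ (frame z.fib y₁ : mirrorBundle ξ₁ z))

end Mirror

/-! ## The Dolbeault complex of `Ľ₁^* ⊗ Ľ₂` -/

section Dolbeault

/-- Alternating maps on a finite-dimensional space are continuous. -/
theorem continuous_alternating {V : Type*} [NormedAddCommGroup V] [NormedSpace ℝ V]
    [FiniteDimensional ℝ V] {q : ℕ} (f : V [⋀^Fin q]→ₗ[ℝ] ℂ) : Continuous f := by
  have h : ∀ v : Fin q → V, f v = ∑ r : Fin q → Fin (Module.finrank ℝ V),
      (∏ i, (Module.finBasis ℝ V).repr (v i) (r i)) • f fun i => Module.finBasis ℝ V (r i) := by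
    intro v
    conv_lhs => rw [show v = fun i => ∑ j, (Module.finBasis ℝ V).repr (v i) j •
      Module.finBasis ℝ V j from funext fun i => ((Module.finBasis ℝ V).sum_repr (v i)).symm]
    have := f.toMultilinearMap.map_sum (fun i j => (Module.finBasis ℝ V).repr (v i) j •
      Module.finBasis ℝ V j)
    refine this.trans (Finset.sum_congr rfl fun r _ => ?_)
    exact f.toMultilinearMap.map_smul_univ _ _
  rw [show (f : (Fin q → V) → ℂ) = _ from funext h]
  refine continuous_finsetSum _ fun r _ => ?_
  refine Continuous.fun_smul ?_ continuous_const
  refine continuous_finsetProd _ fun i _ => ?_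
  exact ((Module.finBasis ℝ V).coord (r i)).continuous_of_finiteDimensional.comp
    (continuous_apply i)

/-- An alternating map on a finite-dimensional space as a continuous one. -/
def toContinuousAlternating {V : Type*} [NormedAddCommGroup V] [NormedSpace ℝ V]
    [FiniteDimensional ℝ V] {q : ℕ} (f : V [⋀^Fin q]→ₗ[ℝ] ℂ) : V [⋀^Fin q]→L[ℝ] ℂ :=
  { f with cont := continuous_alternating f }

variable {n : ℕ} {B : Type*} [TopologicalSpace B] [ChartedSpace (Model n) B] {ħ : ℝ}
  (ξ₁ ξ₂ : LagrangianSection n B ħ)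

/-- (Not necessarily smooth) `q`-forms on `X̌` with values in `Ľ₁^* ⊗ Ľ₂`. -/
abbrev MirrorForm (q : ℕ) : Type _ := ∀ z : Mirror n B, z.Tan [⋀^Fin q]→ₗ[ℝ] homBundle ξ₁ ξ₂ z

variable {ξ₁ ξ₂}

/-- A form is of type `(0, q)` if it is conjugate-linear in every argument. -/
def MirrorForm.IsZeroQ {q : ℕ} (β : MirrorForm ξ₁ ξ₂ q) : Prop :=
  ∀ (z : Mirror n B) (w : Fin q → z.Tan) (i : Fin q),
    β z (Function.update w i (complexStructure ħ (Tan n z.base) (w i))) = -Complex.I • β z w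

open Classical in
/-- The coefficient form of `β` with respect to the frame `1̌₁^* ⊗ 1̌₂` given by lifts `η₁, η₂`
of `ξ₁, ξ₂`, in the coordinates `(x, y̌)` of `X̌` given by the chart `e`. -/
def MirrorForm.localCoeff {q : ℕ} (β : MirrorForm ξ₁ ξ₂ q)
    (e : OpenPartialHomeomorph B (Model n)) (η₁ η₂ : Model n → (Model n →L[ℝ] ℝ))
    (p : Model n × Model n) : (Model n × Model n) [⋀^Fin q]→L[ℝ] ℂ :=
  if h : (QuotientAddGroup.mk (covector e (e.symm p.1) (η₁ p.1)) : Fiber n (e.symm p.1))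
        = ξ₁.toFun (e.symm p.1) ∧
      (QuotientAddGroup.mk (covector e (e.symm p.1) (η₂ p.1)) : Fiber n (e.symm p.1))
        = ξ₂.toFun (e.symm p.1) then
    let ι := fromChart e (e.symm p.1)
    let z : Mirror n B := ⟨e.symm p.1, QuotientAddGroup.mk (ι p.2)⟩
    let c : homBundle ξ₁ ξ₂ z →ₗ[ℂ] ℂ := homCoeff ⟨_, h.1⟩ ⟨_, h.2⟩ ⟨ι p.2, rfl⟩
    toContinuousAlternating (((c.restrictScalars ℝ).compAlternatingMap (β z)).compLinearMap
      (ι.prodMap ι).toLinearMap)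
  else 0

/-- Smooth forms on `X̌` with values in `Ľ₁^* ⊗ Ľ₂`: the coefficients are smooth in `(x, y̌)`. -/
def MirrorForm.IsSmooth {q : ℕ} (β : MirrorForm ξ₁ ξ₂ q) : Prop :=
  ∀ e ∈ atlas (Model n) B, ∀ U η₁ η₂, IsLocalLift ξ₁.toFun e U η₁ → IsLocalLift ξ₂.toFun e U η₂ →
    ContDiffOn ℝ ∞ (β.localCoeff e η₁ η₂) (U ×ˢ Set.univ)

theorem MirrorForm.localCoeff_add {q : ℕ} (β γ : MirrorForm ξ₁ ξ₂ q)
    (e : OpenPartialHomeomorph B (Model n)) (η₁ η₂ : Model n → (Model n →L[ℝ] ℝ)) :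
    (β + γ).localCoeff e η₁ η₂ = β.localCoeff e η₁ η₂ + γ.localCoeff e η₁ η₂ := by
  funext p
  by_cases h : (QuotientAddGroup.mk (covector e (e.symm p.1) (η₁ p.1)) : Fiber n (e.symm p.1))
        = ξ₁.toFun (e.symm p.1) ∧
      (QuotientAddGroup.mk (covector e (e.symm p.1) (η₂ p.1)) : Fiber n (e.symm p.1))
        = ξ₂.toFun (e.symm p.1)
  · simp only [MirrorForm.localCoeff, Pi.add_apply, dif_pos h]
    ext v
    exact map_add (homCoeff _ _ _) _ _
  · simp [MirrorForm.localCoeff, h]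

theorem MirrorForm.localCoeff_smul {q : ℕ} (c : ℂ) (β : MirrorForm ξ₁ ξ₂ q)
    (e : OpenPartialHomeomorph B (Model n)) (η₁ η₂ : Model n → (Model n →L[ℝ] ℝ)) :
    (c • β).localCoeff e η₁ η₂ = c • β.localCoeff e η₁ η₂ := by
  funext p
  by_cases h : (QuotientAddGroup.mk (covector e (e.symm p.1) (η₁ p.1)) : Fiber n (e.symm p.1))
        = ξ₁.toFun (e.symm p.1) ∧
      (QuotientAddGroup.mk (covector e (e.symm p.1) (η₂ p.1)) : Fiber n (e.symm p.1))
        = ξ₂.toFun (e.symm p.1)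
  · simp only [MirrorForm.localCoeff, Pi.smul_apply, dif_pos h]
    ext v
    exact map_smul (homCoeff _ _ _) _ _
  · simp only [MirrorForm.localCoeff, Pi.smul_apply, dif_neg h]
    ext v
    exact (mul_zero c).symm

variable (ξ₁ ξ₂)

/-- The space `A^{0,q}(X̌, Ľ₁^* ⊗ Ľ₂)`. -/
def dolbeaultForms (q : ℕ) : Submodule ℂ (MirrorForm ξ₁ ξ₂ q) where
  carrier := {β | β.IsSmooth ∧ β.IsZeroQ}
  zero_mem' := by
    refine ⟨fun e _ U η₁ η₂ _ _ => ?_, fun z w i => ?_⟩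
    · have : (0 : MirrorForm ξ₁ ξ₂ q).localCoeff e η₁ η₂ = 0 := by
        have h := MirrorForm.localCoeff_smul (0 : ℂ) (0 : MirrorForm ξ₁ ξ₂ q) e η₁ η₂
        rw [zero_smul] at h
        refine h.trans ?_
        ext p v
        exact zero_mul _
      rw [this]
      exact contDiffOn_const
    · simp
  add_mem' := by
    rintro β γ ⟨hβ, hβ'⟩ ⟨hγ, hγ'⟩
    refine ⟨fun e he U η₁ η₂ h₁ h₂ => ?_, fun z w i => ?_⟩
    · rw [MirrorForm.localCoeff_add]
      exact (hβ e he U η₁ η₂ h₁ h₂).add (hγ e he U η₁ η₂ h₁ h₂)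
    · rw [Pi.add_apply, AlternatingMap.add_apply, hβ' z w i, hγ' z w i, AlternatingMap.add_apply,
        smul_add]
  smul_mem' := by
    rintro c β ⟨hβ, hβ'⟩
    refine ⟨fun e he U η₁ η₂ h₁ h₂ => ?_, fun z w i => ?_⟩
    · rw [MirrorForm.localCoeff_smul]
      exact (hβ e he U η₁ η₂ h₁ h₂).const_smul c
    · rw [Pi.smul_apply, AlternatingMap.smul_apply, hβ' z w i, AlternatingMap.smul_apply,
        smul_comm]

variable {ξ₁ ξ₂}

/-- The form `c ⊗ s` with values in the line spanned by `s`, for a complex-valued form `c`. -/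
def tensorFrame {V W : Type*} [AddCommGroup V] [Module ℝ V] [AddCommGroup W] [Module ℂ W] {q : ℕ}
    (c : V [⋀^Fin q]→ₗ[ℝ] ℂ) (s : W) : V [⋀^Fin q]→ₗ[ℝ] W :=
  ((LinearMap.toSpanSingleton ℂ W s).restrictScalars ℝ).compAlternatingMap c

/-- The Dolbeault operator `∂̄_ħ = ∑ dz̄ᵏ ∧ ∇_{∂/∂z̄ᵏ}` of `Ľ₁^* ⊗ Ľ₂`, where `∇` is the connection
induced by `∇_𝒫`, so `∇ = d + 2πi (ξ₂ - ξ₁, dy̌)` in the frame `1̌₁^* ⊗ 1̌₂`. Below, `D v` is the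
covariant derivative along `v` of the coefficient form and `D + i D ∘ J`, halved, is the
`(0,1)`-part of `D`. -/
def dolbeaultD {q : ℕ} (β : MirrorForm ξ₁ ξ₂ q) : MirrorForm ξ₁ ξ₂ (q + 1) := fun z =>
  let e := chartAt (Model n) z.base
  let η₁ := ξ₁.liftAt z.base
  let η₂ := ξ₂.liftAt z.base
  let w : MirrorLift z.fib := ⟨z.fib.out, Quotient.out_eq _⟩
  let p : Model n × Model n := (e z.base, toChart e z.base w.1)
  let b := β.localCoeff e η₁ η₂
  let θ : Model n × Model n →L[ℝ] ℂ := (2 * Real.pi * Complex.I : ℂ) •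
    (Complex.ofRealCLM.comp ((η₂ p.1 - η₁ p.1).comp (ContinuousLinearMap.snd ℝ _ _)))
  let D := fderiv ℝ b p + θ.smulRight (b p)
  let Dbar := (1 / 2 : ℂ) • (D + Complex.I • D.comp (complexStructure ħ (Model n)))
  tensorFrame
    ((ContinuousAlternatingMap.alternatizeUncurryFin Dbar).toAlternatingMap.compLinearMap
      ((toChart e z.base).prodMap (toChart e z.base)).toLinearMap)
    (homFrame ⟨_, ξ₁.mk_liftAt z.base⟩ ⟨_, ξ₂.mk_liftAt z.base⟩ w)

end Dolbeault

/-! ## The SYZ transform -/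

section Transform

variable {n : ℕ} {B : Type*} [TopologicalSpace B] [ChartedSpace (Model n) B] {ħ : ℝ}
  {ξ₁ ξ₂ : LagrangianSection n B ħ}

/-- The path from `ξ₁(x)` to `ξ₂(x)` that corresponds to `m ∈ Λ_x^* ≅ ℤⁿ` when lifts `y₁, y₂` of
`ξ₁(x), ξ₂(x)` are given; its velocity is `y₂ - y₁ + m`. -/
def pathOf {x : B} (y₁ : Lift (ξ₁.toFun x)) (y₂ : Lift (ξ₂.toFun x)) (m : dualLattice n x) :
    PathSpace ξ₁ ξ₂ where
  base := x
  velocity := y₂.1 - y₁.1 + m.1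
  endpoint := by
    have hm : (QuotientAddGroup.mk m.1 : Fiber n x) = 0 := (QuotientAddGroup.eq_zero_iff _).2 m.2
    have h : (QuotientAddGroup.mk (y₂.1 - y₁.1 + m.1) : Fiber n x)
        = QuotientAddGroup.mk y₂.1 - QuotientAddGroup.mk y₁.1 + QuotientAddGroup.mk m.1 := rfl
    rw [h, hm, y₁.2, y₂.2]
    abel

/-- The term `α_I(x, m) e^{2πi (m, y̌)}` of the Fourier series, where `α = ∑ α_I dx^I`. -/
def fourierTerm {q : ℕ} (α : PathForm ξ₁ ξ₂ q) {x : B} (y₁ : Lift (ξ₁.toFun x))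
    (y₂ : Lift (ξ₂.toFun x)) (w : Tan n x) (I : Fin q → Fin n) (m : dualLattice n x) : ℂ :=
  α (pathOf y₁ y₂ m) (fun a => fromChart (chartAt (Model n) x) x (Pi.single (I a) 1))
    * Complex.exp (2 * Real.pi * Complex.I * (m.1 w : ℝ))

open Classical in
/-- The formula
`(-ħ/(2i))^q ∑_m ∑_I α_I(x, m) e^{2πi (m, y̌)} dz̄^I ⊗ 1̌₁^* ⊗ 1̌₂` with given lifts; `I` runs over
the increasing multi-indices. -/
def syzFormula {q : ℕ} (α : PathForm ξ₁ ξ₂ q) (z : Mirror n B) (y₁ : Lift (ξ₁.toFun z.base))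
    (y₂ : Lift (ξ₂.toFun z.base)) (w : MirrorLift z.fib) : z.Tan [⋀^Fin q]→ₗ[ℝ] homBundle ξ₁ ξ₂ z :=
  tensorFrame
    ((-((ħ : ℂ) / (2 * Complex.I))) ^ q • ∑ I : Fin q → Fin n with StrictMono I,
      (∑' m : dualLattice n z.base, fourierTerm α y₁ y₂ w.1 I m) • dzbarForm ħ z I)
    (homFrame y₁ y₂ w)

/-- The SYZ transform `F`, computed at each point of `X̌` with some choice of lifts. -/
def syzTransform {q : ℕ} (α : PathForm ξ₁ ξ₂ q) : MirrorForm ξ₁ ξ₂ q := fun z =>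
  syzFormula α z ⟨(ξ₁.toFun z.base).out, Quotient.out_eq _⟩
    ⟨(ξ₂.toFun z.base).out, Quotient.out_eq _⟩ ⟨z.fib.out, Quotient.out_eq _⟩

end Transform

end SYZ

end

/-! Over an affine chart with chosen lifts `η₁`, `η₂` of the two sections, a form on the path space
is a family of forms on an open subset of `ℝⁿ`, indexed by `m ∈ ℤⁿ`, and the SYZ transform is
Fourier synthesis along the fibres of `X̌`. The analytic core is therefore the correspondence
between smooth functions of `(x, y̌)` periodic in `y̌` and families of coefficients all of whose
`x`-derivatives decay faster than any power of `‖m‖`, uniformly on compact sets. In one direction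
the series may be differentiated term by term (`DecayFamily.contDiffOn_fourierSum`); in the other,
integration by parts gives the decay (`PeriodicSmooth.decayFamily`). Fourier inversion makes the two
directions inverse to each other.

This local picture matches the global definitions for two reasons. The decay condition in terms of
`g` becomes the coordinate one because `g` is comparable with the Euclidean structure on compact
sets and `γ̇ = η₂ - η₁ + m` differs from `m` by a bounded amount (`mem_rapidForms_iff`). A form of
type `(0, q)` is determined by its values on vertical vectors, on which `dz̄ʲ` is `dy̌ʲ`
(`IsConjLinear.ext`, `extForm`), so the multi-indices play no role and every identity is tested on
vertical vectors. Changing the lifts translates the index `m`; the resulting character is cancelled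
by the change of frame (`syzFormula_eq`).

For the chain map, `J` sends the vertical vector `(0, x)` to `(ħx, 0)`. On the mode `m` the
`(0,1)`-part of the covariant derivative in this direction is `½(2πi(η₂ - η₁ + m, x) + iħ∂_x) =
-ħ/(2i) · (∂_x + 2πħ⁻¹(γ̇, x))`, which is the Witten derivative times the constant that `𝓕` carries
per degree (`dbarPart_vertical`, `dolbeaultD_syzTransform`).

The Witten differential squares to zero because the Lagrangian condition makes `γ̇` a closed form
(`wittenD_wittenD`). The transform being bijective and intertwining the operators, the corresponding
facts for `∂̄` are transported from the Witten side. -/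

noncomputable section

namespace SYZ

/-! ## Rapidly decaying families and their Fourier series -/

section Decay

variable {n : ℕ}

/-- The covector `∑ mⱼ dxʲ` with integral components. -/
def icov (m : Fin n → ℤ) : Model n →L[ℝ] ℝ :=
  ∑ j, (m j : ℝ) • ContinuousLinearMap.proj (R := ℝ) (φ := fun _ : Fin n => ℝ) j

theorem icov_apply (m : Fin n → ℤ) (v : Model n) : icov m v = ∑ j, (m j : ℝ) * v j := by
  simp [icov]

theorem icov_single (m : Fin n → ℤ) (j : Fin n) : icov m (Pi.single j 1) = m j := by
  simp [icov_apply, Pi.single_apply]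

theorem icov_add (m k : Fin n → ℤ) : icov (m + k) = icov m + icov k := by
  ext v; simp [icov_apply, add_mul, Finset.sum_add_distrib]

theorem icov_zero : icov (0 : Fin n → ℤ) = 0 := by
  ext v; simp [icov_apply]

theorem icov_injective : Function.Injective (icov (n := n)) := by
  intro m k h
  funext j
  have := congrArg (fun L => L (Pi.single j (1 : ℝ))) h
  simpa only [icov_single, Int.cast_inj] using this

/-- The components of `m` are the values of `icov m` on the standard basis vectors, of sup norm at
most one. Besides comparing decay in `m` with decay in `γ̇`, this separates distinct branches of the
path space. -/
theorem norm_le_norm_icov (m : Fin n → ℤ) : ‖m‖ ≤ ‖icov m‖ := by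
  refine (pi_norm_le_iff_of_nonneg (norm_nonneg _)).2 fun j => ?_
  have h := (icov m).le_opNorm (Pi.single j 1)
  have h1 : ‖(Pi.single j 1 : Model n)‖ ≤ 1 :=
    (pi_norm_le_iff_of_nonneg zero_le_one).2 fun i => by
      by_cases hi : i = j
      · subst hi; simp
      · simp [hi]
  rw [icov_single] at h
  have h2 : ‖m j‖ = ‖((m j : ℤ) : ℝ)‖ := (Int.norm_cast_real _).symm
  rw [h2]
  exact h.trans (mul_le_of_le_one_right (norm_nonneg _) h1)

theorem norm_icov_le (m : Fin n → ℤ) : ‖icov m‖ ≤ n * ‖m‖ := by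
  refine ContinuousLinearMap.opNorm_le_bound _ (by positivity) fun v => ?_
  rw [icov_apply]
  calc ‖∑ j, (m j : ℝ) * v j‖ ≤ ∑ j : Fin n, ‖m‖ * ‖v‖ := by
        refine norm_sum_le_of_le _ fun j _ => ?_
        rw [norm_mul, Int.norm_cast_real]
        exact mul_le_mul (norm_le_pi_norm m j) (norm_le_pi_norm v j) (norm_nonneg _) (norm_nonneg _)
    _ = n * ‖m‖ * ‖v‖ := by simp; ring

/-- The character `y ↦ e^{2πi (m, y)}`. -/
def chi (m : Fin n → ℤ) (y : Model n) : ℂ :=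
  Complex.exp (2 * Real.pi * Complex.I * (icov m y : ℝ))

theorem norm_chi (m : Fin n → ℤ) (y : Model n) : ‖chi m y‖ = 1 := by
  have : (2 * Real.pi * Complex.I * (icov m y : ℝ) : ℂ)
      = ((2 * Real.pi * icov m y : ℝ) : ℂ) * Complex.I := by push_cast; ring
  rw [chi, this, Complex.norm_exp_ofReal_mul_I]

theorem chi_add (m : Fin n → ℤ) (y z : Model n) : chi m (y + z) = chi m y * chi m z := by
  rw [chi, chi, chi, ← Complex.exp_add, map_add]; congr 1; push_cast; ring

theorem chi_add_left (m k : Fin n → ℤ) (y : Model n) : chi (m + k) y = chi m y * chi k y := by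
  rw [chi, chi, chi, ← Complex.exp_add, icov_add]; congr 1; simp; ring

theorem chi_zero_left (y : Model n) : chi (0 : Fin n → ℤ) y = 1 := by
  simp [chi, icov_zero]

theorem chi_neg_mul (m : Fin n → ℤ) (y : Model n) : chi (-m) y * chi m y = 1 := by
  rw [← chi_add_left, neg_add_cancel, chi_zero_left]

theorem chi_zero (m : Fin n → ℤ) : chi m 0 = 1 := by simp [chi]

theorem chi_int (m k : Fin n → ℤ) : chi m (fun j => (k j : ℝ)) = 1 := by
  rw [chi, Complex.exp_eq_one_iff]
  refine ⟨∑ j, m j * k j, ?_⟩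
  rw [icov_apply]; push_cast; ring

/-- The `1`-form `2πi (m, dy̌)` on `(x, y̌)`-space. -/
def dchi (m : Fin n → ℤ) : Model n × Model n →L[ℝ] ℂ :=
  (2 * Real.pi * Complex.I : ℂ) •
    (Complex.ofRealCLM.comp ((icov m).comp (ContinuousLinearMap.snd ℝ _ _)))

theorem dchi_apply (m : Fin n → ℤ) (v : Model n × Model n) :
    dchi m v = 2 * Real.pi * Complex.I * (icov m v.2 : ℝ) := by
  simp [dchi]

theorem hasFDerivAt_chi (m : Fin n → ℤ) (p : Model n × Model n) :
    HasFDerivAt (fun p : Model n × Model n => chi m p.2) (chi m p.2 • dchi m) p := by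
  have h := (dchi m).hasFDerivAt (x := p)
  have := h.cexp
  simp only [dchi_apply] at this
  exact this

theorem contDiff_chi (m : Fin n → ℤ) : ContDiff ℝ ∞ (chi m) := by
  have h : ContDiff ℝ ∞ fun y : Model n => (2 * Real.pi * Complex.I : ℂ) * (icov m y : ℝ) :=
    contDiff_const.mul (Complex.ofRealCLM.contDiff.comp (icov m).contDiff)
  exact h.cexp

variable {E : Type*} [NormedAddCommGroup E] [NormedSpace ℝ E]

/-- A family of smooth functions on `U`, indexed by `ℤⁿ`, all derivatives of which decay rapidly,
uniformly on compact sets. -/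
structure DecayFamily (U : Set (Model n)) (f : (Fin n → ℤ) → Model n → E) : Prop where
  smooth : ∀ m, ContDiffOn ℝ ∞ (f m) U
  bound : ∀ K ⊆ U, IsCompact K → ∀ k l : ℕ, ∃ C : ℝ, ∀ m, ∀ u ∈ K,
    ‖m‖ ^ k * ‖iteratedFDeriv ℝ l (f m) u‖ ≤ C

variable {U : Set (Model n)} {f : (Fin n → ℤ) → Model n → E}

/-- Weights `(1 + ‖m‖)^k` absorb factors of linear growth even at `m = 0`. For `‖m‖ ≤ 1` the weight
is at most `2^k`, for `‖m‖ ≥ 1` at most `(2‖m‖)^k`. -/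
theorem DecayFamily.bound' (hf : DecayFamily U f) {K : Set (Model n)} (hKU : K ⊆ U)
    (hK : IsCompact K) (k l : ℕ) : ∃ C : ℝ, 0 ≤ C ∧ ∀ m, ∀ u ∈ K,
    (1 + ‖m‖) ^ k * ‖iteratedFDeriv ℝ l (f m) u‖ ≤ C := by
  obtain ⟨C₀, h₀⟩ := hf.bound K hKU hK 0 l
  obtain ⟨C₁, h₁⟩ := hf.bound K hKU hK k l
  refine ⟨max 0 (2 ^ k * max C₀ C₁), le_max_left _ _, fun m u hu => le_max_of_le_right ?_⟩
  have h₀ := h₀ m u hu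
  have h₁ := h₁ m u hu
  rw [pow_zero, one_mul] at h₀
  rcases le_total ‖m‖ 1 with h | h
  · calc (1 + ‖m‖) ^ k * ‖iteratedFDeriv ℝ l (f m) u‖
        ≤ 2 ^ k * ‖iteratedFDeriv ℝ l (f m) u‖ := by gcongr; linarith
      _ ≤ _ := by gcongr; exact h₀.trans (le_max_left _ _)
  · calc (1 + ‖m‖) ^ k * ‖iteratedFDeriv ℝ l (f m) u‖
        ≤ (2 * ‖m‖) ^ k * ‖iteratedFDeriv ℝ l (f m) u‖ := by gcongr; linarith
      _ = 2 ^ k * (‖m‖ ^ k * ‖iteratedFDeriv ℝ l (f m) u‖) := by rw [mul_pow, mul_assoc]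
      _ ≤ _ := by gcongr; exact h₁.trans (le_max_right _ _)

theorem DecayFamily.congr (hU : IsOpen U) (hf : DecayFamily U f)
    {f' : (Fin n → ℤ) → Model n → E} (h : ∀ m, ∀ u ∈ U, f' m u = f m u) : DecayFamily U f' := by
  refine ⟨fun m => (hf.smooth m).congr (h m), fun K hKU hK k l => ?_⟩
  obtain ⟨C, hC⟩ := hf.bound K hKU hK k l
  refine ⟨C, fun m u hu => ?_⟩
  have : f' m =ᶠ[𝓝 u] f m := by
    filter_upwards [hU.mem_nhds (hKU hu)] with v hv using h m v hv
  rw [(Filter.EventuallyEq.iteratedFDeriv ℝ this l).eq_of_nhds]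
  exact hC m u hu

theorem DecayFamily.contDiffAt (hU : IsOpen U) (hf : DecayFamily U f) (m : Fin n → ℤ)
    {u : Model n} (hu : u ∈ U) : ContDiffAt ℝ ∞ (f m) u :=
  (hf.smooth m).contDiffAt (hU.mem_nhds hu)

theorem DecayFamily.differential (hU : IsOpen U) (hf : DecayFamily U f) :
    DecayFamily U fun m => fderiv ℝ (f m) := by
  refine ⟨fun m => (hf.smooth m).fderiv_of_isOpen hU (by simp), fun K hKU hK k l => ?_⟩
  simpa only [norm_iteratedFDeriv_fderiv] using hf.bound K hKU hK k (l + 1)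

theorem DecayFamily.add (hU : IsOpen U) (hf : DecayFamily U f)
    {f' : (Fin n → ℤ) → Model n → E} (hf' : DecayFamily U f') :
    DecayFamily U fun m u => f m u + f' m u := by
  refine ⟨fun m => (hf.smooth m).add (hf'.smooth m), fun K hKU hK k l => ?_⟩
  obtain ⟨C, hC⟩ := hf.bound K hKU hK k l
  obtain ⟨C', hC'⟩ := hf'.bound K hKU hK k l
  refine ⟨C + C', fun m u hu => ?_⟩
  rw [fun_iteratedFDeriv_add_apply ((hf.contDiffAt hU m (hKU hu)).of_le (by exact_mod_cast le_top))
    ((hf'.contDiffAt hU m (hKU hu)).of_le (by exact_mod_cast le_top))]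
  refine le_trans ?_ (add_le_add (hC m u hu) (hC' m u hu))
  rw [← mul_add]
  gcongr
  exact norm_add_le _ _

variable {F : Type*} [NormedAddCommGroup F] [NormedSpace ℝ F]

/-- Rapidly decaying families are stable under linear maps whose norms grow at most linearly. -/
theorem DecayFamily.clm (hU : IsOpen U) (hf : DecayFamily U f) (L : (Fin n → ℤ) → E →L[ℝ] F)
    {C : ℝ} (hL : ∀ m, ‖L m‖ ≤ C * (1 + ‖m‖)) : DecayFamily U fun m u => L m (f m u) := by
  refine ⟨fun m => (L m).contDiff.comp_contDiffOn (hf.smooth m), fun K hKU hK k l => ?_⟩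
  obtain ⟨D, hD0, hD⟩ := hf.bound' hKU hK (k + 1) l
  have hC0 : 0 ≤ C := by
    have := (norm_nonneg _).trans (hL 0)
    simpa using this
  refine ⟨C * D, fun m u hu => ?_⟩
  have h := (L m).norm_iteratedFDeriv_comp_left (n := l) (hf.contDiffAt hU m (hKU hu))
    (by exact_mod_cast le_top)
  have h1 : ‖m‖ ^ k ≤ (1 + ‖m‖) ^ k := by gcongr; linarith
  calc ‖m‖ ^ k * ‖iteratedFDeriv ℝ l (fun u => L m (f m u)) u‖
      ≤ (1 + ‖m‖) ^ k * ((C * (1 + ‖m‖)) * ‖iteratedFDeriv ℝ l (f m) u‖) := by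
        gcongr
        exact h.trans (by gcongr; exact hL m)
    _ = C * ((1 + ‖m‖) ^ (k + 1) * ‖iteratedFDeriv ℝ l (f m) u‖) := by ring
    _ ≤ C * D := by gcongr; exact hD m u hu

theorem DecayFamily.clm_const (hU : IsOpen U) (hf : DecayFamily U f) (L : E →L[ℝ] F) :
    DecayFamily U fun m u => L (f m u) :=
  hf.clm hU (fun _ => L) (C := ‖L‖) fun m =>
    le_mul_of_one_le_right (norm_nonneg _) (by linarith [norm_nonneg m])

/-- Rapidly decaying families are stable under products with smooth functions. -/
theorem DecayFamily.bilin {G : Type*} [NormedAddCommGroup G] [NormedSpace ℝ G]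
    (hU : IsOpen U) (hf : DecayFamily U f) (A : G →L[ℝ] E →L[ℝ] F) {g : Model n → G}
    (hg : ContDiffOn ℝ ∞ g U) : DecayFamily U fun m u => A (g u) (f m u) := by
  refine ⟨fun m => (A.contDiff.comp_contDiffOn hg).clm_apply (hf.smooth m),
    fun K hKU hK k l => ?_⟩
  have hb : ∀ i, ∃ D : ℝ, 0 ≤ D ∧ ∀ u ∈ K, ‖iteratedFDeriv ℝ i g u‖ ≤ D := by
    intro i
    have hc : ContinuousOn (iteratedFDeriv ℝ i g) K := by
      intro u hu
      have h1 : ContDiffAt ℝ ∞ g u := hg.contDiffAt (hU.mem_nhds (hKU hu))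
      have h2 : ContDiffAt ℝ 0 (iteratedFDeriv ℝ i g) u :=
        h1.iteratedFDeriv_right (i := i) (by rw [zero_add]; exact_mod_cast le_top)
      exact h2.continuousAt.continuousWithinAt
    obtain ⟨D, hD⟩ := hK.exists_bound_of_continuousOn hc
    exact ⟨max D 0, le_max_right _ _, fun u hu => (hD u hu).trans (le_max_left _ _)⟩
  choose D hD0 hD using hb
  have hb' := fun i => hf.bound' hKU hK k i
  choose D' hD'0 hD' using hb'
  refine ⟨‖A‖ * ∑ i ∈ Finset.range (l + 1), (l.choose i : ℝ) * D i * D' (l - i),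
    fun m u hu => ?_⟩
  have h := A.norm_iteratedFDerivWithin_le_of_bilinear hg (hf.smooth m) hU.uniqueDiffOn (hKU hu)
    (n := l) (by exact_mod_cast le_top)
  -- The Leibniz estimate concerns derivatives within `U`, which are the full derivatives since `U`
  -- is open.
  have h1 := fun i => iteratedFDerivWithin_of_isOpen (𝕜 := ℝ) (f := g) i hU (hKU hu)
  have h2 := fun i => iteratedFDerivWithin_of_isOpen (𝕜 := ℝ) (f := f m) i hU (hKU hu)
  simp only [h1, h2, iteratedFDerivWithin_of_isOpen (𝕜 := ℝ) (f := fun u => A (g u) (f m u)) l hU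
    (hKU hu)] at h
  have h1 : ‖m‖ ^ k ≤ (1 + ‖m‖) ^ k := by gcongr; linarith
  calc _ ≤ (1 + ‖m‖) ^ k * _ := by gcongr
    _ ≤ (1 + ‖m‖) ^ k * (‖A‖ * ∑ i ∈ Finset.range (l + 1), (l.choose i : ℝ)
          * ‖iteratedFDeriv ℝ i g u‖ * ‖iteratedFDeriv ℝ (l - i) (f m) u‖) := by
        gcongr
    _ = ‖A‖ * ∑ i ∈ Finset.range (l + 1), (l.choose i : ℝ) * ‖iteratedFDeriv ℝ i g u‖
          * ((1 + ‖m‖) ^ k * ‖iteratedFDeriv ℝ (l - i) (f m) u‖) := by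
        rw [mul_left_comm, Finset.mul_sum]
        congr 1
        exact Finset.sum_congr rfl fun i _ => by ring
    _ ≤ _ := by
        refine mul_le_mul_of_nonneg_left (Finset.sum_le_sum fun i _ => ?_) (norm_nonneg A)
        exact mul_le_mul (mul_le_mul_of_nonneg_left (hD i u hu) (by positivity)) (hD' _ m u hu)
          (by positivity) (mul_nonneg (by positivity) (hD0 i))

/-- `(1 + |m|)^{-(n+1)}` is summable over `ℤⁿ`. -/
theorem summable_one_add_norm_pow_inv :
    Summable fun m : Fin n → ℤ => ((1 + ‖m‖) ^ (n + 1))⁻¹ := by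
  let b : Module.Basis (Fin n) ℝ (Model n) := Pi.basisFun ℝ (Fin n)
  let L : Submodule ℤ (Model n) := Submodule.span ℤ (Set.range b)
  have hfr : Module.finrank ℤ L = n := by
    rw [ZLattice.rank ℝ L]
    simp
  -- The exponent `n + 1` exceeds the rank `n` of the lattice.
  have h := ZLattice.summable_norm_pow_inv L (n + 1) (by omega)
  let φ : (Fin n → ℤ) → L := fun m => ⟨fun j => (m j : ℝ), by
    have : (fun j => (m j : ℝ)) = ∑ j, m j • b j := by
      funext i
      simp [b, Pi.single_apply]
    rw [this]
    exact Submodule.sum_mem _ fun j _ => Submodule.smul_mem _ _ (Submodule.subset_span ⟨j, rfl⟩)⟩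
  have hφ : Function.Injective φ := by
    intro m k hmk
    funext j
    have : (m j : ℝ) = k j := congrFun (congrArg Subtype.val hmk) j
    exact_mod_cast this
  have hn : ∀ m, ‖φ m‖ = ‖m‖ := by
    intro m
    change ‖(fun j => (m j : ℝ))‖ = ‖m‖
    simp only [Pi.norm_def]
    congr 2
  have h2 := h.comp_injective hφ
  -- The comparison fails at `m = 0`, where the inverse power of the norm takes the default value
  -- zero; finitely many terms may be ignored.
  refine Summable.of_norm_bounded_eventually h2 ?_
  have : ∀ᶠ m : Fin n → ℤ in Filter.cofinite, m ≠ 0 := by simp [Filter.eventually_cofinite]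
  filter_upwards [this] with m hm
  have hpos : 0 < ‖m‖ := norm_pos_iff.2 hm
  simp only [Function.comp_apply, hn, ← inv_pow]
  rw [Real.norm_of_nonneg (by positivity)]
  gcongr
  linarith

/-- A rapidly decaying family is dominated on compact sets by a summable family. -/
theorem DecayFamily.exists_summable (hf : DecayFamily U f) {K : Set (Model n)} (hKU : K ⊆ U)
    (hK : IsCompact K) : ∃ v : (Fin n → ℤ) → ℝ, Summable v ∧ ∀ m, ∀ u ∈ K, ‖f m u‖ ≤ v m := by
  obtain ⟨C, hC0, hC⟩ := hf.bound' hKU hK (n + 1) 0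
  refine ⟨fun m => C * ((1 + ‖m‖) ^ (n + 1))⁻¹, summable_one_add_norm_pow_inv.mul_left C,
    fun m u hu => ?_⟩
  have h := hC m u hu
  rw [norm_iteratedFDeriv_zero] at h
  change _ ≤ C * _
  rw [← div_eq_mul_inv, le_div_iff₀ (by positivity)]
  linarith

theorem DecayFamily.summable_norm (hf : DecayFamily U f) {u : Model n} (hu : u ∈ U) :
    Summable fun m => ‖f m u‖ := by
  obtain ⟨v, hv, h⟩ := hf.exists_summable (K := {u}) (by simpa using hu) isCompact_singleton
  exact Summable.of_nonneg_of_le (fun _ => norm_nonneg _) (fun m => h m u rfl) hv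

end Decay

/-! ### Termwise differentiation of Fourier series with rapidly decaying coefficients -/

section FourierSeries

variable {n : ℕ} {E : Type*} [NormedAddCommGroup E] [NormedSpace ℝ E] [NormedSpace ℂ E]
  [IsScalarTower ℝ ℂ E]

/-- `ContinuousLinearMap.smulRight` for a complex-valued linear form, as a bilinear map. -/
def smulRightBilin (X E : Type*) [NormedAddCommGroup X] [NormedSpace ℝ X]
    [NormedAddCommGroup E] [NormedSpace ℝ E] [NormedSpace ℂ E] [IsScalarTower ℝ ℂ E] :
    (X →L[ℝ] ℂ) →L[ℝ] E →L[ℝ] X →L[ℝ] E :=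
  ((ContinuousLinearMap.compL ℝ E (ℂ →L[ℝ] E) (X →L[ℝ] E)).flip
    (ContinuousLinearMap.lsmul ℝ ℂ).flip).comp (ContinuousLinearMap.compL ℝ X ℂ E).flip

theorem smulRightBilin_apply {X E : Type*} [NormedAddCommGroup X] [NormedSpace ℝ X]
    [NormedAddCommGroup E] [NormedSpace ℝ E] [NormedSpace ℂ E] [IsScalarTower ℝ ℂ E]
    (c : X →L[ℝ] ℂ) (x : E) : smulRightBilin X E c x = c.smulRight x := by
  ext v
  rfl

theorem norm_smulRightBilin_apply_le {X E : Type*} [NormedAddCommGroup X] [NormedSpace ℝ X]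
    [NormedAddCommGroup E] [NormedSpace ℝ E] [NormedSpace ℂ E] [IsScalarTower ℝ ℂ E]
    (c : X →L[ℝ] ℂ) : ‖smulRightBilin X E c‖ ≤ ‖c‖ := by
  refine ContinuousLinearMap.opNorm_le_bound _ (norm_nonneg c) fun x => ?_
  rw [smulRightBilin_apply]
  refine ContinuousLinearMap.opNorm_le_bound _ (by positivity) fun v => ?_
  rw [ContinuousLinearMap.smulRight_apply, norm_smul, mul_right_comm]
  gcongr
  exact c.le_opNorm v

/-- The sum of the Fourier series `∑ₘ f(m, x) e^{2πi (m, y̌)}`. -/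
def fourierSum (f : (Fin n → ℤ) → Model n → E) (p : Model n × Model n) : E :=
  ∑' m, chi m p.2 • f m p.1

/-- The family of coefficients of the derivative of a Fourier series. -/
def twist (f : (Fin n → ℤ) → Model n → E) (m : Fin n → ℤ) (u : Model n) :
    Model n × Model n →L[ℝ] E :=
  (fderiv ℝ (f m) u).comp (ContinuousLinearMap.fst ℝ _ _) + (dchi m).smulRight (f m u)

variable {U : Set (Model n)} {f : (Fin n → ℤ) → Model n → E}

theorem norm_dchi_le (m : Fin n → ℤ) : ‖dchi m‖ ≤ 2 * Real.pi * n * (1 + ‖m‖) := by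
  refine ContinuousLinearMap.opNorm_le_bound _ (by positivity) fun v => ?_
  rw [dchi_apply, norm_mul, norm_mul, norm_mul, Complex.norm_I, Complex.norm_real,
    Complex.norm_real, Real.norm_of_nonneg Real.pi_pos.le, mul_one]
  have h1 : ‖icov m v.2‖ ≤ n * (1 + ‖m‖) * ‖v‖ :=
    ((icov m).le_opNorm _).trans (mul_le_mul ((norm_icov_le m).trans (by gcongr; linarith))
      (norm_snd_le v) (norm_nonneg _) (by positivity))
  calc ‖(2 : ℂ)‖ * Real.pi * ‖icov m v.2‖ ≤ 2 * Real.pi * (n * (1 + ‖m‖) * ‖v‖) := by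
        rw [Complex.norm_ofNat]
        gcongr
    _ = _ := by ring

/-- The derivative is again a character times a coefficient depending on the base alone, now with
values in a space of linear maps. Hence the derivative of a Fourier series is a series of the same
kind. -/
theorem hasFDerivAt_chi_smul (m : Fin n → ℤ) {p : Model n × Model n}
    (h : DifferentiableAt ℝ (f m) p.1) :
    HasFDerivAt (fun p : Model n × Model n => chi m p.2 • f m p.1) (chi m p.2 • twist f m p.1) p := by
  have h1 : HasFDerivAt (fun p : Model n × Model n => f m p.1)
      ((fderiv ℝ (f m) p.1).comp (ContinuousLinearMap.fst ℝ _ _)) p :=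
    h.hasFDerivAt.comp p hasFDerivAt_fst
  have h2 := (hasFDerivAt_chi m p).fun_smul h1
  have h3 : chi m p.2 • twist f m p.1
      = chi m p.2 • (fderiv ℝ (f m) p.1).comp (ContinuousLinearMap.fst ℝ _ _)
        + (chi m p.2 • dchi m).smulRight (f m p.1) := by
    ext v <;> simp [twist, mul_smul]
  rw [h3]
  exact h2

/-- Differentiating the character costs only a factor linear in `m`, which rapid decay tolerates. -/
theorem DecayFamily.twisted (hU : IsOpen U) (hf : DecayFamily U f) :
    DecayFamily U (twist f) := by
  have h1 : DecayFamily U fun m u =>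
      (fderiv ℝ (f m) u).comp (ContinuousLinearMap.fst ℝ (Model n) (Model n)) :=
    (hf.differential hU).clm_const hU
      ((ContinuousLinearMap.compL ℝ (Model n × Model n) (Model n) E).flip
        (ContinuousLinearMap.fst ℝ (Model n) (Model n)))
  have h2 : DecayFamily U fun m u => (dchi m).smulRight (f m u) := by
    have h3 := hf.clm hU (fun m => smulRightBilin (Model n × Model n) E (dchi m))
      (C := 2 * Real.pi * n) fun m => (norm_smulRightBilin_apply_le _).trans (norm_dchi_le m)
    simpa only [smulRightBilin_apply] using h3
  exact h1.add hU h2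

variable [CompleteSpace E]

omit [IsScalarTower ℝ ℂ E] in
theorem DecayFamily.hasSum (hf : DecayFamily U f) {p : Model n × Model n} (hp : p.1 ∈ U) :
    HasSum (fun m => chi m p.2 • f m p.1) (fourierSum f p) := by
  refine Summable.hasSum (Summable.of_norm ?_)
  simpa only [norm_smul, norm_chi, one_mul] using hf.summable_norm hp

/-- A Fourier series with rapidly decaying coefficients can be differentiated term by term. -/
theorem DecayFamily.hasFDerivAt_fourierSum (hU : IsOpen U) (hf : DecayFamily U f)
    {p : Model n × Model n} (hp : p.1 ∈ U) :
    HasFDerivAt (fourierSum f) (fourierSum (twist f) p) p := by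
  obtain ⟨r, hr, hrU⟩ := Metric.nhds_basis_closedBall.mem_iff.1 (hU.mem_nhds hp)
  obtain ⟨v, hv, hb⟩ := (hf.twisted hU).exists_summable hrU (isCompact_closedBall _ _)
  have hsub : Metric.ball p.1 r ⊆ U := Metric.ball_subset_closedBall.trans hrU
  -- Characters have modulus one, so a bound on a ball in the base dominates the derivatives along
  -- the entire fibre; the domain is convex, hence preconnected.
  refine hasFDerivAt_tsum_of_isPreconnected (s := Metric.ball p.1 r ×ˢ Set.univ) (x₀ := p)
    (f := fun m (p : Model n × Model n) => chi m p.2 • f m p.1)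
    (f' := fun m (p : Model n × Model n) => chi m p.2 • twist f m p.1) hv
    (Metric.isOpen_ball.prod isOpen_univ)
    ((convex_ball _ _).prod convex_univ).isPreconnected (fun m x hx => ?_) (fun m x hx => ?_)
    ⟨Metric.mem_ball_self hr, trivial⟩ (hf.hasSum hp).summable ⟨Metric.mem_ball_self hr, trivial⟩
  · exact hasFDerivAt_chi_smul m ((hf.contDiffAt hU m (hsub hx.1)).differentiableAt (by simp))
  · rw [norm_smul, norm_chi, one_mul]
    exact hb m _ (Metric.ball_subset_closedBall hx.1)

/-- The target space is quantified inside the induction because the derivative is a Fourier series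
with values in linear maps into it. -/
theorem DecayFamily.contDiffOn_fourierSum_nat (hU : IsOpen U) (k : ℕ) :
    ∀ {E : Type*} [NormedAddCommGroup E] [NormedSpace ℝ E] [NormedSpace ℂ E]
      [IsScalarTower ℝ ℂ E] [CompleteSpace E] {f : (Fin n → ℤ) → Model n → E},
      DecayFamily U f → ContDiffOn ℝ k (fourierSum f) (U ×ˢ Set.univ) := by
  induction k with
  | zero =>
    intro E _ _ _ _ _ f hf
    refine contDiffOn_zero.2 fun p hp => ?_
    exact (hf.hasFDerivAt_fourierSum hU hp.1).continuousAt.continuousWithinAt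
  | succ k ih =>
    intro E _ _ _ _ _ f hf
    have hO : IsOpen (U ×ˢ (Set.univ : Set (Model n))) := hU.prod isOpen_univ
    push_cast
    rw [contDiffOn_succ_iff_fderiv_of_isOpen hO]
    refine ⟨fun p hp => ?_, fun h => ?_, ?_⟩
    · exact (hf.hasFDerivAt_fourierSum hU hp.1).differentiableAt.differentiableWithinAt
    · exact absurd h (by simp)
    · exact (ih (hf.twisted hU)).congr fun p hp => (hf.hasFDerivAt_fourierSum hU hp.1).fderiv

theorem DecayFamily.contDiffOn_fourierSum (hU : IsOpen U) (hf : DecayFamily U f) :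
    ContDiffOn ℝ ∞ (fourierSum f) (U ×ˢ Set.univ) :=
  contDiffOn_infty.2 fun k => hf.contDiffOn_fourierSum_nat hU k

end FourierSeries

/-! ### Fourier coefficients and Fourier inversion on the torus -/

section FourierCoefficients

open MeasureTheory

variable {n : ℕ}

/-- The half-open unit cube with corner `a`. -/
def unitBox (a : Model n) : Set (Model n) := {x | ∀ i, x i ∈ Set.Ioc (a i) (a i + 1)}

theorem unitBox_eq_pi (a : Model n) :
    unitBox a = Set.univ.pi fun i => Set.Ioc (a i) (a i + 1) := by
  ext x; simp [unitBox]

theorem measurableSet_unitBox (a : Model n) : MeasurableSet (unitBox a) := by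
  rw [unitBox_eq_pi]
  exact MeasurableSet.univ_pi fun i => measurableSet_Ioc

theorem volume_unitBox (a : Model n) : volume (unitBox a) = 1 := by
  rw [unitBox_eq_pi, Real.volume_pi_Ioc]
  simp

theorem unitBox_subset_Icc (a : Model n) : unitBox a ⊆ Set.Icc a (a + 1) := fun _ hx =>
  ⟨fun i => (hx i).1.le, fun i => (hx i).2⟩

instance isFiniteMeasure_restrict_unitBox (a : Model n) :
    IsFiniteMeasure (volume.restrict (unitBox a)) :=
  ⟨by rw [Measure.restrict_apply_univ, volume_unitBox]; exact ENNReal.one_lt_top⟩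

variable {E : Type*} [NormedAddCommGroup E]

theorem integrable_unitBox (a : Model n) {F : Model n → E} (hF : Continuous F) :
    Integrable F (volume.restrict (unitBox a)) :=
  (hF.continuousOn.integrableOn_compact isCompact_Icc).mono_set (unitBox_subset_Icc a)

/-- Periodicity with respect to `ℤⁿ`. -/
def IsPeriodic {X : Type*} (F : Model n → X) : Prop :=
  ∀ (y : Model n) (k : Fin n → ℤ), F (y + fun j => (k j : ℝ)) = F y

/-- A representative of a point of the torus `ℝⁿ / ℤⁿ`. -/
def torusRep (t : UnitAddTorus (Fin n)) : Model n := fun i => (t i).out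

theorem IsPeriodic.torusRep {X : Type*} {F : Model n → X} (hF : IsPeriodic F) (y : Model n) :
    F (torusRep fun i => (y i : UnitAddCircle)) = F y := by
  have h : ∀ i, ∃ k : ℤ, (y i : UnitAddCircle).out = y i + k := by
    intro i
    have h1 : ((y i : UnitAddCircle).out : UnitAddCircle) = (y i : UnitAddCircle) :=
      Quotient.out_eq _
    rw [← sub_eq_zero, ← AddCircle.coe_sub, AddCircle.coe_eq_zero_iff] at h1
    obtain ⟨k, hk⟩ := h1
    refine ⟨k, ?_⟩
    rw [zsmul_one] at hk
    linarith
  choose k hk using h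
  have h2 : SYZ.torusRep (fun i => (y i : UnitAddCircle)) = y + fun j => (k j : ℝ) :=
    funext fun i => hk i
  rw [h2, hF]

variable [NormedSpace ℝ E]

/-- A periodic function factors through the torus, and each unit box is a fundamental domain, so
both sides are the integral over the torus. -/
theorem IsPeriodic.setIntegral_unitBox {F : Model n → E} (hF : IsPeriodic F) (a b : Model n) :
    ∫ y in unitBox a, F y = ∫ y in unitBox b, F y := by
  have h := fun c => UnitAddTorus.integral_preimage (fun t => F (SYZ.torusRep t)) c
  simp only [hF.torusRep] at h
  exact (h a).symm.trans (h b)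

theorem IsPeriodic.setIntegral_add {F : Model n → E} (hF : IsPeriodic F) (s : Model n) :
    ∫ y in unitBox 0, F (y + s) = ∫ y in unitBox 0, F y := by
  have h : unitBox (0 : Model n) = (fun y => y + s) ⁻¹' unitBox s := by
    ext y
    simp only [unitBox, Set.mem_ofPred_eq, Set.mem_preimage, Set.mem_Ioc, Pi.add_apply,
      Pi.zero_apply]
    refine forall_congr' fun i => ?_
    constructor <;> rintro ⟨h1, h2⟩ <;> constructor <;> linarith
  rw [h, (measurePreserving_add_right volume s).setIntegral_preimage_emb
    (measurableEmbedding_addRight s), ← h]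
  exact hF.setIntegral_unitBox s 0

theorem isPeriodic_chi (m : Fin n → ℤ) : IsPeriodic (chi m) := fun y k => by
  rw [chi_add, chi_int, mul_one]

theorem integral_chi (m : Fin n → ℤ) :
    ∫ y in unitBox 0, chi m y = if m = 0 then 1 else 0 := by
  split_ifs with h
  · subst h
    simp [chi_zero_left, volume_unitBox, Measure.real]
  · obtain ⟨j, hj⟩ := Function.ne_iff.1 h
    have hj' : (m j : ℝ) ≠ 0 := by exact_mod_cast hj
    -- Translation by half a period of the character changes its sign but not its integral, which
    -- therefore vanishes.
    let s : Model n := Pi.single j (2 * (m j : ℝ))⁻¹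
    have hs : chi m s = -1 := by
      have h1 : icov m s = 1 / 2 := by
        simp only [icov_apply, s, Pi.single_apply, mul_ite, mul_zero, Finset.sum_ite_eq',
          Finset.mem_univ, if_true]
        field_simp
      rw [chi, h1, ← Complex.exp_pi_mul_I]
      congr 1
      push_cast
      ring
    have h2 := (isPeriodic_chi m).setIntegral_add s
    simp only [chi_add, hs, mul_neg, mul_one, integral_neg] at h2
    linear_combination (-1 / 2 : ℂ) * h2

variable [NormedSpace ℂ E]

theorem continuous_chi (m : Fin n → ℤ) : Continuous (chi m) := (contDiff_chi m).continuous

/-- The Fourier coefficients of an absolutely convergent Fourier series. -/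
theorem setIntegral_tsum_chi [IsScalarTower ℝ ℂ E] [CompleteSpace E] {a : (Fin n → ℤ) → E}
    (ha : Summable fun m => ‖a m‖) (k : Fin n → ℤ) :
    ∫ y in unitBox 0, chi (-k) y • ∑' m, chi m y • a m = a k := by
  have hs : ∀ y, chi (-k) y • ∑' m, chi m y • a m = ∑' m, chi (m - k) y • a m := by
    intro y
    have h : Summable fun m => chi m y • a m :=
      Summable.of_norm (by simpa only [norm_smul, norm_chi, one_mul] using ha)
    rw [← h.tsum_const_smul]
    refine tsum_congr fun m => ?_
    rw [smul_smul, ← chi_add_left, neg_add_eq_sub]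
  simp only [hs]
  have hn : ∀ m, (∫ y in unitBox 0, ‖chi (m - k) y • a m‖) = ‖a m‖ := by
    intro m
    simp [norm_smul, norm_chi, volume_unitBox, Measure.real]
  -- Absolute summability allows the exchange of sum and integral; orthogonality of the characters
  -- then leaves only the term `m = k`.
  have h := hasSum_integral_of_summable_integral_norm (μ := volume.restrict (unitBox 0))
    (F := fun m y => chi (m - k) y • a m)
    (fun m => integrable_unitBox 0 ((continuous_chi _).smul continuous_const))
    (by simpa only [hn] using ha)
  have h2 : ∀ m, (∫ y in unitBox 0, chi (m - k) y • a m) = if m = k then a k else 0 := by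
    intro m
    rw [integral_smul_const, integral_chi]
    by_cases hm : m = k
    · simp [hm]
    · simp [hm, sub_eq_zero]
  simp only [h2] at h
  exact h.unique (hasSum_ite_eq k (a k))

theorem eq_zero_of_tsum_chi_eq_zero [IsScalarTower ℝ ℂ E] [CompleteSpace E]
    {a : (Fin n → ℤ) → E} (ha : Summable fun m => ‖a m‖)
    (h : ∀ y, ∑' m, chi m y • a m = 0) (k : Fin n → ℤ) : a k = 0 := by
  rw [← setIntegral_tsum_chi ha k]
  simp [h]

/-- Fourier inversion on the torus. -/
theorem IsPeriodic.hasSum_of_summable {F : Model n → ℂ} (hF : IsPeriodic F) (hc : Continuous F)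
    (hs : Summable fun m : Fin n → ℤ => ∫ y in unitBox 0, chi (-m) y • F y) (y : Model n) :
    HasSum (fun m => chi m y • ∫ y in unitBox 0, chi (-m) y • F y) (F y) := by
  have hcont : Continuous fun t : UnitAddTorus (Fin n) => F (SYZ.torusRep t) := by
    -- Continuity on the torus is checked after pulling back along the quotient map, where the
    -- function becomes `F` again.
    have hq : IsOpenQuotientMap fun (y : Model n) (i : Fin n) => (y i : UnitAddCircle) :=
      IsOpenQuotientMap.piMap fun _ => QuotientAddGroup.isOpenQuotientMap_mk
    rw [← hq.continuous_comp_iff]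
    simpa only [Function.comp_def, hF.torusRep] using hc
  let H : C(UnitAddTorus (Fin n), ℂ) := ⟨_, hcont⟩
  have hchi : ∀ (m : Fin n → ℤ) (y : Model n),
      UnitAddTorus.mFourier m (fun i => (y i : UnitAddCircle)) = chi m y := by
    intro m y
    simp only [UnitAddTorus.mFourier, ContinuousMap.coe_mk, fourier_coe_apply]
    rw [← Complex.exp_sum, chi, icov_apply]
    congr 1
    push_cast
    rw [Finset.mul_sum]
    exact Finset.sum_congr rfl fun i _ => by ring
  have hcoef : ∀ m, UnitAddTorus.mFourierCoeff H m = ∫ y in unitBox 0, chi (-m) y • F y := by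
    intro m
    rw [UnitAddTorus.mFourierCoeff_eq_integral H m 0]
    simp only [hchi, H, ContinuousMap.coe_mk, hF.torusRep]
    rfl
  have h := UnitAddTorus.hasSum_mFourier_series_apply_of_summable (f := H)
    (by simpa only [← hcoef] using hs) (fun i => (y i : UnitAddCircle))
  simp only [hcoef, hchi] at h
  simp only [smul_eq_mul, H, ContinuousMap.coe_mk, hF.torusRep] at h ⊢
  simpa only [mul_comm] using h

end FourierCoefficients

/-! ### Rapid decay of the Fourier coefficients of smooth periodic functions -/

section SmoothCoefficients

open MeasureTheory

variable {n : ℕ} {E : Type*} [NormedAddCommGroup E]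

/-- Smooth functions `h(x, y̌)` on `U × ℝⁿ` that are `ℤⁿ`-periodic in `y̌`. -/
structure PeriodicSmooth [NormedSpace ℝ E] (U : Set (Model n)) (h : Model n × Model n → E) :
    Prop where
  smooth : ContDiffOn ℝ ∞ h (U ×ˢ Set.univ)
  periodic : ∀ u ∈ U, IsPeriodic fun y => h (u, y)

/-- The Fourier coefficients in the fibre direction. -/
def torusCoeff [NormedSpace ℝ E] [NormedSpace ℂ E] (h : Model n × Model n → E)
    (m : Fin n → ℤ) (u : Model n) : E :=
  ∫ y in unitBox 0, chi (-m) y • h (u, y)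

variable [NormedSpace ℝ E] {U : Set (Model n)} {h : Model n × Model n → E}

theorem PeriodicSmooth.contDiffAt (hU : IsOpen U) (hh : PeriodicSmooth U h) {u : Model n}
    (hu : u ∈ U) (y : Model n) : ContDiffAt ℝ ∞ h (u, y) :=
  hh.smooth.contDiffAt ((hU.prod isOpen_univ).mem_nhds ⟨hu, trivial⟩)

theorem PeriodicSmooth.continuous (hU : IsOpen U) (hh : PeriodicSmooth U h) {u : Model n}
    (hu : u ∈ U) : Continuous fun y => h (u, y) :=
  continuous_iff_continuousAt.2 fun y =>
    (hh.contDiffAt hU hu y).continuousAt.comp (f := fun y => (u, y)) (by fun_prop)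

theorem PeriodicSmooth.differential (hU : IsOpen U) (hh : PeriodicSmooth U h) :
    PeriodicSmooth U (fderiv ℝ h) := by
  refine ⟨hh.smooth.fderiv_of_isOpen (hU.prod isOpen_univ) (by simp), fun u hu y k => ?_⟩
  let c : Model n × Model n := (0, fun j => (k j : ℝ))
  have h1 : (fun p => h (p + c)) =ᶠ[𝓝 (u, y)] h := by
    filter_upwards [(hU.prod isOpen_univ).mem_nhds (show (u, y) ∈ U ×ˢ Set.univ from ⟨hu, trivial⟩)]
      with p hp
    have := hh.periodic p.1 hp.1 p.2 k
    simpa [c, Prod.add_def] using this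
  have h2 := h1.fderiv_eq (𝕜 := ℝ)
  rw [fderiv_comp_add_right] at h2
  simpa [c] using h2

variable [NormedSpace ℂ E] [IsScalarTower ℝ ℂ E] [CompleteSpace E]

omit [IsScalarTower ℝ ℂ E] [CompleteSpace E] in
-- The integral of a periodic function is translation invariant, and the shift of the argument is
-- absorbed by the character. Regarded as a function of `(u, s)`, the left side can be
-- differentiated under the integral; the `u`-part differentiates the coefficient and the `s`-part
-- is integration by parts.
theorem PeriodicSmooth.torusCoeff_shift (hh : PeriodicSmooth U h) (m : Fin n → ℤ) {u : Model n}
    (hu : u ∈ U) (s : Model n) :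
    ∫ y in unitBox 0, chi (-m) y • h (u, y + s) = chi m s • torusCoeff h m u := by
  have hp : IsPeriodic fun y => chi (-m) y • h (u, y) := fun y k => by
    change chi (-m) _ • h (u, _) = chi (-m) y • h (u, y)
    rw [isPeriodic_chi (-m) y k, show h (u, y + _) = h (u, y) from hh.periodic u hu y k]
  have h1 := hp.setIntegral_add s
  rw [torusCoeff, ← h1, ← integral_smul]
  refine integral_congr_ae (Filter.Eventually.of_forall fun y => ?_)
  simp only
  rw [chi_add, smul_smul, mul_left_comm, mul_comm (chi m s), chi_neg_mul, mul_one]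

omit [CompleteSpace E] in
/-- Differentiation under the integral sign, in the base and in the fibre directions at once. -/
theorem PeriodicSmooth.hasFDerivAt_shift (hU : IsOpen U) (hh : PeriodicSmooth U h)
    (m : Fin n → ℤ) {u : Model n} (hu : u ∈ U) :
    HasFDerivAt (fun p : Model n × Model n => chi m p.2 • torusCoeff h m p.1)
      (torusCoeff (fderiv ℝ h) m u) (u, 0) := by
  obtain ⟨r, hr, hrU⟩ := Metric.nhds_basis_closedBall.mem_iff.1 (hU.mem_nhds hu)
  have hd := hh.differential hU
  -- The fibre radius is `2` because the integrand is evaluated at `y + p.2` with `‖y‖ ≤ 1` on the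
  -- unit box and `‖p.2‖ < 1`.
  let K : Set (Model n × Model n) :=
    Metric.closedBall u r ×ˢ Metric.closedBall (0 : Model n) 2
  have hKc : IsCompact K := (isCompact_closedBall _ _).prod (isCompact_closedBall _ _)
  obtain ⟨C, hC⟩ := hKc.exists_bound_of_continuousOn
    (hd.smooth.continuousOn.mono (Set.prod_mono hrU (Set.subset_univ _)))
  let s : Set (Model n × Model n) := Metric.ball u r ×ˢ Metric.ball 0 1
  have hs : s ∈ 𝓝 (u, (0 : Model n)) :=
    prod_mem_nhds (Metric.ball_mem_nhds _ hr) (Metric.ball_mem_nhds _ one_pos)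
  have hsU : ∀ p ∈ s, p.1 ∈ U := fun p hp => hrU (Metric.ball_subset_closedBall hp.1)
  have hcont : ∀ p ∈ s, Continuous fun y => chi (-m) y • h (p.1, y + p.2) := fun p hp =>
    (continuous_chi _).smul ((hh.continuous hU (hsU p hp)).comp (by fun_prop))
  have hder : ∀ y, ∀ p ∈ s, HasFDerivAt (fun p : Model n × Model n => chi (-m) y • h (p.1, y + p.2))
      (chi (-m) y • fderiv ℝ h (p.1, y + p.2)) p := by
    intro y p hp
    have h1 : HasFDerivAt (fun p : Model n × Model n => (p.1, y + p.2))
        (ContinuousLinearMap.id ℝ _) p := by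
      have h2 : (fun p : Model n × Model n => (p.1, y + p.2)) = fun p => (0, y) + p := by
        funext p; ext <;> simp
      rw [h2]
      exact (hasFDerivAt_id p).const_add (0, y)
    have h3 := ((hh.contDiffAt hU (hsU p hp) (y + p.2)).differentiableAt (by simp)).hasFDerivAt
    exact (h3.comp p h1).const_smul (chi (-m) y)
  have hp0 : (u, (0 : Model n)) ∈ s := mem_of_mem_nhds hs
  have key := hasFDerivAt_integral_of_dominated_of_fderiv_le (μ := volume.restrict (unitBox 0))
    (F := fun (p : Model n × Model n) y => chi (-m) y • h (p.1, y + p.2))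
    (F' := fun p y => chi (-m) y • fderiv ℝ h (p.1, y + p.2)) (x₀ := (u, 0))
    (bound := fun _ => C) hs
    (Filter.eventually_of_mem hs fun p hp => (hcont p hp).aestronglyMeasurable)
    (integrable_unitBox 0 (hcont _ hp0))
    (Continuous.aestronglyMeasurable ((continuous_chi _).smul
      ((hd.continuous hU hu).comp (by fun_prop))))
    ?_ (integrable_const C) (Filter.Eventually.of_forall hder)
  · simp only [add_zero] at key
    refine key.congr_of_eventuallyEq ?_
    filter_upwards [hs] with p hp
    exact (hh.torusCoeff_shift m (hsU p hp) p.2).symm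
  · rw [ae_restrict_iff' (measurableSet_unitBox 0)]
    refine Filter.Eventually.of_forall fun y hy p hp => ?_
    rw [norm_smul, norm_chi, one_mul]
    refine hC _ ⟨Metric.ball_subset_closedBall hp.1, ?_⟩
    rw [mem_closedBall_zero_iff]
    have h1 : ‖y‖ ≤ 1 := (pi_norm_le_iff_of_nonneg zero_le_one).2 fun i => by
      have := hy i
      simp only [Pi.zero_apply, zero_add, Set.mem_Ioc] at this
      rw [Real.norm_of_nonneg this.1.le]
      exact this.2
    have h2 : ‖p.2‖ < 1 := by simpa using hp.2
    exact (norm_add_le _ _).trans (by linarith)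

omit [CompleteSpace E] in
theorem PeriodicSmooth.hasFDerivAt_torusCoeff (hU : IsOpen U) (hh : PeriodicSmooth U h)
    (m : Fin n → ℤ) {u : Model n} (hu : u ∈ U) :
    HasFDerivAt (torusCoeff h m)
      ((torusCoeff (fderiv ℝ h) m u).comp (ContinuousLinearMap.inl ℝ _ _)) u := by
  have h1 := (hh.hasFDerivAt_shift hU m hu).comp u
    (f := fun v : Model n => (v, (0 : Model n))) (hasFDerivAt_prodMk_left u 0)
  refine h1.congr_of_eventuallyEq (Filter.Eventually.of_forall fun v => ?_)
  simp [chi_zero]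

omit [CompleteSpace E] in
/-- Integration by parts. -/
theorem PeriodicSmooth.torusCoeff_fderiv_snd (hU : IsOpen U) (hh : PeriodicSmooth U h)
    (m : Fin n → ℤ) {u : Model n} (hu : u ∈ U) (v : Model n) :
    torusCoeff (fderiv ℝ h) m u (0, v)
      = (2 * Real.pi * Complex.I * (icov m v : ℝ) : ℂ) • torusCoeff h m u := by
  have h1 := (hh.hasFDerivAt_shift hU m hu).comp (0 : Model n)
    (f := fun v : Model n => (u, v)) (hasFDerivAt_prodMk_right u 0)
  -- The same function of `v` is differentiated directly; uniqueness of the derivative at `0` is the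
  -- integration by parts formula.
  have h2 : HasFDerivAt (fun v : Model n => chi m v • torusCoeff h m u)
      ((chi m 0 • (dchi m).comp (ContinuousLinearMap.inr ℝ _ _)).smulRight (torusCoeff h m u)) 0 := by
    have h3 := ((hasFDerivAt_chi m ((0 : Model n), (0 : Model n))).comp (0 : Model n)
      (f := fun v : Model n => ((0 : Model n), v)) (hasFDerivAt_prodMk_right 0 0)).smul_const
      (torusCoeff h m u)
    exact h3
  have h4 := congrArg (fun L : Model n →L[ℝ] E => L v) (h1.unique h2)
  simpa [chi_zero, dchi_apply] using h4

theorem PeriodicSmooth.contDiffOn_torusCoeff_nat (hU : IsOpen U) (m : Fin n → ℤ) (k : ℕ) :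
    ∀ {E : Type*} [NormedAddCommGroup E] [NormedSpace ℝ E] [NormedSpace ℂ E]
      [IsScalarTower ℝ ℂ E] [CompleteSpace E] {h : Model n × Model n → E},
      PeriodicSmooth U h → ContDiffOn ℝ k (torusCoeff h m) U := by
  induction k with
  | zero =>
    intro E _ _ _ _ _ h hh
    refine contDiffOn_zero.2 fun u hu => ?_
    exact (hh.hasFDerivAt_torusCoeff hU m hu).continuousAt.continuousWithinAt
  | succ k ih =>
    intro E _ _ _ _ _ h hh
    push_cast
    rw [contDiffOn_succ_iff_fderiv_of_isOpen hU]
    refine ⟨fun u hu => ?_, fun h => ?_, ?_⟩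
    · exact (hh.hasFDerivAt_torusCoeff hU m hu).differentiableAt.differentiableWithinAt
    · exact absurd h (by simp)
    · refine ContDiffOn.congr ?_ fun u hu => (hh.hasFDerivAt_torusCoeff hU m hu).fderiv
      exact (ih (hh.differential hU)).clm_comp contDiffOn_const

omit [IsScalarTower ℝ ℂ E] [CompleteSpace E] in
theorem PeriodicSmooth.torusCoeff_bound (hh : PeriodicSmooth U h)
    {K : Set (Model n)} (hKU : K ⊆ U) (hK : IsCompact K) :
    ∃ C : ℝ, ∀ m, ∀ u ∈ K, ‖torusCoeff h m u‖ ≤ C := by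
  obtain ⟨C, hC⟩ := (hK.prod (isCompact_Icc (a := (0 : Model n)) (b := 0 + 1))).exists_bound_of_continuousOn
    (hh.smooth.continuousOn.mono (Set.prod_mono hKU (Set.subset_univ _)))
  refine ⟨C, fun m u hu => ?_⟩
  have h1 := norm_setIntegral_le_of_norm_le_const (μ := volume) (s := unitBox (0 : Model n))
    (f := fun y => chi (-m) y • h (u, y)) (C := C)
    (by rw [volume_unitBox]; exact ENNReal.one_lt_top) fun y hy => by
      rw [norm_smul, norm_chi, one_mul]
      exact hC _ ⟨hu, unitBox_subset_Icc 0 hy⟩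
  simpa [Measure.real, volume_unitBox, torusCoeff] using h1

omit [CompleteSpace E] in
-- Integration by parts in the `j`-th fibre direction turns the factor `mⱼ` into a derivative of
-- `h`; the constant `2π ≥ 1` is discarded. Iterating this trades any power of `‖m‖` for
-- derivatives.
theorem PeriodicSmooth.norm_mul_torusCoeff_le (hU : IsOpen U) (hh : PeriodicSmooth U h)
    (m : Fin n → ℤ) {u : Model n} (hu : u ∈ U) :
    ‖m‖ * ‖torusCoeff h m u‖ ≤ ‖torusCoeff (fderiv ℝ h) m u‖ := by
  rcases (norm_nonneg (torusCoeff h m u)).eq_or_lt with h0 | h0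
  · rw [← h0, mul_zero]; exact norm_nonneg _
  rw [← le_div_iff₀ h0]
  refine (pi_norm_le_iff_of_nonneg (by positivity)).2 fun j => ?_
  rw [le_div_iff₀ h0]
  have h1 := hh.torusCoeff_fderiv_snd hU m hu (Pi.single j 1)
  have h2 := (torusCoeff (fderiv ℝ h) m u).le_opNorm (0, Pi.single j 1)
  have h3 : ‖((0 : Model n), (Pi.single j 1 : Model n))‖ ≤ 1 := by
    rw [Prod.norm_mk, norm_zero]
    refine max_le zero_le_one ((pi_norm_le_iff_of_nonneg zero_le_one).2 fun i => ?_)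
    by_cases hi : i = j
    · subst hi; simp
    · simp [hi]
  rw [h1, icov_single, norm_smul, norm_mul, norm_mul, norm_mul, Complex.norm_I, Complex.norm_real,
    Complex.norm_real, Real.norm_of_nonneg Real.pi_pos.le, mul_one, Complex.norm_ofNat,
    Int.norm_cast_real] at h2
  have h4 : 1 * (‖m j‖ * ‖torusCoeff h m u‖) ≤ 2 * Real.pi * (‖m j‖ * ‖torusCoeff h m u‖) := by
    gcongr
    linarith [Real.pi_gt_three]
  calc _ ≤ _ := by linarith
    _ ≤ _ := h2
    _ ≤ _ := mul_le_of_le_one_right (norm_nonneg _) h3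

theorem PeriodicSmooth.norm_pow_mul_torusCoeff_bound (hU : IsOpen U) {K : Set (Model n)}
    (hKU : K ⊆ U) (hK : IsCompact K) (k : ℕ) :
    ∀ {E : Type*} [NormedAddCommGroup E] [NormedSpace ℝ E] [NormedSpace ℂ E]
      [IsScalarTower ℝ ℂ E] [CompleteSpace E] {h : Model n × Model n → E},
      PeriodicSmooth U h → ∃ C : ℝ, ∀ m, ∀ u ∈ K, ‖m‖ ^ k * ‖torusCoeff h m u‖ ≤ C := by
  induction k with
  | zero =>
    intro E _ _ _ _ _ h hh
    simpa using hh.torusCoeff_bound hKU hK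
  | succ k ih =>
    intro E _ _ _ _ _ h hh
    obtain ⟨C, hC⟩ := ih (hh.differential hU)
    refine ⟨C, fun m u hu => le_trans ?_ (hC m u hu)⟩
    rw [pow_succ, mul_assoc]
    gcongr
    exact hh.norm_mul_torusCoeff_le hU m (hKU hu)

/-- A base derivative of the coefficient is the restriction to horizontal vectors of the coefficient
of `fderiv ℝ h`, so induction on `l` reduces to the case without derivatives, for all targets at
once. -/
theorem PeriodicSmooth.iteratedFDeriv_torusCoeff_bound (hU : IsOpen U) {K : Set (Model n)}
    (hKU : K ⊆ U) (hK : IsCompact K) (k l : ℕ) :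
    ∀ {E : Type*} [NormedAddCommGroup E] [NormedSpace ℝ E] [NormedSpace ℂ E]
      [IsScalarTower ℝ ℂ E] [CompleteSpace E] {h : Model n × Model n → E},
      PeriodicSmooth U h → ∃ C : ℝ, ∀ m, ∀ u ∈ K,
        ‖m‖ ^ k * ‖iteratedFDeriv ℝ l (torusCoeff h m) u‖ ≤ C := by
  induction l with
  | zero =>
    intro E _ _ _ _ _ h hh
    simpa using hh.norm_pow_mul_torusCoeff_bound hU hKU hK k
  | succ l ih =>
    intro E _ _ _ _ _ h hh
    obtain ⟨C, hC⟩ := ih (hh.differential hU)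
    let L : (Model n × Model n →L[ℝ] E) →L[ℝ] (Model n →L[ℝ] E) :=
      (ContinuousLinearMap.compL ℝ (Model n) (Model n × Model n) E).flip
        (ContinuousLinearMap.inl ℝ (Model n) (Model n))
    refine ⟨‖L‖ * C, fun m u hu => ?_⟩
    have h1 : fderiv ℝ (torusCoeff h m) =ᶠ[𝓝 u] L ∘ torusCoeff (fderiv ℝ h) m := by
      filter_upwards [hU.mem_nhds (hKU hu)] with v hv
      exact (hh.hasFDerivAt_torusCoeff hU m hv).fderiv
    rw [← norm_iteratedFDeriv_fderiv, (Filter.EventuallyEq.iteratedFDeriv ℝ h1 l).eq_of_nhds]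
    have h2 : ContDiffAt ℝ l (torusCoeff (fderiv ℝ h) m) u :=
      (PeriodicSmooth.contDiffOn_torusCoeff_nat hU m l (hh.differential hU)).contDiffAt
        (hU.mem_nhds (hKU hu))
    calc _ ≤ ‖m‖ ^ k * (‖L‖ * ‖iteratedFDeriv ℝ l (torusCoeff (fderiv ℝ h) m) u‖) := by
          gcongr
          exact L.norm_iteratedFDeriv_comp_left h2 le_rfl
      _ = ‖L‖ * (‖m‖ ^ k * ‖iteratedFDeriv ℝ l (torusCoeff (fderiv ℝ h) m) u‖) := by ring
      _ ≤ _ := by gcongr; exact hC m u hu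

/-- The Fourier coefficients of a smooth periodic function decay rapidly. -/
theorem PeriodicSmooth.decayFamily (hU : IsOpen U) (hh : PeriodicSmooth U h) :
    DecayFamily U (torusCoeff h) :=
  ⟨fun m => contDiffOn_infty.2 fun k => contDiffOn_torusCoeff_nat hU m k hh,
    fun _ hKU hK k l => iteratedFDeriv_torusCoeff_bound hU hKU hK k l hh⟩

end SmoothCoefficients

/-! ## Integral affine coordinates -/

section Charts

variable {n : ℕ}

theorem castMatrix_mul {A C : GL (Fin n) ℤ} (h : A * C = 1) :
    (A : Matrix (Fin n) (Fin n) ℤ).map (Int.cast : ℤ → ℝ)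
      * (C : Matrix (Fin n) (Fin n) ℤ).map (Int.cast : ℤ → ℝ) = 1 := by
  have h1 := Matrix.map_mul (L := (A : Matrix (Fin n) (Fin n) ℤ))
    (M := (C : Matrix (Fin n) (Fin n) ℤ)) (f := Int.castRingHom ℝ)
  rw [← Units.val_mul, h] at h1
  simpa using h1.symm

/-- An element of `GL(n, ℤ)` acting on `ℝⁿ`. -/
def glMap (A : GL (Fin n) ℤ) : Model n ≃L[ℝ] Model n :=
  LinearEquiv.toContinuousLinearEquiv
    { Matrix.mulVecLin ((A : Matrix (Fin n) (Fin n) ℤ).map (Int.cast : ℤ → ℝ)) with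
      invFun := ((A⁻¹ : GL (Fin n) ℤ) : Matrix (Fin n) (Fin n) ℤ).map (Int.cast : ℤ → ℝ) |>.mulVec
      left_inv := fun v => by
        change Matrix.mulVec _ (Matrix.mulVec _ v) = v
        rw [Matrix.mulVec_mulVec]
        rw [castMatrix_mul (inv_mul_cancel A), Matrix.one_mulVec]
      right_inv := fun v => by
        change Matrix.mulVec ((A : Matrix (Fin n) (Fin n) ℤ).map (Int.cast : ℤ → ℝ))
          (Matrix.mulVec (((A⁻¹ : GL (Fin n) ℤ) : Matrix (Fin n) (Fin n) ℤ).map Int.cast) v) = v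
        rw [Matrix.mulVec_mulVec]
        rw [castMatrix_mul (mul_inv_cancel A), Matrix.one_mulVec] }

theorem glMap_apply (A : GL (Fin n) ℤ) (v : Model n) :
    glMap A v = ((A : Matrix (Fin n) (Fin n) ℤ).map (Int.cast : ℤ → ℝ)).mulVec v := rfl

theorem glMap_symm_apply (A : GL (Fin n) ℤ) (v : Model n) :
    (glMap A).symm v = glMap A⁻¹ v := rfl

theorem glMap_int (A : GL (Fin n) ℤ) (k : Fin n → ℤ) :
    ∃ l : Fin n → ℤ, glMap A (fun j => (k j : ℝ)) = fun j => (l j : ℝ) := by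
  refine ⟨(A : Matrix (Fin n) (Fin n) ℤ).mulVec k, ?_⟩
  funext j
  simp [glMap_apply, Matrix.mulVec, dotProduct]

variable {B : Type*} [TopologicalSpace B] [ChartedSpace (Model n) B]
  [HasGroupoid B (integralAffineGroupoid n)]

/-- The affine formula is only local: `A` and `b` may differ between components of the overlap of
two charts. -/
theorem eventually_transition {e e' : OpenPartialHomeomorph B (Model n)}
    (he : e ∈ atlas (Model n) B) (he' : e' ∈ atlas (Model n) B) {u : Model n} (hu : u ∈ e.target)
    (hx : e.symm u ∈ e'.source) : ∃ (A : GL (Fin n) ℤ) (b : Model n),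
      ∀ᶠ v in 𝓝 u, e' (e.symm v) = glMap A v + b := by
  have h := HasGroupoid.compatible (G := integralAffineGroupoid n) he he'
  rw [integralAffineGroupoid, mem_groupoid_of_pregroupoid] at h
  exact h.1 u (by simp [hu, hx])

variable (n B) in
theorem isManifold_of_integralAffine : IsManifold 𝓘(ℝ, Model n) ∞ B := by
  refine isManifold_of_contDiffOn _ _ _ fun e e' he he' => ?_
  intro u hu
  simp only [modelWithCornersSelf_coe, modelWithCornersSelf_coe_symm, Set.preimage_id_eq, id_eq,
    Set.range_id, Set.inter_univ] at hu ⊢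
  simp only [OpenPartialHomeomorph.trans_source, OpenPartialHomeomorph.symm_source,
    Set.mem_inter_iff, Set.mem_preimage] at hu
  obtain ⟨A, b, h⟩ := eventually_transition he he' hu.1 hu.2
  have h1 : ContDiffAt ℝ ∞ (fun v => glMap A v + b) u :=
    ((glMap A).contDiff.add contDiff_const).contDiffAt
  exact (h1.congr_of_eventuallyEq h).contDiffWithinAt

/-- `fromChart` is defined with `ContinuousLinearMap.inverse`, which is zero for a non-invertible
map; over the source of a chart of the atlas it is a genuine inverse. -/
theorem exists_toChart_eq {e : OpenPartialHomeomorph B (Model n)} (he : e ∈ atlas (Model n) B)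
    {x : B} (hx : x ∈ e.source) : ∃ L : Tan n x ≃L[ℝ] Model n,
      toChart e x = L ∧ fromChart e x = L.symm := by
  have := isManifold_of_integralAffine n B
  have : IsManifold 𝓘(ℝ, Model n) 1 B := IsManifold.of_le (n := ∞) (by simp)
  have h := mdifferentiable_of_mem_atlas (I := 𝓘(ℝ, Model n)) he
  let L := (h.mfderiv hx).trans (NormedSpace.fromTangentSpace (𝕜 := ℝ) (e x))
  have h1 : toChart e x = L := rfl
  exact ⟨L, h1, by rw [fromChart, h1, ContinuousLinearMap.inverse_equiv]⟩

variable {e e' : OpenPartialHomeomorph B (Model n)} {x : B}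

theorem toChart_fromChart (he : e ∈ atlas (Model n) B) (hx : x ∈ e.source) (v : Model n) :
    toChart e x (fromChart e x v) = v := by
  obtain ⟨L, h1, h2⟩ := exists_toChart_eq he hx
  rw [h1, h2]
  exact L.apply_symm_apply v

theorem fromChart_toChart (he : e ∈ atlas (Model n) B) (hx : x ∈ e.source) (v : Tan n x) :
    fromChart e x (toChart e x v) = v := by
  obtain ⟨L, h1, h2⟩ := exists_toChart_eq he hx
  rw [h1, h2]
  exact L.symm_apply_apply v

theorem toChart_transition (he : e ∈ atlas (Model n) B)
    {u : Model n} (hu : u ∈ e.target) {A : GL (Fin n) ℤ} {b : Model n}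
    (h : ∀ᶠ v in 𝓝 u, e' (e.symm v) = glMap A v + b) (w : Tan n (e.symm u)) :
    toChart e' (e.symm u) w = glMap A (toChart e (e.symm u) w) := by
  have := isManifold_of_integralAffine n B
  have : IsManifold 𝓘(ℝ, Model n) 1 B := IsManifold.of_le (n := ∞) (by simp)
  have hs : e.symm u ∈ e.source := e.map_target hu
  have h1 : MDifferentiableAt 𝓘(ℝ, Model n) 𝓘(ℝ, Model n) e (e.symm u) :=
    mdifferentiableAt_atlas (I := 𝓘(ℝ, Model n)) he hs
  have h2 : e' =ᶠ[𝓝 (e.symm u)] (fun v => glMap A v + b) ∘ e := by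
    have h3 := (e.continuousAt hs).eventually (by rwa [e.right_inv hu])
    filter_upwards [h3, e.open_source.mem_nhds hs] with y hy hys
    rw [e.left_inv hys] at hy
    exact hy
  have h4 : HasFDerivAt (fun v => glMap A v + b) (glMap A : Model n →L[ℝ] Model n) (e (e.symm u)) :=
    (glMap A).hasFDerivAt.add_const b
  have h5 : HasMFDerivAt 𝓘(ℝ, Model n) 𝓘(ℝ, Model n) e' (e.symm u)
      ((glMap A : Model n →L[ℝ] Model n).comp (mfderiv 𝓘(ℝ, Model n) 𝓘(ℝ, Model n) e (e.symm u))) :=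
    (h4.hasMFDerivAt.comp (e.symm u) h1.hasMFDerivAt).congr_of_eventuallyEq h2
  have h6 := congrArg (fun L => L w) h5.mfderiv
  exact h6

theorem fromChart_transition (he : e ∈ atlas (Model n) B) (he' : e' ∈ atlas (Model n) B)
    {u : Model n} (hu : u ∈ e.target) (hx : e.symm u ∈ e'.source) {A : GL (Fin n) ℤ} {b : Model n}
    (h : ∀ᶠ v in 𝓝 u, e' (e.symm v) = glMap A v + b) (w : Model n) :
    fromChart e' (e.symm u) (glMap A w) = fromChart e (e.symm u) w := by
  have h1 := toChart_transition he hu h (fromChart e (e.symm u) w)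
  rw [toChart_fromChart he (e.map_target hu)] at h1
  rw [← h1, fromChart_toChart he' hx]

/-- The lattice is defined with the preferred chart at `x`. Linear parts of transition maps and
their inverses preserve `ℤⁿ`, so every chart of the atlas gives the same lattice. -/
theorem mem_lattice_iff (he : e ∈ atlas (Model n) B) (hx : x ∈ e.source) {v : Tan n x} :
    v ∈ lattice n x ↔ ∃ k : Fin n → ℤ, toChart e x v = fun j => (k j : ℝ) := by
  have h0 : v ∈ lattice n x ↔
      ∃ k : Fin n → ℤ, toChart (chartAt (Model n) x) x v = fun j => (k j : ℝ) := by
    constructor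
    · intro h
      choose k hk using h
      exact ⟨k, funext hk⟩
    · rintro ⟨k, hk⟩ j
      exact ⟨k j, congrFun hk j⟩
  rw [h0]
  obtain ⟨u, hu, rfl⟩ : ∃ u ∈ e.target, e.symm u = x := ⟨e x, e.map_source hx, e.left_inv hx⟩
  obtain ⟨A, b, h⟩ := eventually_transition he (chart_mem_atlas (Model n) (e.symm u)) hu
    (mem_chart_source _ _)
  rw [toChart_transition he hu h]
  constructor
  · rintro ⟨k, hk⟩
    obtain ⟨l, hl⟩ := glMap_int A⁻¹ k
    refine ⟨l, ?_⟩
    rw [← hl, ← glMap_symm_apply, ← hk, ContinuousLinearEquiv.symm_apply_apply]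
  · rintro ⟨k, hk⟩
    rw [hk]
    exact glMap_int A k

/-- The vectors `∂/∂xʲ` lie in the lattice, so the components `mⱼ` of a dual lattice element are
integers. -/
theorem mem_dualLattice_iff (he : e ∈ atlas (Model n) B) (hx : x ∈ e.source) {η : Cotan n x} :
    η ∈ dualLattice n x ↔ ∃ m : Fin n → ℤ, η = covector e x (icov m) := by
  constructor
  · intro h
    have h1 : ∀ j, ∃ k : ℤ, η (fromChart e x (Pi.single j 1)) = k := fun j => by
      refine h _ ((mem_lattice_iff he hx).2 ⟨Pi.single j 1, ?_⟩)
      rw [toChart_fromChart he hx]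
      funext i
      by_cases hi : i = j
      · subst hi; simp
      · simp [hi]
    choose m hm using h1
    refine ⟨m, ?_⟩
    ext v
    have h2 : v = fromChart e x (∑ j, toChart e x v j • (Pi.single j 1 : Model n)) := by
      rw [← pi_eq_sum_univ', fromChart_toChart he hx]
    conv_lhs => rw [h2]
    rw [map_sum, map_sum, covector, ContinuousLinearMap.comp_apply, icov_apply]
    refine Finset.sum_congr rfl fun j _ => ?_
    rw [map_smul, map_smul, hm, smul_eq_mul, mul_comm]
  · rintro ⟨m, rfl⟩ v hv
    obtain ⟨k, hk⟩ := (mem_lattice_iff he hx).1 hv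
    refine ⟨∑ j, m j * k j, ?_⟩
    rw [covector, ContinuousLinearMap.comp_apply, hk, icov_apply]
    push_cast
    rfl

theorem covector_comp_fromChart (he : e ∈ atlas (Model n) B) (hx : x ∈ e.source)
    (a : Model n →L[ℝ] ℝ) : (covector e x a).comp (fromChart e x) = a := by
  ext v
  exact congrArg a (toChart_fromChart he hx v)

theorem covector_comp_of_fromChart (he : e ∈ atlas (Model n) B) (hx : x ∈ e.source)
    (η : Cotan n x) : covector e x (η.comp (fromChart e x)) = η := by
  ext v
  exact congrArg η (fromChart_toChart he hx v)

theorem covector_injective (he : e ∈ atlas (Model n) B) (hx : x ∈ e.source) :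
    Function.Injective (covector e x) := fun a a' h => by
  rw [← covector_comp_fromChart he hx a, h, covector_comp_fromChart he hx]

omit [HasGroupoid B (integralAffineGroupoid n)] in
theorem covector_add (a a' : Model n →L[ℝ] ℝ) :
    covector e x (a + a') = covector e x a + covector e x a' := rfl

omit [HasGroupoid B (integralAffineGroupoid n)] in
theorem covector_sub (a a' : Model n →L[ℝ] ℝ) :
    covector e x (a - a') = covector e x a - covector e x a' := rfl

theorem covector_transition (he : e ∈ atlas (Model n) B)
    {u : Model n} (hu : u ∈ e.target) {A : GL (Fin n) ℤ} {b : Model n}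
    (h : ∀ᶠ v in 𝓝 u, e' (e.symm v) = glMap A v + b) (a : Model n →L[ℝ] ℝ) :
    covector e' (e.symm u) a = covector e (e.symm u) (a.comp (glMap A : Model n →L[ℝ] Model n)) := by
  ext v
  exact congrArg a (toChart_transition he hu h v)

end Charts

/-! ### Local comparison of the metric with the coordinate norm -/

section Metric

variable {n : ℕ} {B : Type*} [TopologicalSpace B] [ChartedSpace (Model n) B]

theorem HessianMetric.conorm_nonneg (g : HessianMetric n B) (x : B) (η : Cotan n x) :
    0 ≤ g.conorm x η := by
  refine Real.sSup_nonneg ?_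
  rintro r ⟨v, _, rfl⟩
  exact abs_nonneg _

variable [HasGroupoid B (integralAffineGroupoid n)] {e : OpenPartialHomeomorph B (Model n)}

omit [HasGroupoid B (integralAffineGroupoid n)] in
-- The structure does not ask for continuity of `g`; it follows since the coefficients are second
-- derivatives of a smooth potential.
theorem HessianMetric.continuousOn_coord (g : HessianMetric n B) (he : e ∈ atlas (Model n) B) :
    ContinuousOn (fun p : Model n × Model n =>
      g.toFun (e.symm p.1) (fromChart e (e.symm p.1) p.2) (fromChart e (e.symm p.1) p.2))
      (e.target ×ˢ Set.univ) := by
  rintro ⟨u, a⟩ ⟨hu, -⟩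
  obtain ⟨U, φ, hU, huU, -, hφ, -, h⟩ := g.hessian e he (e.symm u) (e.map_target hu)
  rw [e.right_inv hu] at huU
  have h1 : ContinuousAt (fderiv ℝ (fderiv ℝ φ)) u := by
    have h2 : ContDiffOn ℝ ∞ (fderiv ℝ φ) U := hφ.fderiv_of_isOpen hU (by simp)
    have h3 : ContDiffOn ℝ ∞ (fderiv ℝ (fderiv ℝ φ)) U := h2.fderiv_of_isOpen hU (by simp)
    exact h3.continuousOn.continuousAt (hU.mem_nhds huU)
  have h4 : ContinuousAt (fun p : Model n × Model n => fderiv ℝ (fderiv ℝ φ) p.1 p.2 p.2) (u, a) := by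
    have h5 : ContinuousAt (fun p : Model n × Model n => fderiv ℝ (fderiv ℝ φ) p.1) (u, a) :=
      ContinuousAt.comp (f := Prod.fst) (x := (u, a)) h1 continuousAt_fst
    exact (h5.clm_apply continuousAt_snd).clm_apply continuousAt_snd
  refine (h4.congr ?_).continuousWithinAt
  filter_upwards [(hU.prod isOpen_univ).mem_nhds (show (u, a) ∈ U ×ˢ Set.univ from ⟨huU, trivial⟩)]
    with p hp
  exact (h p.1 hp.1 p.2 p.2).symm

theorem fromChart_ne_zero (he : e ∈ atlas (Model n) B) {x : B} (hx : x ∈ e.source) {a : Model n}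
    (ha : a ≠ 0) : fromChart e x a ≠ 0 := fun h => ha <| by
  rw [← toChart_fromChart he hx a, h, map_zero]

/-- On compact subsets of a chart, `g` is comparable with the norm of `ℝⁿ`. -/
theorem HessianMetric.exists_comparison (g : HessianMetric n B) (he : e ∈ atlas (Model n) B)
    {K : Set (Model n)} (hK : IsCompact K) (hKe : K ⊆ e.target) : ∃ D : ℝ, 0 < D ∧ ∀ u ∈ K,
      (∀ a, g.toFun (e.symm u) (fromChart e (e.symm u) a) (fromChart e (e.symm u) a) ≤ 1 → ‖a‖ ≤ D) ∧
      (∀ a, ‖a‖ ≤ D⁻¹ →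
        g.toFun (e.symm u) (fromChart e (e.symm u) a) (fromChart e (e.symm u) a) ≤ 1) := by
  have hcomp : IsCompact (K ×ˢ Metric.sphere (0 : Model n) 1) := hK.prod (isCompact_sphere _ _)
  have hcont := (g.continuousOn_coord he).mono
    (Set.prod_mono hKe (Set.subset_univ (Metric.sphere (0 : Model n) 1)))
  obtain ⟨C, hC⟩ := hcomp.exists_bound_of_continuousOn hcont
  -- Positivity of `g` and compactness of `K` times the unit sphere give a uniform positive lower
  -- bound `c`.
  obtain ⟨c, hc0, hc⟩ := hcomp.exists_forall_le' hcont (a := 0) fun p hp =>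
    g.pos _ _ (fromChart_ne_zero he (e.map_target (hKe hp.1)) (by
      rintro h
      have := hp.2
      rw [h] at this
      simp at this))
  have hscale : ∀ u ∈ K, ∀ a : Model n, a ≠ 0 → ∃ b ∈ Metric.sphere (0 : Model n) 1,
      g.toFun (e.symm u) (fromChart e (e.symm u) a) (fromChart e (e.symm u) a)
        = ‖a‖ ^ 2 * g.toFun (e.symm u) (fromChart e (e.symm u) b) (fromChart e (e.symm u) b) := by
    intro u _ a ha
    have hn : ‖a‖ ≠ 0 := norm_ne_zero_iff.2 ha
    refine ⟨‖a‖⁻¹ • a, by simp [norm_smul, hn], ?_⟩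
    simp only [map_smul, smul_apply, smul_eq_mul]
    field_simp
  -- From `c‖a‖² ≤ g(a, a) ≤ C‖a‖²`, the first inclusion of balls needs `D² ≥ c⁻¹` and the second
  -- `D² ≥ C`; the `1` makes `D` positive.
  let D := max (max (Real.sqrt c⁻¹) (Real.sqrt C)) 1
  have hD1 : 1 ≤ D := le_max_right _ _
  refine ⟨D, by linarith, fun u hu => ⟨fun a h => ?_, fun a h => ?_⟩⟩
  · by_cases ha : a = 0
    · rw [ha, norm_zero]; linarith
    obtain ⟨b, hb, hab⟩ := hscale u hu a ha
    rw [hab] at h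
    have h1 := hc (u, b) ⟨hu, hb⟩
    have h2 : ‖a‖ ^ 2 * c ≤ 1 := (mul_le_mul_of_nonneg_left h1 (by positivity)).trans h
    refine le_trans (Real.le_sqrt_of_sq_le ?_) ((le_max_left _ _).trans (le_max_left _ _))
    rwa [← one_div, le_div_iff₀ hc0]
  · by_cases ha : a = 0
    · rw [ha]; simp
    obtain ⟨b, hb, hab⟩ := hscale u hu a ha
    rw [hab]
    have h1 := (le_abs_self _).trans (hC (u, b) ⟨hu, hb⟩)
    have hD0 : 0 < D := by linarith
    have h2 : C ≤ D ^ 2 := by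
      rcases le_total C 0 with h | h
      · nlinarith
      · rw [← Real.sq_sqrt h]
        gcongr
        exact (le_max_right _ _).trans (le_max_left _ _)
    calc _ ≤ (D⁻¹) ^ 2 * D ^ 2 := by
          refine mul_le_mul (by gcongr) (h1.trans h2) ?_ (by positivity)
          have := hc (u, b) ⟨hu, hb⟩
          exact hc0.le.trans this
      _ = 1 := by field_simp

/-- On compact subsets of a chart, the conorm of `g` is comparable with the dual norm of `ℝⁿ`. -/
theorem HessianMetric.exists_conorm_comparison (g : HessianMetric n B)
    (he : e ∈ atlas (Model n) B) {K : Set (Model n)} (hK : IsCompact K) (hKe : K ⊆ e.target) :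
    ∃ D : ℝ, 0 < D ∧ ∀ u ∈ K,
      (∀ a, g.toFun (e.symm u) (fromChart e (e.symm u) a) (fromChart e (e.symm u) a) ≤ 1 → ‖a‖ ≤ D) ∧
      (∀ a, ‖a‖ ≤ D⁻¹ →
        g.toFun (e.symm u) (fromChart e (e.symm u) a) (fromChart e (e.symm u) a) ≤ 1) ∧
      (∀ w : Model n →L[ℝ] ℝ, g.conorm (e.symm u) (covector e (e.symm u) w) ≤ D * ‖w‖) ∧
      ∀ w : Model n →L[ℝ] ℝ, ‖w‖ ≤ D * g.conorm (e.symm u) (covector e (e.symm u) w) := by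
  obtain ⟨D, hD, h⟩ := g.exists_comparison he hK hKe
  refine ⟨D, hD, fun u hu => ⟨(h u hu).1, (h u hu).2, ?_⟩⟩
  have hs := e.map_target (hKe hu)
  -- This bound gives the upper estimate and also the boundedness that lets single vectors bound the
  -- supremum `conorm` from below.
  have hb : ∀ w : Model n →L[ℝ] ℝ, ∀ r ∈ {r : ℝ | ∃ v : Tan n (e.symm u),
      g.toFun (e.symm u) v v ≤ 1 ∧ r = |covector e (e.symm u) w v|}, r ≤ D * ‖w‖ := by
    rintro w r ⟨v, hv, rfl⟩
    rw [← fromChart_toChart he hs v] at hv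
    have h1 := (h u hu).1 _ hv
    calc _ = ‖w (toChart e (e.symm u) v)‖ := rfl
      _ ≤ ‖w‖ * ‖toChart e (e.symm u) v‖ := w.le_opNorm _
      _ ≤ D * ‖w‖ := by rw [mul_comm]; gcongr
  refine ⟨fun w => Real.sSup_le (hb w) (by positivity), fun w => ?_⟩
  refine ContinuousLinearMap.opNorm_le_of_unit_norm
    (mul_nonneg hD.le (g.conorm_nonneg _ _)) fun z hz => ?_
  have h1 : |covector e (e.symm u) w (fromChart e (e.symm u) (D⁻¹ • z))|
      ≤ g.conorm (e.symm u) (covector e (e.symm u) w) := by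
    refine le_csSup ⟨_, hb w⟩ ⟨_, (h u hu).2 _ ?_, rfl⟩
    rw [norm_smul, hz, mul_one, Real.norm_of_nonneg (by positivity)]
  have h2 : covector e (e.symm u) w (fromChart e (e.symm u) (D⁻¹ • z)) = D⁻¹ * w z := by
    rw [covector, ContinuousLinearMap.comp_apply, toChart_fromChart he hs, map_smul, smul_eq_mul]
  rw [h2, abs_mul, abs_of_pos (inv_pos.2 hD), inv_mul_le_iff₀ hD] at h1
  exact h1

end Metric

/-! ## Branches of the path space -/

section Branches

variable {n : ℕ} {B : Type*} [TopologicalSpace B] [ChartedSpace (Model n) B]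
  [HasGroupoid B (integralAffineGroupoid n)] {ħ : ℝ} {ξ₁ ξ₂ : LagrangianSection n B ħ}
  {e e' : OpenPartialHomeomorph B (Model n)} {U U' : Set (Model n)}
  {w w' η₁ η₂ : Model n → (Model n →L[ℝ] ℝ)} {q : ℕ}

theorem covector_icov_mem (he : e ∈ atlas (Model n) B) {x : B} (hx : x ∈ e.source)
    (m : Fin n → ℤ) : covector e x (icov m) ∈ dualLattice n x :=
  (mem_dualLattice_iff he hx).2 ⟨m, rfl⟩

theorem IsLocalLift.isBranch (he : e ∈ atlas (Model n) B) (h₁ : IsLocalLift ξ₁.toFun e U η₁)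
    (h₂ : IsLocalLift ξ₂.toFun e U η₂) (m : Fin n → ℤ) :
    IsBranch ξ₁ ξ₂ e U fun u => η₂ u - η₁ u + icov m := by
  refine ⟨h₁.isOpen, h₁.subset, (h₂.smooth.sub h₁.smooth).add contDiffOn_const, fun u hu => ?_⟩
  have hm : (QuotientAddGroup.mk (covector e (e.symm u) (icov m)) : Fiber n (e.symm u)) = 0 :=
    (QuotientAddGroup.eq_zero_iff _).2 (covector_icov_mem he (e.map_target (h₁.subset hu)) m)
  rw [← h₁.lift u hu, ← h₂.lift u hu, covector_add, covector_sub, QuotientAddGroup.mk_add, hm,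
    QuotientAddGroup.mk_sub]
  abel

omit [HasGroupoid B (integralAffineGroupoid n)] in
theorem IsLocalLift.mono {ξ : ∀ x : B, Fiber n x} {η : Model n → (Model n →L[ℝ] ℝ)}
    (h : IsLocalLift ξ e U η) {W : Set (Model n)} (hW : IsOpen W) (hWU : W ⊆ U) :
    IsLocalLift ξ e W η :=
  ⟨hW, hWU.trans h.subset, h.smooth.mono hWU, fun u hu => h.lift u (hWU hu)⟩

/-- Two geodesics with the same end points have velocities differing by an element of the dual
lattice. -/
theorem exists_icov_of_endpoints (he : e ∈ atlas (Model n) B) {x : B} (hx : x ∈ e.source)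
    {a a' : Model n →L[ℝ] ℝ}
    (h : ξ₁.toFun x + QuotientAddGroup.mk (covector e x a) = ξ₂.toFun x)
    (h' : ξ₁.toFun x + QuotientAddGroup.mk (covector e x a') = ξ₂.toFun x) :
    ∃ m : Fin n → ℤ, a = a' + icov m := by
  have h1 : (QuotientAddGroup.mk (covector e x a') : Fiber n x) = QuotientAddGroup.mk (covector e x a) :=
    add_left_cancel (h'.trans h.symm)
  rw [QuotientAddGroup.eq, neg_add_eq_sub] at h1
  obtain ⟨m, hm⟩ := (mem_dualLattice_iff he hx).1 h1
  refine ⟨m, ?_⟩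
  rw [← covector_sub] at hm
  rw [← covector_injective he hx hm, add_sub_cancel]

/-- Two branches that agree at a point agree near it. -/
theorem IsBranch.eventuallyEq (he : e ∈ atlas (Model n) B) (hw : IsBranch ξ₁ ξ₂ e U w)
    (hw' : IsBranch ξ₁ ξ₂ e U' w') {u : Model n} (hu : u ∈ U) (hu' : u ∈ U') (h : w u = w' u) :
    w =ᶠ[𝓝 u] w' := by
  have h1 : ContinuousAt (fun v => w v - w' v) u :=
    (hw.smooth.continuousOn.continuousAt (hw.isOpen.mem_nhds hu)).sub
      (hw'.smooth.continuousOn.continuousAt (hw'.isOpen.mem_nhds hu'))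
  -- The difference of the branches takes values in the lattice, where norm less than one forces
  -- zero.
  have h2 : ∀ᶠ v in 𝓝 u, ‖w v - w' v‖ < 1 :=
    h1.norm.eventually_lt continuousAt_const (by simp [h])
  filter_upwards [h2, hw.isOpen.mem_nhds hu, hw'.isOpen.mem_nhds hu'] with v hv hvU hvU'
  obtain ⟨m, hm⟩ := exists_icov_of_endpoints he (e.map_target (hw.subset hvU)) (hw.mem v hvU)
    (hw'.mem v hvU')
  rw [hm, add_sub_cancel_left] at hv
  have h3 := (norm_le_norm_icov m).trans_lt hv
  have h4 : m = 0 := by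
    funext j
    have h5 := (norm_le_pi_norm m j).trans_lt h3
    rw [Int.norm_eq_abs] at h5
    have h6 : |m j| < 1 := by exact_mod_cast h5
    simpa using h6
  rw [hm, h4, icov_zero, add_zero]

omit [HasGroupoid B (integralAffineGroupoid n)] in
-- Only the value of the branch at `v` matters. Passing to constant branches avoids rewriting inside
-- the dependent end point condition.
theorem PathForm.localRep_congr (α : PathForm ξ₁ ξ₂ q) {v : Model n} (h : w v = w' v) :
    α.localRep e w v = α.localRep e w' v := by
  have key : ∀ a a' : Model n →L[ℝ] ℝ, a = a' →
      α.localRep e (fun _ => a) v = α.localRep e (fun _ => a') v := by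
    rintro a _ rfl
    rfl
  exact key _ _ h

/-- The base point of `γ` is only required to be provably equal to `e.symm v`, so that the same path
can be read in two charts. -/
theorem PathForm.localRep_eq (α : PathForm ξ₁ ξ₂ q) (he : e ∈ atlas (Model n) B) {v : Model n}
    (hv : v ∈ e.target) (γ : PathSpace ξ₁ ξ₂) (hb : γ.base = e.symm v)
    (hw : γ.velocity.comp (fromChart e γ.base) = w v) :
    α.localRep e w v = (α γ).compContinuousLinearMap (fromChart e γ.base) := by
  obtain ⟨x, η, h⟩ := γ
  simp only at hb hw
  subst hb
  have h1 : covector e (e.symm v) (w v) = η := by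
    rw [← hw, covector_comp_of_fromChart he (e.map_target hv)]
  subst h1
  rw [PathForm.localRep, dif_pos h]

/-- The change of affine coordinates for branches and forms. -/
theorem PathForm.eventually_localRep (α : PathForm ξ₁ ξ₂ q) (he : e ∈ atlas (Model n) B)
    (he' : e' ∈ atlas (Model n) B) (hw : IsBranch ξ₁ ξ₂ e U w) (hw' : IsBranch ξ₁ ξ₂ e' U' w')
    {u : Model n} (hu : u ∈ U) (hx : e.symm u ∈ e'.source) {A : GL (Fin n) ℤ} {b : Model n}
    (h : ∀ᶠ v in 𝓝 u, e' (e.symm v) = glMap A v + b) (hu' : glMap A u + b ∈ U')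
    (heq : w u = (w' (glMap A u + b)).comp (glMap A : Model n →L[ℝ] Model n)) :
    ∀ᶠ v in 𝓝 u, w v = (w' (glMap A v + b)).comp (glMap A : Model n →L[ℝ] Model n) ∧
      α.localRep e w v = (α.localRep e' w' (glMap A v + b)).compContinuousLinearMap
        (glMap A : Model n →L[ℝ] Model n) := by
  have hut := hw.subset hu
  have hcA : Continuous fun v => glMap A v + b := (glMap A).continuous.add continuous_const
  have hc : ContinuousAt e.symm u := e.continuousAt_symm hut
  have hgood : ∀ᶠ v in 𝓝 u, v ∈ U ∧ e.symm v ∈ e'.source ∧ glMap A v + b ∈ U' ∧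
      ∀ᶠ v' in 𝓝 v, e' (e.symm v') = glMap A v' + b :=
    (hw.isOpen.eventually_mem hu).and ((hc.eventually (e'.open_source.mem_nhds hx)).and
      ((hcA.continuousAt.eventually (hw'.isOpen.mem_nhds hu')).and h.eventually_nhds))
  -- On the open set `N` the affine formula holds near every point, not just at `u`. Hence the
  -- pullback of `w'` by it is a branch in the chart `e`, and coincides with `w` near `u` because
  -- both agree at `u`.
  obtain ⟨N, hN, hNo, huN⟩ := eventually_nhds_iff.1 hgood
  have hsymm : ∀ v ∈ N, e'.symm (glMap A v + b) = e.symm v := fun v hv => by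
    rw [← (hN v hv).2.2.2.self_of_nhds, e'.left_inv (hN v hv).2.1]
  have hbr : IsBranch ξ₁ ξ₂ e N
      fun v => (w' (glMap A v + b)).comp (glMap A : Model n →L[ℝ] Model n) := by
    refine ⟨hNo, fun v hv => hw.subset (hN v hv).1, ?_, fun v hv => ?_⟩
    · refine ContDiffOn.clm_comp (hw'.smooth.comp (t := U') ?_ fun v hv => (hN v hv).2.2.1)
        contDiffOn_const
      exact ((glMap A).contDiff.add contDiff_const).contDiffOn
    · have h1 := hw'.mem _ (hN v hv).2.2.1
      rw [hsymm v hv] at h1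
      rw [← covector_transition he (hw.subset (hN v hv).1) (hN v hv).2.2.2]
      exact h1
  have hev := IsBranch.eventuallyEq he hw hbr hu huN heq
  filter_upwards [hev, hNo.mem_nhds huN] with v hv hvN
  refine ⟨hv, ?_⟩
  obtain ⟨hvU, hvs, hvU', hvt⟩ := hN v hvN
  have hmem := hw.mem v hvU
  let γ : PathSpace ξ₁ ξ₂ := ⟨e.symm v, covector e (e.symm v) (w v), hmem⟩
  have hfrom := fun a => fromChart_transition he he' (hw.subset hvU) hvs hvt a
  rw [α.localRep_eq he (hw.subset hvU) γ rfl
    (covector_comp_fromChart he (e.map_target (hw.subset hvU)) _)]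
  rw [α.localRep_eq he' (hw'.subset hvU') γ (hsymm v hvN).symm ?_]
  · ext a
    simp only [ContinuousAlternatingMap.compContinuousLinearMap_apply]
    congr 1
    funext i
    exact (hfrom (a i)).symm
  · change (covector e (e.symm v) (w v)).comp (fromChart e' (e.symm v)) = _
    rw [hv, ← covector_transition he (hw.subset hvU) hvt, covector_comp_fromChart he' hvs]

variable (ξ₁ ξ₂) in
omit [HasGroupoid B (integralAffineGroupoid n)] in
theorem exists_lifts (he : e ∈ atlas (Model n) B) {u : Model n} (hu : u ∈ e.target) :
    ∃ (W : Set (Model n)) (η₁ η₂ : Model n → (Model n →L[ℝ] ℝ)), u ∈ W ∧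
      IsLocalLift ξ₁.toFun e W η₁ ∧ IsLocalLift ξ₂.toFun e W η₂ := by
  obtain ⟨U₁, η₁, hu₁, h₁⟩ := ξ₁.exists_lift e he (e.symm u) (e.map_target hu)
  obtain ⟨U₂, η₂, hu₂, h₂⟩ := ξ₂.exists_lift e he (e.symm u) (e.map_target hu)
  rw [e.right_inv hu] at hu₁ hu₂
  exact ⟨U₁ ∩ U₂, η₁, η₂, ⟨hu₁, hu₂⟩,
    h₁.mono (h₁.isOpen.inter h₂.isOpen) Set.inter_subset_left,
    h₂.mono (h₁.isOpen.inter h₂.isOpen) Set.inter_subset_right⟩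

/-- Near a point, every branch is `ξ₂ - ξ₁ + m` with constant `m ∈ ℤⁿ`. -/
theorem IsBranch.exists_eventuallyEq (he : e ∈ atlas (Model n) B) (hw : IsBranch ξ₁ ξ₂ e U w)
    (h₁ : IsLocalLift ξ₁.toFun e U' η₁) (h₂ : IsLocalLift ξ₂.toFun e U' η₂) {u : Model n}
    (hu : u ∈ U) (hu' : u ∈ U') :
    ∃ m : Fin n → ℤ, w =ᶠ[𝓝 u] fun v => η₂ v - η₁ v + icov m := by
  obtain ⟨m, hm⟩ := exists_icov_of_endpoints he (e.map_target (hw.subset hu)) (hw.mem u hu)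
    ((h₁.isBranch he h₂ 0).mem u hu')
  rw [icov_zero, add_zero] at hm
  exact ⟨m, IsBranch.eventuallyEq he hw (h₁.isBranch he h₂ m) hu hu' hm⟩

end Branches

/-! ### Norms tested on small vectors, and iterated derivatives under affine maps -/

section Scaling

variable {V : Type*} [NormedAddCommGroup V] [NormedSpace ℝ V]

/-- A multilinear map with values in alternating maps is bounded by its values on small vectors. -/
theorem norm_le_of_forall_small {l q : ℕ}
    (T : ContinuousMultilinearMap ℝ (fun _ : Fin l => V) (V [⋀^Fin q]→L[ℝ] ℂ)) {δ C : ℝ}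
    (hδ : 0 < δ) (hC : 0 ≤ C)
    (h : ∀ (a : Fin l → V) (b : Fin q → V), (∀ i, ‖a i‖ ≤ δ) → (∀ i, ‖b i‖ ≤ δ) → ‖T a b‖ ≤ C) :
    ‖T‖ ≤ C * (δ⁻¹ ^ l * δ⁻¹ ^ q) := by
  -- Each vector is rescaled to norm `δ`; the identity also holds at `v = 0`, where `‖v‖⁻¹` is zero
  -- by convention.
  have hsc : ∀ v : V, (‖v‖ * δ⁻¹) • ((δ * ‖v‖⁻¹) • v) = v := by
    intro v
    by_cases hv : v = 0
    · simp [hv]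
    · have : ‖v‖ ≠ 0 := norm_ne_zero_iff.2 hv
      rw [smul_smul, show ‖v‖ * δ⁻¹ * (δ * ‖v‖⁻¹) = 1 by field_simp, one_smul]
  have hsm : ∀ v : V, ‖(δ * ‖v‖⁻¹) • v‖ ≤ δ := by
    intro v
    rw [norm_smul, norm_mul, norm_inv, norm_norm, Real.norm_of_nonneg hδ.le, mul_assoc]
    exact mul_le_of_le_one_right hδ.le (inv_mul_le_one)
  refine ContinuousMultilinearMap.opNorm_le_bound (by positivity) fun a => ?_
  refine ContinuousAlternatingMap.opNorm_le_bound _ (by positivity) fun b => ?_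
  have ha : T a = (∏ i, ‖a i‖ * δ⁻¹) • T fun i => (δ * ‖a i‖⁻¹) • a i := by
    rw [← T.map_smul_univ]
    simp only [hsc]
  have hb : ∀ S : V [⋀^Fin q]→L[ℝ] ℂ,
      S b = (∏ i, ‖b i‖ * δ⁻¹) • S fun i => (δ * ‖b i‖⁻¹) • b i := by
    intro S
    have := S.toContinuousMultilinearMap.map_smul_univ (fun i => ‖b i‖ * δ⁻¹)
      fun i => (δ * ‖b i‖⁻¹) • b i
    simp only [hsc] at this
    exact this
  rw [ha, ContinuousAlternatingMap.smul_apply, hb, norm_smul, norm_smul, Finset.prod_mul_distrib,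
    Finset.prod_mul_distrib, Finset.prod_const, Finset.prod_const, Finset.card_univ,
    Finset.card_univ, Fintype.card_fin, Fintype.card_fin,
    Real.norm_of_nonneg (by positivity), Real.norm_of_nonneg (by positivity)]
  calc _ ≤ (∏ i, ‖a i‖) * δ⁻¹ ^ l * ((∏ i, ‖b i‖) * δ⁻¹ ^ q * C) := by
        gcongr
        exact h _ _ (fun i => hsm _) fun i => hsm _
    _ = _ := by ring

theorem mul_norm_le_of_forall_small {l q : ℕ}
    (T : ContinuousMultilinearMap ℝ (fun _ : Fin l => V) (V [⋀^Fin q]→L[ℝ] ℂ)) {δ C r : ℝ}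
    (hδ : 0 < δ) (hC : 0 ≤ C) (hr : 0 ≤ r)
    (h : ∀ (a : Fin l → V) (b : Fin q → V), (∀ i, ‖a i‖ ≤ δ) → (∀ i, ‖b i‖ ≤ δ) →
      r * ‖T a b‖ ≤ C) :
    r * ‖T‖ ≤ C * (δ⁻¹ ^ l * δ⁻¹ ^ q) := by
  rcases hr.eq_or_lt with rfl | hr
  · rw [zero_mul]; positivity
  have h1 := norm_le_of_forall_small T hδ (C := C / r) (by positivity) fun a b ha hb => by
    rw [le_div_iff₀ hr, mul_comm]
    exact h a b ha hb
  calc r * ‖T‖ ≤ r * (C / r * (δ⁻¹ ^ l * δ⁻¹ ^ q)) := by gcongr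
    _ = _ := by field_simp

/-- An affine change of variables produces no lower-order terms, which is why `∇ˡ` is the `l`-th
derivative in every affine chart. -/
theorem iteratedFDeriv_comp_affine {E F : Type*} [NormedAddCommGroup E] [NormedSpace ℝ E]
    [NormedAddCommGroup F] [NormedSpace ℝ F] (L : E →L[ℝ] F) (A : V ≃L[ℝ] V) (b : V) {f : V → E}
    {u : V} {l : ℕ} (hf : ContDiffAt ℝ l f (A u + b)) (a : Fin l → V) :
    iteratedFDeriv ℝ l (fun v => L (f (A v + b))) u a
      = L (iteratedFDeriv ℝ l f (A u + b) fun i => A (a i)) := by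
  have h1 : ContDiffAt ℝ l (fun v => f (A v + b)) u :=
    hf.comp u (f := fun v => A v + b) (A.contDiff.add contDiff_const).contDiffAt
  have h2 := L.iteratedFDeriv_comp_left h1 (i := l) le_rfl
  have h3 := A.iteratedFDerivWithin_comp_right (fun v => f (v + b)) uniqueDiffOn_univ
    (x := u) trivial l
  simp only [Set.preimage_univ, iteratedFDerivWithin_univ, iteratedFDeriv_comp_add_right] at h3
  have h4 : (fun v => L (f (A v + b))) = L ∘ fun v => f (A v + b) := rfl
  rw [h4, h2]
  have h5 : (fun v => f (A v + b)) = (fun v => f (v + b)) ∘ A := rfl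
  rw [h5, h3]
  rfl

end Scaling

/-! ### Rapid decay in terms of the metric and in terms of the lattice index -/

section RapidForms

variable {n : ℕ} {B : Type*} [TopologicalSpace B] [ChartedSpace (Model n) B]
  [HasGroupoid B (integralAffineGroupoid n)] {ħ : ℝ} {ξ₁ ξ₂ : LagrangianSection n B ħ} {q : ℕ}
  {e : OpenPartialHomeomorph B (Model n)} {U : Set (Model n)}
  {w η₁ η₂ : Model n → (Model n →L[ℝ] ℝ)}

/-- The branches of a form over a coordinate patch with given lifts. -/
def PathForm.family (α : PathForm ξ₁ ξ₂ q) (e : OpenPartialHomeomorph B (Model n))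
    (η₁ η₂ : Model n → (Model n →L[ℝ] ℝ)) (m : Fin n → ℤ) : Model n → Model n [⋀^Fin q]→L[ℝ] ℂ :=
  α.localRep e fun u => η₂ u - η₁ u + icov m

theorem PathForm.eventuallyEq_family (α : PathForm ξ₁ ξ₂ q) (he : e ∈ atlas (Model n) B)
    {W : Set (Model n)} (hw : IsBranch ξ₁ ξ₂ e U w)
    (h₁ : IsLocalLift ξ₁.toFun e W η₁) (h₂ : IsLocalLift ξ₂.toFun e W η₂) {u : Model n}
    (hu : u ∈ U) (hu' : u ∈ W) : ∃ m, α.localRep e w =ᶠ[𝓝 u] α.family e η₁ η₂ m := by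
  obtain ⟨m, hm⟩ := hw.exists_eventuallyEq he h₁ h₂ hu hu'
  exact ⟨m, hm.mono fun v hv => α.localRep_congr hv⟩

omit [HasGroupoid B (integralAffineGroupoid n)] in
theorem exists_norm_diff_le (h₁ : IsLocalLift ξ₁.toFun e U η₁)
    (h₂ : IsLocalLift ξ₂.toFun e U η₂) {K : Set (Model n)} (hK : IsCompact K) (hKU : K ⊆ U) :
    ∃ M : ℝ, 0 ≤ M ∧ ∀ u ∈ K, ‖η₂ u - η₁ u‖ ≤ M := by
  obtain ⟨M, hM⟩ := hK.exists_bound_of_continuousOn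
    ((h₂.smooth.continuousOn.sub h₁.smooth.continuousOn).mono hKU)
  exact ⟨max M 0, le_max_right _ _, fun u hu => (hM u hu).trans (le_max_left _ _)⟩

/-- On `K` the index is controlled by the length `c` of `γ̇` through `‖m‖ ≤ D c + M`, where `M`
bounds `η₂ - η₁`. Where `c` is large the decay hypothesis applies; where it is small, `m` lies in a
finite set and continuity on the compact set suffices. -/
theorem decayFamily_of_mem_rapidForms {g : HessianMetric n B} {α : PathForm ξ₁ ξ₂ q}
    (hα : α ∈ rapidForms ξ₁ ξ₂ g q) (he : e ∈ atlas (Model n) B)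
    (h₁ : IsLocalLift ξ₁.toFun e U η₁) (h₂ : IsLocalLift ξ₂.toFun e U η₂) :
    DecayFamily U (α.family e η₁ η₂) := by
  obtain ⟨hs, hd⟩ := hα
  have hbr := h₁.isBranch he h₂
  have hsm : ∀ m, ContDiffOn ℝ ∞ (α.family e η₁ η₂ m) U := fun m => hs e he U _ (hbr m)
  refine ⟨hsm, fun K hKU hK k l => ?_⟩
  have hKe := hKU.trans h₁.subset
  obtain ⟨D, hD, hcmp⟩ := g.exists_conorm_comparison he hK hKe
  obtain ⟨M, hM0, hM⟩ := exists_norm_diff_le h₁ h₂ hK hKU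
  have hK' : IsCompact (e.symm '' K) := hK.image_of_continuousOn (e.continuousOn_symm.mono hKe)
  -- Both exponents are needed: `(D c + M)^k` is bounded by `2^k` times the sum of `(D c)^k`,
  -- treated with exponent `k`, and `M^k`, treated with exponent `0`.
  obtain ⟨R₀, hR₀⟩ := hd _ hK' 0 l 1 one_pos
  obtain ⟨R₁, hR₁⟩ := hd _ hK' k l 1 one_pos
  let R := max R₀ R₁
  have hfin : {m : Fin n → ℤ | ‖m‖ ≤ D * R + M}.Finite := by
    have : {m : Fin n → ℤ | ‖m‖ ≤ D * R + M} = Metric.closedBall 0 (D * R + M) := by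
      ext m; simp
    rw [this]
    exact (isCompact_closedBall _ _).finite_of_discrete
  have hb : ∀ m, ∃ C : ℝ, 0 ≤ C ∧ ∀ u ∈ K,
      ‖m‖ ^ k * ‖iteratedFDeriv ℝ l (α.family e η₁ η₂ m) u‖ ≤ C := by
    intro m
    have hc : ContinuousOn (fun u => ‖m‖ ^ k * ‖iteratedFDeriv ℝ l (α.family e η₁ η₂ m) u‖) K := by
      intro u hu
      have h1 : ContDiffAt ℝ ∞ (α.family e η₁ η₂ m) u :=
        (hsm m).contDiffAt (h₁.isOpen.mem_nhds (hKU hu))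
      have h2 : ContDiffAt ℝ 0 (iteratedFDeriv ℝ l (α.family e η₁ η₂ m)) u :=
        h1.iteratedFDeriv_right (i := l) (by rw [zero_add]; exact_mod_cast le_top)
      exact (continuousAt_const.mul h2.continuousAt.norm).continuousWithinAt
    obtain ⟨C, hC⟩ := hK.exists_bound_of_continuousOn hc
    exact ⟨max C 0, le_max_right _ _,
      fun u hu => ((le_abs_self _).trans (hC u hu)).trans (le_max_left _ _)⟩
  choose C hC0 hC using hb
  let S := D ^ l * D ^ q
  refine ⟨max (∑ m ∈ hfin.toFinset, C m) (2 ^ k * (D ^ k * S + M ^ k * S)), fun m u hu => ?_⟩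
  obtain ⟨-, hunit, -, hw⟩ := hcmp u hu
  have huU := hKU hu
  set c := g.conorm (e.symm u) (covector e (e.symm u) (η₂ u - η₁ u + icov m)) with hc
  have hc0 : 0 ≤ c := g.conorm_nonneg _ _
  have hm : ‖m‖ ≤ D * c + M := by
    calc ‖m‖ ≤ ‖icov m‖ := norm_le_norm_icov m
      _ = ‖(η₂ u - η₁ u + icov m) - (η₂ u - η₁ u)‖ := by rw [add_sub_cancel_left]
      _ ≤ ‖η₂ u - η₁ u + icov m‖ + ‖η₂ u - η₁ u‖ := norm_sub_le _ _
      _ ≤ _ := add_le_add (hw _) (hM u hu)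
  set T := iteratedFDeriv ℝ l (α.family e η₁ η₂ m) u with hT
  rcases le_or_gt R c with hRc | hRc
  · refine le_max_of_le_right ?_
    have hδ : 0 < D⁻¹ := inv_pos.2 hD
    have h0 := mul_norm_le_of_forall_small T hδ zero_le_one (pow_nonneg hc0 0)
      fun a b ha hb => hR₀ e he U _ (hbr m) u huU ⟨u, hu, rfl⟩ ((le_max_left _ _).trans hRc) a b
        (fun i => hunit _ (ha i)) fun i => hunit _ (hb i)
    have hk := mul_norm_le_of_forall_small T hδ zero_le_one (pow_nonneg hc0 k)
      fun a b ha hb => hR₁ e he U _ (hbr m) u huU ⟨u, hu, rfl⟩ ((le_max_right _ _).trans hRc) a b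
        (fun i => hunit _ (ha i)) fun i => hunit _ (hb i)
    rw [inv_inv, one_mul, pow_zero, one_mul] at h0
    rw [inv_inv, one_mul] at hk
    have hpow : ‖m‖ ^ k ≤ 2 ^ k * (D ^ k * c ^ k + M ^ k) := by
      have hmax : ‖m‖ ≤ 2 * max (D * c) M := by
        linarith [le_max_left (D * c) M, le_max_right (D * c) M]
      calc ‖m‖ ^ k ≤ (2 * max (D * c) M) ^ k := by gcongr
        _ = 2 ^ k * max (D * c) M ^ k := mul_pow _ _ _
        _ ≤ _ := by
          gcongr
          rw [← mul_pow]
          rcases max_cases (D * c) M with ⟨h, -⟩ | ⟨h, -⟩ <;> rw [h]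
          · have : 0 ≤ M ^ k := by positivity
            linarith
          · have : 0 ≤ (D * c) ^ k := by positivity
            linarith
    calc ‖m‖ ^ k * ‖T‖ ≤ 2 ^ k * (D ^ k * c ^ k + M ^ k) * ‖T‖ := by gcongr
      _ = 2 ^ k * (D ^ k * (c ^ k * ‖T‖) + M ^ k * ‖T‖) := by ring
      _ ≤ _ := by gcongr
  · refine le_max_of_le_left ?_
    have hmem : m ∈ hfin.toFinset := by
      rw [Set.Finite.mem_toFinset]
      have : D * c ≤ D * R := by gcongr
      exact hm.trans (by linarith)
    exact (hC m u hu).trans (Finset.single_le_sum (fun i _ => hC0 i) hmem)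

/-- Smoothness is local, and near any point every branch is one of those indexed by `ℤⁿ`. -/
theorem isSmooth_of_decayFamily {α : PathForm ξ₁ ξ₂ q}
    (h : ∀ e ∈ atlas (Model n) B, ∀ U η₁ η₂, IsLocalLift ξ₁.toFun e U η₁ →
      IsLocalLift ξ₂.toFun e U η₂ → DecayFamily U (α.family e η₁ η₂)) : α.IsSmooth := by
  intro e he U w hw u hu
  obtain ⟨W, η₁, η₂, huW, h₁, h₂⟩ := exists_lifts ξ₁ ξ₂ he (hw.subset hu)
  obtain ⟨m, hm⟩ := α.eventuallyEq_family he hw h₁ h₂ hu huW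
  exact (((h e he W η₁ η₂ h₁ h₂).contDiffAt h₁.isOpen m huW).congr_of_eventuallyEq
    hm).contDiffWithinAt

/-- The decay condition on the set `K`, for fixed exponents. -/
def PathForm.DecaysOn (α : PathForm ξ₁ ξ₂ q) (g : HessianMetric n B) (K : Set B) (k l : ℕ) : Prop :=
  ∀ ε > (0 : ℝ), ∃ R : ℝ,
    ∀ e ∈ atlas (Model n) B, ∀ U w, IsBranch ξ₁ ξ₂ e U w → ∀ u ∈ U, e.symm u ∈ K →
      R ≤ g.conorm (e.symm u) (covector e (e.symm u) (w u)) →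
      ∀ (a : Fin l → Model n) (b : Fin q → Model n),
        (∀ i, g.toFun (e.symm u) (fromChart e (e.symm u) (a i)) (fromChart e (e.symm u) (a i)) ≤ 1) →
        (∀ i, g.toFun (e.symm u) (fromChart e (e.symm u) (b i)) (fromChart e (e.symm u) (b i)) ≤ 1) →
        g.conorm (e.symm u) (covector e (e.symm u) (w u)) ^ k
          * ‖iteratedFDeriv ℝ l (α.localRep e w) u a b‖ ≤ ε

/-- The condition involves an arbitrary chart `e'`. The transition to `e` is affine and carries test
vectors of `g`-length at most one to vectors of norm at most `D`, so everything is estimated in `e`,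
with constants independent of `e'`. The bound with exponent `k + 1` divided by the length `r` of
`γ̇` then tends to zero. -/
theorem PathForm.decaysOn_image {g : HessianMetric n B} {α : PathForm ξ₁ ξ₂ q}
    (he : e ∈ atlas (Model n) B) (h₁ : IsLocalLift ξ₁.toFun e U η₁)
    (h₂ : IsLocalLift ξ₂.toFun e U η₂) (hf : DecayFamily U (α.family e η₁ η₂))
    {K : Set (Model n)} (hK : IsCompact K) (hKU : K ⊆ U) (k l : ℕ) :
    α.DecaysOn g (e.symm '' K) k l := by
  have hKe := hKU.trans h₁.subset
  obtain ⟨D, hD, hcmp⟩ := g.exists_conorm_comparison he hK hKe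
  obtain ⟨M, hM0, hM⟩ := exists_norm_diff_le h₁ h₂ hK hKU
  obtain ⟨C, hC0, hC⟩ := hf.bound' hKU hK (k + 1) l
  intro ε hε
  let S := (D * (M + n)) ^ (k + 1) * (C * D ^ l * D ^ q)
  have hS : 0 ≤ S := by positivity
  -- For `r` at least this large, `r > 0` and `S ≤ ε r`.
  refine ⟨S / ε + 1, ?_⟩
  rintro e' he' U' w hw u hu ⟨u₀, hu₀, hx⟩ hR a b ha hb
  have hut := hw.subset hu
  have hut₀ := hKe hu₀
  have hs : e'.symm u ∈ e.source := by rw [← hx]; exact e.map_target hut₀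
  obtain ⟨A, c, hA⟩ := eventually_transition he' he hut hs
  have hAu : glMap A u + c = u₀ := by
    rw [← hA.self_of_nhds, ← hx, e.right_inv hut₀]
  -- Read in the chart `e`, the given branch passes through one of the branches `η₂ - η₁ + m`.
  obtain ⟨m, hm⟩ : ∃ m, (w u).comp ((glMap A).symm : Model n →L[ℝ] Model n)
      = (η₂ u₀ - η₁ u₀ + icov 0) + icov m := by
    refine exists_icov_of_endpoints (ξ₁ := ξ₁) (ξ₂ := ξ₂) he hs ?_ ?_
    · rw [covector_transition he' hut hA, ContinuousLinearMap.comp_assoc,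
        ContinuousLinearEquiv.coe_symm_comp_coe, ContinuousLinearMap.comp_id]
      exact hw.mem u hu
    · rw [← hx]
      exact (h₁.isBranch he h₂ 0).mem u₀ (hKU hu₀)
  rw [icov_zero, add_zero] at hm
  have heq : w u = (η₂ (glMap A u + c) - η₁ (glMap A u + c) + icov m).comp
      (glMap A : Model n →L[ℝ] Model n) := by
    rw [hAu, ← hm, ContinuousLinearMap.comp_assoc, ContinuousLinearEquiv.coe_symm_comp_coe,
      ContinuousLinearMap.comp_id]
  have hev := α.eventually_localRep he' he hw (h₁.isBranch he h₂ m) hu hs hA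
    (by rw [hAu]; exact hKU hu₀) heq
  have hT : iteratedFDeriv ℝ l (α.localRep e' w) u a b
      = iteratedFDeriv ℝ l (α.family e η₁ η₂ m) u₀ (fun i => glMap A (a i))
        fun i => glMap A (b i) := by
    have h3 : α.localRep e' w =ᶠ[𝓝 u] fun v => ContinuousAlternatingMap.compContinuousLinearMapCLM
        (glMap A : Model n →L[ℝ] Model n) (α.family e η₁ η₂ m (glMap A v + c)) :=
      hev.mono fun v hv => hv.2
    rw [(Filter.EventuallyEq.iteratedFDeriv ℝ h3 l).eq_of_nhds, iteratedFDeriv_comp_affine _ _ _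
      (by rw [hAu]; exact (hf.contDiffAt h₁.isOpen m (hKU hu₀)).of_le (by exact_mod_cast le_top)),
      hAu]
    rfl
  obtain ⟨hlen, -, hcon, -⟩ := hcmp u₀ hu₀
  rw [hx] at hlen hcon
  have hlen' : ∀ v, g.toFun (e'.symm u) (fromChart e' (e'.symm u) v) (fromChart e' (e'.symm u) v) ≤ 1 →
      ‖glMap A v‖ ≤ D := by
    intro v hv
    refine hlen _ ?_
    rw [fromChart_transition he' he hut hs hA]
    exact hv
  have hcov : covector e' (e'.symm u) (w u)
      = covector e (e'.symm u) (η₂ u₀ - η₁ u₀ + icov m) := by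
    rw [covector_transition he' hut hA, ← hm, ContinuousLinearMap.comp_assoc,
      ContinuousLinearEquiv.coe_symm_comp_coe, ContinuousLinearMap.comp_id]
  set r := g.conorm (e'.symm u) (covector e' (e'.symm u) (w u)) with hr
  have hr0 : 0 ≤ r := g.conorm_nonneg _ _
  have hrle : r ≤ D * (M + n) * (1 + ‖m‖) := by
    rw [hr, hcov]
    calc _ ≤ D * ‖η₂ u₀ - η₁ u₀ + icov m‖ := hcon _
      _ ≤ D * (M + n * ‖m‖) := by
          gcongr
          exact (norm_add_le _ _).trans (add_le_add (hM u₀ hu₀) (norm_icov_le m))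
      _ ≤ D * ((M + n) * (1 + ‖m‖)) := by
          gcongr
          have h5 : 0 ≤ M * ‖m‖ := by positivity
          have h6 : (0 : ℝ) ≤ n := by positivity
          linarith
      _ = _ := by ring
  set T := iteratedFDeriv ℝ l (α.family e η₁ η₂ m) u₀ with hTdef
  have hTab : ‖iteratedFDeriv ℝ l (α.localRep e' w) u a b‖ ≤ ‖T‖ * D ^ l * D ^ q := by
    rw [hT]
    have h5 : ∏ i, ‖glMap A (a i)‖ ≤ D ^ l :=
      (Finset.prod_le_prod (fun _ _ => norm_nonneg _) fun i _ => hlen' _ (ha i)).trans (by simp)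
    have h6 : ∏ i, ‖glMap A (b i)‖ ≤ D ^ q :=
      (Finset.prod_le_prod (fun _ _ => norm_nonneg _) fun i _ => hlen' _ (hb i)).trans (by simp)
    calc _ ≤ ‖T fun i => glMap A (a i)‖ * ∏ i, ‖glMap A (b i)‖ :=
          ContinuousAlternatingMap.le_opNorm _ _
      _ ≤ (‖T‖ * ∏ i, ‖glMap A (a i)‖) * ∏ i, ‖glMap A (b i)‖ := by
          gcongr
          exact T.le_opNorm _
      _ ≤ _ := by gcongr
  have hmain : r ^ (k + 1) * ‖iteratedFDeriv ℝ l (α.localRep e' w) u a b‖ ≤ S := by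
    calc _ ≤ (D * (M + n) * (1 + ‖m‖)) ^ (k + 1) * (‖T‖ * D ^ l * D ^ q) := by gcongr
      _ = (D * (M + n)) ^ (k + 1) * (((1 + ‖m‖) ^ (k + 1) * ‖T‖) * D ^ l * D ^ q) := by
          rw [mul_pow]; ring
      _ ≤ (D * (M + n)) ^ (k + 1) * (C * D ^ l * D ^ q) := by
          gcongr
          exact hC m u₀ hu₀
  have hrpos : 0 < r := lt_of_lt_of_le (by positivity) hR
  have hSε : S ≤ ε * r := by
    have h7 : S / ε ≤ r := by linarith
    rw [div_le_iff₀ hε] at h7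
    linarith
  rw [pow_succ, mul_right_comm] at hmain
  exact le_of_mul_le_mul_right (hmain.trans hSε) hrpos

/-- The condition passes to subsets and finite unions, so a compact set may be covered by closed
coordinate balls over which both sections lift. -/
theorem rapidlyDecays_of_decayFamily (g : HessianMetric n B) {α : PathForm ξ₁ ξ₂ q}
    (h : ∀ e ∈ atlas (Model n) B, ∀ U η₁ η₂, IsLocalLift ξ₁.toFun e U η₁ →
      IsLocalLift ξ₂.toFun e U η₂ → DecayFamily U (α.family e η₁ η₂)) : α.RapidlyDecays g := by
  intro K hK k l
  change α.DecaysOn g K k l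
  refine hK.induction_on (p := fun K => α.DecaysOn g K k l) ?_ ?_ ?_ ?_
  · exact fun ε _ => ⟨0, fun e _ U w _ u _ hu => hu.elim⟩
  · intro s t hst ht ε hε
    obtain ⟨R, hR⟩ := ht ε hε
    exact ⟨R, fun e he U w hw u hu hus => hR e he U w hw u hu (hst hus)⟩
  · intro s t hs ht ε hε
    obtain ⟨R, hR⟩ := hs ε hε
    obtain ⟨R', hR'⟩ := ht ε hε
    refine ⟨max R R', fun e he U w hw u hu hust hc => ?_⟩
    rcases hust with h | h
    · exact hR e he U w hw u hu h ((le_max_left _ _).trans hc)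
    · exact hR' e he U w hw u hu h ((le_max_right _ _).trans hc)
  · intro x _
    have he := chart_mem_atlas (Model n) x
    have hx := mem_chart_source (Model n) x
    obtain ⟨W, η₁, η₂, hW, h₁, h₂⟩ := exists_lifts ξ₁ ξ₂ he (mem_chart_target (Model n) x)
    obtain ⟨r, hr, hrW⟩ := Metric.nhds_basis_closedBall.mem_iff.1 (h₁.isOpen.mem_nhds hW)
    refine ⟨(chartAt (Model n) x).symm '' Metric.closedBall (chartAt (Model n) x x) r,
      mem_nhdsWithin_of_mem_nhds ?_, PathForm.decaysOn_image he h₁ h₂ (h _ he W η₁ η₂ h₁ h₂)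
        (isCompact_closedBall _ _) hrW k l⟩
    filter_upwards [(chartAt (Model n) x).open_source.mem_nhds hx,
      ((chartAt (Model n) x).continuousAt hx).preimage_mem_nhds (Metric.closedBall_mem_nhds _ hr)]
      with y hy hy'
    exact ⟨_, hy', (chartAt (Model n) x).left_inv hy⟩

/-- Smooth rapidly decaying forms in affine coordinates. -/
theorem mem_rapidForms_iff (g : HessianMetric n B) {α : PathForm ξ₁ ξ₂ q} :
    α ∈ rapidForms ξ₁ ξ₂ g q ↔ ∀ e ∈ atlas (Model n) B, ∀ U η₁ η₂,
      IsLocalLift ξ₁.toFun e U η₁ → IsLocalLift ξ₂.toFun e U η₂ →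
        DecayFamily U (α.family e η₁ η₂) :=
  ⟨fun h _ he _ _ _ h₁ h₂ => decayFamily_of_mem_rapidForms h he h₁ h₂,
    fun h => ⟨isSmooth_of_decayFamily h, rapidlyDecays_of_decayFamily g h⟩⟩

end RapidForms

/-! ## The Witten complex -/

section TwistedDerivative

open ContinuousAlternatingMap

variable {V : Type*} [NormedAddCommGroup V] [NormedSpace ℝ V] {q : ℕ}

/-- The operator `d + θ ∧`. -/
def twistedD (θ : V → V →L[ℝ] ℂ) (f : V → V [⋀^Fin q]→L[ℝ] ℂ) (u : V) :
    V [⋀^Fin (q + 1)]→L[ℝ] ℂ :=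
  alternatizeUncurryFin (fderiv ℝ f u + (θ u).smulRight (f u))

theorem hasFDerivAt_smulRight {θ : V → V →L[ℝ] ℂ} {f : V → V [⋀^Fin q]→L[ℝ] ℂ} {u : V}
    (hθ : DifferentiableAt ℝ θ u) (hf : DifferentiableAt ℝ f u) :
    HasFDerivAt (fun v => (θ v).smulRight (f v))
      ((smulRightBilin V (V [⋀^Fin q]→L[ℝ] ℂ)).precompR V (θ u) (fderiv ℝ f u)
        + (smulRightBilin V (V [⋀^Fin q]→L[ℝ] ℂ)).precompL V (fderiv ℝ θ u) (f u)) u := by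
  have h := (smulRightBilin V (V [⋀^Fin q]→L[ℝ] ℂ)).hasFDerivAt_of_bilinear hθ.hasFDerivAt
    hf.hasFDerivAt
  simpa only [smulRightBilin_apply] using h

theorem hasFDerivAt_twistedD {θ : V → V →L[ℝ] ℂ} {f : V → V [⋀^Fin q]→L[ℝ] ℂ} {u : V}
    (hθ : ContDiffAt ℝ ∞ θ u) (hf : ContDiffAt ℝ ∞ f u) :
    HasFDerivAt (twistedD θ f) ((alternatizeUncurryFinCLM (n := q) ℝ V ℂ).comp
      (fderiv ℝ (fderiv ℝ f) u
        + ((smulRightBilin V (V [⋀^Fin q]→L[ℝ] ℂ)).precompR V (θ u) (fderiv ℝ f u)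
        + (smulRightBilin V (V [⋀^Fin q]→L[ℝ] ℂ)).precompL V (fderiv ℝ θ u) (f u)))) u := by
  have hf1 : DifferentiableAt ℝ (fderiv ℝ f) u :=
    (hf.fderiv_right (m := 1) (by norm_cast)).differentiableAt (by simp)
  have hP := HasFDerivAt.fun_add (f := fderiv ℝ f) (g := fun v => (θ v).smulRight (f v))
    hf1.hasFDerivAt (hasFDerivAt_smulRight (hθ.differentiableAt (by simp))
      (hf.differentiableAt (by simp)))
  exact (alternatizeUncurryFinCLM (n := q) ℝ V ℂ).hasFDerivAt.comp u hP

set_option maxSynthPendingDepth 5 in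
-- With `φ`, `φ'` the value and derivative of `θ` and `c`, `c'`, `c''` those of the form up to
-- second order, the expression is a double alternatization of a bilinear map symmetric in its two
-- arguments, hence zero. The cross terms `φ ⊗ c'` occur in both orders, and the symmetry of `φ'` is
-- the closedness of `θ`.
theorem alternatize_twisted_eq_zero (φ : V →L[ℝ] ℂ) (φ' : V →L[ℝ] V →L[ℝ] ℂ)
    (c : V [⋀^Fin q]→L[ℝ] ℂ) (c' : V →L[ℝ] V [⋀^Fin q]→L[ℝ] ℂ)
    (c'' : V →L[ℝ] V →L[ℝ] V [⋀^Fin q]→L[ℝ] ℂ) (hφ : ∀ a b, φ' a b = φ' b a)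
    (hc : ∀ a b, c'' a b = c'' b a) :
    alternatizeUncurryFin ((alternatizeUncurryFinCLM (n := q) ℝ V ℂ).comp
      (c'' + ((smulRightBilin V (V [⋀^Fin q]→L[ℝ] ℂ)).precompR V φ c'
        + (smulRightBilin V (V [⋀^Fin q]→L[ℝ] ℂ)).precompL V φ' c))
      + φ.smulRight (alternatizeUncurryFin (c' + φ.smulRight c))) = 0 := by
  -- Multiplication by `φ` moves inside the inner alternatization, so that both summands are
  -- alternatized twice.
  have h1 : φ.smulRight (alternatizeUncurryFin (c' + φ.smulRight c))
      = (alternatizeUncurryFinCLM (n := q) ℝ V ℂ).comp (φ.smulRight (c' + φ.smulRight c)) := by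
    ext a : 1
    rw [ContinuousLinearMap.smulRight_apply, ContinuousLinearMap.comp_apply,
      ContinuousLinearMap.smulRight_apply, alternatizeUncurryFinCLM_apply,
      alternatizeUncurryFin_smul]
  rw [h1, ← ContinuousLinearMap.comp_add]
  refine alternatizeUncurryFin_alternatizeUncurryFinCLM_comp_of_symmetric fun a b => ?_
  change c'' a b + (φ b • c' a + φ' a b • c) + φ a • (c' b + φ b • c)
    = c'' b a + (φ a • c' b + φ' b a • c) + φ b • (c' a + φ a • c)
  rw [hc a b, hφ a b, smul_add, smul_add, smul_smul, smul_smul, mul_comm (φ a)]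
  abel

/-- `(d + θ ∧)² = 0` for a closed form `θ`. -/
theorem twistedD_twistedD {θ : V → V →L[ℝ] ℂ} {f : V → V [⋀^Fin q]→L[ℝ] ℂ} {u : V}
    (hθ : ContDiffAt ℝ ∞ θ u) (hf : ContDiffAt ℝ ∞ f u)
    (hsym : ∀ a b, fderiv ℝ θ u a b = fderiv ℝ θ u b a) : twistedD θ (twistedD θ f) u = 0 := by
  rw [twistedD, (hasFDerivAt_twistedD hθ hf).fderiv]
  refine alternatize_twisted_eq_zero _ _ _ _ _ hsym fun a b => ?_
  refine (hf.isSymmSndFDerivAt ?_) a b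
  rw [minSmoothness_of_isRCLikeNormedField]
  exact WithTop.coe_le_coe.2 le_top

end TwistedDerivative

/-! ### The Witten differential in coordinates and its square -/

section Witten

open ContinuousAlternatingMap

variable {n : ℕ} {B : Type*} [TopologicalSpace B] [ChartedSpace (Model n) B] {ħ : ℝ}
  {ξ₁ ξ₂ : LagrangianSection n B ħ} {q : ℕ}
  {e : OpenPartialHomeomorph B (Model n)} {U : Set (Model n)}
  {w η₁ η₂ : Model n → (Model n →L[ℝ] ℝ)}

/-- The `1`-form `2π γ̇ ⌟ ω_ħ` as a function of `γ̇`. -/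
def wittenForm (ħ : ℝ) : (Model n →L[ℝ] ℝ) →L[ℝ] (Model n →L[ℝ] ℂ) :=
  (2 * Real.pi * ħ⁻¹) • ContinuousLinearMap.compL ℝ (Model n) ℝ ℂ Complex.ofRealCLM

theorem wittenForm_eq (a : Model n →L[ℝ] ℝ) :
    wittenForm ħ a = Complex.ofRealCLM.comp ((2 * Real.pi) • areaForm ħ a) := by
  ext v
  simp [wittenForm, areaForm, mul_assoc]

theorem wittenForm_apply (a : Model n →L[ℝ] ℝ) (v : Model n) :
    wittenForm ħ a v = ((2 * Real.pi * ħ⁻¹ * a v : ℝ) : ℂ) := by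
  simp [wittenForm]

theorem PathSpace.branchAt_base (γ : PathSpace ξ₁ ξ₂) :
    γ.branchAt (chartAt (Model n) γ.base γ.base)
      = γ.velocity.comp (fromChart (chartAt (Model n) γ.base) γ.base) := by
  simp [PathSpace.branchAt]

variable [HasGroupoid B (integralAffineGroupoid n)]

/-- The constant by which `branchAt` corrects the difference of the lifts is the difference of two
velocities with the same end points, so it is integral. -/
theorem PathSpace.exists_branchAt_eq (γ : PathSpace ξ₁ ξ₂) :
    ∃ (W : Set (Model n)) (m : Fin n → ℤ), chartAt (Model n) γ.base γ.base ∈ W ∧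
      IsLocalLift ξ₁.toFun (chartAt (Model n) γ.base) W (ξ₁.liftAt γ.base) ∧
      IsLocalLift ξ₂.toFun (chartAt (Model n) γ.base) W (ξ₂.liftAt γ.base) ∧
      γ.branchAt = fun u => ξ₂.liftAt γ.base u - ξ₁.liftAt γ.base u + icov m := by
  obtain ⟨U₁, hu₁, h₁⟩ := ξ₁.liftAt_spec γ.base
  obtain ⟨U₂, hu₂, h₂⟩ := ξ₂.liftAt_spec γ.base
  have h₁' := h₁.mono (h₁.isOpen.inter h₂.isOpen) Set.inter_subset_left
  have h₂' := h₂.mono (h₁.isOpen.inter h₂.isOpen) Set.inter_subset_right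
  have he := chart_mem_atlas (Model n) γ.base
  have hx := mem_chart_source (Model n) γ.base
  have hu : chartAt (Model n) γ.base γ.base ∈ U₁ ∩ U₂ := ⟨hu₁, hu₂⟩
  have h3 := (IsLocalLift.isBranch he h₁' h₂' 0).mem _ hu
  rw [(chartAt (Model n) γ.base).left_inv hx] at h3
  have h4 := γ.endpoint
  rw [← covector_comp_of_fromChart he hx γ.velocity] at h4
  obtain ⟨m, hm⟩ := exists_icov_of_endpoints he hx h4 h3
  refine ⟨U₁ ∩ U₂, m, hu, h₁', h₂', ?_⟩
  funext u
  rw [PathSpace.branchAt, hm, icov_zero, add_zero, add_sub_cancel_left]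

/-- The Witten differential in affine coordinates. -/
theorem wittenD_localRep {α : PathForm ξ₁ ξ₂ q} (hα : α.IsSmooth) (he : e ∈ atlas (Model n) B)
    (hw : IsBranch ξ₁ ξ₂ e U w) {u : Model n} (hu : u ∈ U) :
    (wittenD α).localRep e w u = twistedD (fun v => wittenForm ħ (w v)) (α.localRep e w) u := by
  have hut := hw.subset hu
  have hs := e.map_target hut
  let γ : PathSpace ξ₁ ξ₂ := ⟨e.symm u, covector e (e.symm u) (w u), hw.mem u hu⟩
  let c := chartAt (Model n) γ.base
  have hc : c ∈ atlas (Model n) B := chart_mem_atlas _ _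
  have hx : e.symm u ∈ c.source := mem_chart_source _ _
  -- `wittenD` is computed in the preferred chart at each point. It agrees with the computation in
  -- `e` because exterior differentiation and `γ̇` are natural under the affine transition map.
  obtain ⟨A, b, hA⟩ := eventually_transition he hc hut hx
  obtain ⟨W, m, hW, h₁, h₂, hbr⟩ := γ.exists_branchAt_eq
  have hbranch : IsBranch ξ₁ ξ₂ c W γ.branchAt := by rw [hbr]; exact h₁.isBranch hc h₂ m
  have hAu : glMap A u + b = c γ.base := hA.self_of_nhds.symm
  have hW' : glMap A u + b ∈ W := by rw [hAu]; exact hW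
  have hfrom := fun v => fromChart_transition he hc hut hx hA v
  have heq : w u = (γ.branchAt (glMap A u + b)).comp (glMap A : Model n →L[ℝ] Model n) := by
    rw [hAu, γ.branchAt_base]
    ext v
    change w u v = w u (toChart e (e.symm u) (fromChart c (e.symm u) (glMap A v)))
    rw [hfrom, toChart_fromChart he hs]
  have hev := α.eventually_localRep he hc hw hbranch hu hx hA hW' heq
  let f' := α.localRep c γ.branchAt
  have hf' : DifferentiableAt ℝ f' (glMap A u + b) :=
    ((hα c hc W _ hbranch).contDiffAt (hbranch.isOpen.mem_nhds hW')).differentiableAt (by simp)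
  have hfd : HasFDerivAt (α.localRep e w)
      ((compContinuousLinearMapCLM (glMap A : Model n →L[ℝ] Model n)).comp
        ((fderiv ℝ f' (glMap A u + b)).comp (glMap A : Model n →L[ℝ] Model n))) u := by
    have h3 : HasFDerivAt (fun v => glMap A v + b) (glMap A : Model n →L[ℝ] Model n) u :=
      (glMap A).hasFDerivAt.add_const b
    have h4 := (compContinuousLinearMapCLM (F := ℂ) (ι := Fin q)
      (glMap A : Model n →L[ℝ] Model n)).hasFDerivAt.comp u (hf'.hasFDerivAt.comp u h3)
    exact h4.congr_of_eventuallyEq (hev.mono fun v hv => hv.2)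
  rw [(wittenD α).localRep_eq he hut γ rfl (covector_comp_fromChart he hs _), twistedD, hfd.fderiv,
    hev.self_of_nhds.2, heq]
  ext v
  have hv : ∀ i, toChart c γ.base (fromChart e γ.base (v i)) = glMap A (v i) := fun i => by
    rw [← toChart_fromChart hc hx (glMap A (v i)), hfrom]
  simp only [wittenD, compContinuousLinearMap_apply]
  have hvv : (fun i => toChart c γ.base (fromChart e γ.base (v i))) = fun i => glMap A (v i) :=
    funext hv
  change alternatizeUncurryFin (fderiv ℝ f' (c γ.base) + _)
    (fun i => toChart c γ.base (fromChart e γ.base (v i))) = _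
  rw [hvv]
  simp only [alternatizeUncurryFin_apply, _root_.add_apply, ContinuousLinearMap.smulRight_apply]
  refine Finset.sum_congr rfl fun i _ => ?_
  rw [hAu, γ.branchAt_base, wittenForm_eq]
  rfl

omit [HasGroupoid B (integralAffineGroupoid n)] in
-- The multiplier splits into a smooth factor independent of `m` and a constant of linear growth in
-- `m`; rapid decay survives both.
theorem DecayFamily.witten {f : (Fin n → ℤ) → Model n → Model n [⋀^Fin q]→L[ℝ] ℂ} (hU : IsOpen U)
    (hf : DecayFamily U f) (ħ : ℝ) {η : Model n → (Model n →L[ℝ] ℝ)} (hη : ContDiffOn ℝ ∞ η U) :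
    DecayFamily U fun m u =>
      fderiv ℝ (f m) u + (wittenForm ħ (η u + icov m)).smulRight (f m u) := by
  have hg : ContDiffOn ℝ ∞ (fun u => wittenForm ħ (η u)) U :=
    (wittenForm ħ).contDiff.comp_contDiffOn hη
  have hL : ∀ m : Fin n → ℤ,
      ‖smulRightBilin (Model n) (Model n [⋀^Fin q]→L[ℝ] ℂ) (wittenForm ħ (icov m))‖
        ≤ ‖wittenForm (n := n) ħ‖ * n * (1 + ‖m‖) := by
    intro m
    refine (norm_smulRightBilin_apply_le _).trans
      (((wittenForm ħ).le_opNorm (icov m)).trans ?_)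
    rw [mul_assoc]
    refine mul_le_mul_of_nonneg_left ((norm_icov_le m).trans ?_) (norm_nonneg _)
    gcongr
    linarith
  refine (((hf.differential hU).add hU (hf.bilin hU (smulRightBilin (Model n)
    (Model n [⋀^Fin q]→L[ℝ] ℂ)) hg)).add hU (hf.clm hU _ hL)).congr hU fun m u _ => ?_
  rw [add_assoc]
  congr 1
  ext a : 1
  simp only [_root_.add_apply, smulRightBilin_apply, ContinuousLinearMap.smulRight_apply, map_add,
    add_smul]

theorem wittenD_mem_rapidForms {g : HessianMetric n B} {α : PathForm ξ₁ ξ₂ q}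
    (hα : α ∈ rapidForms ξ₁ ξ₂ g q) : wittenD α ∈ rapidForms ξ₁ ξ₂ g (q + 1) := by
  refine (mem_rapidForms_iff g).2 fun e he U η₁ η₂ h₁ h₂ => ?_
  have hf := decayFamily_of_mem_rapidForms hα he h₁ h₂
  refine ((hf.witten h₁.isOpen ħ (h₂.smooth.sub h₁.smooth)).clm_const h₁.isOpen
    (alternatizeUncurryFinCLM (n := q) ℝ (Model n) ℂ)).congr h₁.isOpen fun m u hu => ?_
  rw [PathForm.family, wittenD_localRep hα.1 he (h₁.isBranch he h₂ m) hu, twistedD,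
    alternatizeUncurryFinCLM_apply]
  rfl

omit [HasGroupoid B (integralAffineGroupoid n)] in
-- The vanishing of `ω_ħ` on the graph of a lift says that the lift is a closed `1`-form.
theorem LagrangianSection.fderiv_symm (hħ : ħ ≠ 0) (ξ : LagrangianSection n B ħ)
    (he : e ∈ atlas (Model n) B) {η : Model n → (Model n →L[ℝ] ℝ)} (h : IsLocalLift ξ.toFun e U η)
    {u : Model n} (hu : u ∈ U) (a b : Model n) : fderiv ℝ η u a b = fderiv ℝ η u b a := by
  have h1 := ξ.lagrangian e he U η h u hu a b
  rw [symplecticForm, mul_eq_zero] at h1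
  exact sub_eq_zero.1 (h1.resolve_left (inv_ne_zero hħ))

theorem PathSpace.isBranch_branchAt (γ : PathSpace ξ₁ ξ₂) :
    ∃ W, chartAt (Model n) γ.base γ.base ∈ W ∧
      IsBranch ξ₁ ξ₂ (chartAt (Model n) γ.base) W γ.branchAt := by
  obtain ⟨W, m, hW, h₁, h₂, hbr⟩ := γ.exists_branchAt_eq
  exact ⟨W, hW, by rw [hbr]; exact h₁.isBranch (chart_mem_atlas _ _) h₂ m⟩

omit [HasGroupoid B (integralAffineGroupoid n)] in
theorem wittenD_apply (α : PathForm ξ₁ ξ₂ q) (γ : PathSpace ξ₁ ξ₂) :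
    wittenD α γ = (twistedD (fun v => wittenForm ħ (γ.branchAt v))
      (α.localRep (chartAt (Model n) γ.base) γ.branchAt)
        (chartAt (Model n) γ.base γ.base)).compContinuousLinearMap
          (toChart (chartAt (Model n) γ.base) γ.base) := by
  rw [wittenD, twistedD, wittenForm_eq, γ.branchAt_base]

/-- Along a branch, `γ̇` is a difference of two closed forms plus a constant covector, so
`twistedD_twistedD` applies. -/
theorem wittenD_wittenD (hħ : ħ ≠ 0) {α : PathForm ξ₁ ξ₂ q} (hα : α.IsSmooth) :
    wittenD (wittenD α) = 0 := by
  funext γ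
  obtain ⟨W, m, hW, h₁, h₂, hbr⟩ := γ.exists_branchAt_eq
  have hc := chart_mem_atlas (Model n) γ.base
  have hb : IsBranch ξ₁ ξ₂ (chartAt (Model n) γ.base) W γ.branchAt := by rw [hbr]; exact h₁.isBranch hc h₂ m
  have hWo := hb.isOpen.mem_nhds hW
  have hev : (wittenD α).localRep (chartAt (Model n) γ.base) γ.branchAt
      =ᶠ[𝓝 (chartAt (Model n) γ.base γ.base)] twistedD (fun v => wittenForm ħ (γ.branchAt v))
        (α.localRep (chartAt (Model n) γ.base) γ.branchAt) := by
    filter_upwards [hWo] with u hu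
    exact wittenD_localRep hα hc hb hu
  have hθ : ContDiffAt ℝ ∞ (fun v => wittenForm ħ (γ.branchAt v))
      (chartAt (Model n) γ.base γ.base) :=
    (wittenForm ħ).contDiff.contDiffAt.comp _ (hb.smooth.contDiffAt hWo)
  have hd₁ := (h₁.smooth.contDiffAt hWo).differentiableAt (by simp)
  have hd₂ := (h₂.smooth.contDiffAt hWo).differentiableAt (by simp)
  have hd : HasFDerivAt (fun v => wittenForm ħ (γ.branchAt v))
      ((wittenForm ħ).comp (fderiv ℝ (ξ₂.liftAt γ.base) (chartAt (Model n) γ.base γ.base)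
        - fderiv ℝ (ξ₁.liftAt γ.base) (chartAt (Model n) γ.base γ.base)))
      (chartAt (Model n) γ.base γ.base) := by
    rw [hbr]
    exact (wittenForm ħ).hasFDerivAt.comp _
      ((hd₂.hasFDerivAt.fun_sub hd₁.hasFDerivAt).add_const _)
  have h0 := twistedD_twistedD hθ ((hα _ hc W _ hb).contDiffAt hWo) fun a b => by
    rw [hd.fderiv]
    simp only [ContinuousLinearMap.comp_apply, wittenForm_apply, _root_.sub_apply]
    rw [ξ₁.fderiv_symm hħ hc h₁ hW a b, ξ₂.fderiv_symm hħ hc h₂ hW a b]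
  rw [twistedD, ← hev.fderiv_eq, ← hev.self_of_nhds] at h0
  rw [wittenD_apply, twistedD, h0]
  rfl

theorem twistedD_add {V : Type*} [NormedAddCommGroup V] [NormedSpace ℝ V]
    {θ : V → V →L[ℝ] ℂ} {f f' : V → V [⋀^Fin q]→L[ℝ] ℂ} {u : V}
    (hf : DifferentiableAt ℝ f u) (hf' : DifferentiableAt ℝ f' u) :
    twistedD θ (f + f') u = twistedD θ f u + twistedD θ f' u := by
  rw [twistedD, twistedD, twistedD, fderiv_add hf hf', ← alternatizeUncurryFin_add]
  congr 1
  ext a : 1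
  simp only [_root_.add_apply, ContinuousLinearMap.smulRight_apply, Pi.add_apply, smul_add]
  abel

theorem twistedD_smul {V : Type*} [NormedAddCommGroup V] [NormedSpace ℝ V]
    {θ : V → V →L[ℝ] ℂ} {f : V → V [⋀^Fin q]→L[ℝ] ℂ} {u : V} (c : ℂ)
    (hf : DifferentiableAt ℝ f u) : twistedD θ (c • f) u = c • twistedD θ f u := by
  rw [twistedD, twistedD, fderiv_const_smul hf, ← alternatizeUncurryFin_smul]
  congr 1
  ext a : 1
  change c • fderiv ℝ f u a + θ u a • c • f u = c • (fderiv ℝ f u a + θ u a • f u)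
  rw [smul_add, smul_comm c (θ u a)]

theorem wittenD_add {α β : PathForm ξ₁ ξ₂ q} (hα : α.IsSmooth) (hβ : β.IsSmooth) :
    wittenD (α + β) = wittenD α + wittenD β := by
  funext γ
  obtain ⟨W, hW, hb⟩ := γ.isBranch_branchAt
  have hWo := hb.isOpen.mem_nhds hW
  have hc := chart_mem_atlas (Model n) γ.base
  rw [Pi.add_apply, wittenD_apply, wittenD_apply, wittenD_apply, PathForm.localRep_add,
    twistedD_add (((hα _ hc W _ hb).contDiffAt hWo).differentiableAt (by simp))
      (((hβ _ hc W _ hb).contDiffAt hWo).differentiableAt (by simp))]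
  rfl

theorem wittenD_smul (c : ℂ) {α : PathForm ξ₁ ξ₂ q} (hα : α.IsSmooth) :
    wittenD (c • α) = c • wittenD α := by
  funext γ
  obtain ⟨W, hW, hb⟩ := γ.isBranch_branchAt
  have hWo := hb.isOpen.mem_nhds hW
  have hc := chart_mem_atlas (Model n) γ.base
  rw [Pi.smul_apply, wittenD_apply, wittenD_apply, PathForm.localRep_smul,
    twistedD_smul c (((hα _ hc W _ hb).contDiffAt hWo).differentiableAt (by simp))]
  rfl

end Witten

/-! ## Forms of type `(0, q)` -/

section ConjLinear

variable {T W : Type*} [AddCommGroup T] [Module ℝ T] [TopologicalSpace T] [IsTopologicalAddGroup T]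
  [ContinuousSMul ℝ T] [AddCommGroup W] [Module ℂ W] {q : ℕ} {ħ : ℝ}

/-- A form on `T × T` that is conjugate-linear in every argument. -/
def IsConjLinear (ħ : ℝ) (β : (T × T) [⋀^Fin q]→ₗ[ℝ] W) : Prop :=
  ∀ (w : Fin q → T × T) (i : Fin q),
    β (Function.update w i (complexStructure ħ T (w i))) = -Complex.I • β w

theorem complexStructure_apply (a : T × T) : complexStructure ħ T a = (ħ • a.2, -(ħ⁻¹ • a.1)) := rfl

/-- A form of type `(0, q)` is determined by its values on vertical vectors. -/
theorem IsConjLinear.ext (hħ : ħ ≠ 0) {β β' : (T × T) [⋀^Fin q]→ₗ[ℝ] W} (hβ : IsConjLinear ħ β)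
    (hβ' : IsConjLinear ħ β')
    (h : ∀ v : Fin q → T, β (fun i => (0, v i)) = β' (fun i => (0, v i))) : β = β' := by
  classical
  -- Induction on the set of slots that may have a horizontal component.
  have key : ∀ (s : Finset (Fin q)) (w : Fin q → T × T), (∀ i ∉ s, (w i).1 = 0) →
      β w = β' w := by
    intro s
    induction s using Finset.induction_on with
    | empty =>
      intro w hw
      have h1 : w = fun i => (0, (w i).2) :=
        funext fun i => Prod.ext (hw i (Finset.notMem_empty i)) rfl
      rw [h1]
      exact h _
    | insert a s _ ih =>
      intro w hw
      -- A horizontal vector is `J` of a vertical one, `(x, 0) = J(0, ħ⁻¹x)`, so conjugate-linearity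
      -- makes the slot vertical.
      have h1 : w = Function.update w a
          ((0, (w a).2) + complexStructure ħ T (0, ħ⁻¹ • (w a).1)) := by
        rw [complexStructure_apply]
        simp [hħ]
      have h2 : ∀ γ : (T × T) [⋀^Fin q]→ₗ[ℝ] W, IsConjLinear ħ γ →
          γ w = γ (Function.update w a (0, (w a).2))
            + -Complex.I • γ (Function.update w a (0, ħ⁻¹ • (w a).1)) := by
        intro γ hγ
        have h3 := hγ (Function.update w a (0, ħ⁻¹ • (w a).1)) a
        rw [Function.update_self, Function.update_idem] at h3
        rw [← h3, ← γ.map_update_add, ← h1]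
      have h4 : ∀ b : T, ∀ i ∉ s, (Function.update w a (0, b) i).1 = 0 := by
        intro b i hi
        by_cases hia : i = a
        · rw [hia, Function.update_self]
        · rw [Function.update_of_ne hia]
          exact hw i (by simp [hia, hi])
      rw [h2 β hβ, h2 β' hβ', ih _ (h4 _), ih _ (h4 _)]
  ext w
  exact key Finset.univ w fun i hi => (hi (Finset.mem_univ i)).elim

theorem IsConjLinear.compLinearMap {T' : Type*} [AddCommGroup T'] [Module ℝ T']
    [TopologicalSpace T'] [IsTopologicalAddGroup T'] [ContinuousSMul ℝ T']
    {β : (T × T) [⋀^Fin q]→ₗ[ℝ] W} (hβ : IsConjLinear ħ β) (ι : T' →ₗ[ℝ] T) :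
    IsConjLinear ħ (β.compLinearMap (ι.prodMap ι)) := by
  intro w i
  rw [AlternatingMap.compLinearMap_apply, AlternatingMap.compLinearMap_apply, ← hβ _ i]
  congr 1
  funext j
  by_cases hj : j = i
  · subst hj
    simp [complexStructure_apply]
  · simp [Function.update_of_ne hj]

theorem IsConjLinear.compAlternatingMap {W' : Type*} [AddCommGroup W'] [Module ℂ W']
    {β : (T × T) [⋀^Fin q]→ₗ[ℝ] W} (hβ : IsConjLinear ħ β) (c : W →ₗ[ℂ] W') :
    IsConjLinear ħ ((c.restrictScalars ℝ).compAlternatingMap β) := by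
  intro w i
  change c (β _) = -Complex.I • c (β w)
  rw [hβ, map_smul]

theorem IsConjLinear.smul {β : (T × T) [⋀^Fin q]→ₗ[ℝ] W} (hβ : IsConjLinear ħ β) (c : ℂ) :
    IsConjLinear ħ (c • β) := by
  intro w i
  rw [AlternatingMap.smul_apply, AlternatingMap.smul_apply, hβ, smul_comm]

theorem alternatingMap_sum_apply {V : Type*} [AddCommGroup V] [Module ℝ V] {ι : Type*}
    (s : Finset ι) (β : ι → V [⋀^Fin q]→ₗ[ℝ] W) (v : Fin q → V) :
    (∑ j ∈ s, β j) v = ∑ j ∈ s, β j v :=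
  map_sum (⟨⟨fun f : V [⋀^Fin q]→ₗ[ℝ] W => f v, rfl⟩, fun _ _ => rfl⟩ : _ →+ W) β s

theorem IsConjLinear.sum {ι : Type*} (s : Finset ι) {β : ι → (T × T) [⋀^Fin q]→ₗ[ℝ] W}
    (hβ : ∀ j ∈ s, IsConjLinear ħ (β j)) : IsConjLinear ħ (∑ j ∈ s, β j) := by
  intro w i
  rw [alternatingMap_sum_apply, alternatingMap_sum_apply, Finset.smul_sum]
  exact Finset.sum_congr rfl fun j hj => hβ j hj w i

theorem isConjLinear_tensorFrame {c : (T × T) [⋀^Fin q]→ₗ[ℝ] ℂ} (hc : IsConjLinear ħ c) (s : W) :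
    IsConjLinear ħ (tensorFrame c s) :=
  hc.compAlternatingMap _

end ConjLinear

/-! ### Expansion of alternating forms over increasing multi-indices -/

section BasisExpansion

variable {n q : ℕ}

/-- The expansion of an alternating form on `ℝⁿ` in terms of the coordinate forms. -/
theorem sum_strictMono_eq (φ : Model n [⋀^Fin q]→ₗ[ℝ] ℂ) (v : Fin q → Model n)
    [DecidablePred fun I : Fin q → Fin n => StrictMono I] :
    ∑ I : Fin q → Fin n with StrictMono I, φ (fun a => Pi.single (I a) 1)
      * realDet q (fun i a => (v i (I a) : ℂ)) = φ v := by
  let ρ : (Fin q → Fin n) → (Model n →ₗ[ℝ] (Fin q → ℂ)) := fun I =>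
    LinearMap.pi fun a => (Complex.ofRealCLM : ℝ →ₗ[ℝ] ℂ).comp (LinearMap.proj (I a))
  let S : Model n [⋀^Fin q]→ₗ[ℝ] ℂ := ∑ I : Fin q → Fin n with StrictMono I,
    φ (fun a => Pi.single (I a) 1) • (realDet q).compLinearMap (ρ I)
  have hS : ∀ v, S v = ∑ I : Fin q → Fin n with StrictMono I, φ (fun a => Pi.single (I a) 1)
      * realDet q (fun i a => (v i (I a) : ℂ)) := by
    intro v
    simp only [S, alternatingMap_sum_apply, AlternatingMap.smul_apply, smul_eq_mul]
    rfl
  rw [← hS]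
  congr 1
  refine Module.Basis.ext_alternating (Pi.basisFun ℝ (Fin n)) fun J hJ => ?_
  simp only [Pi.basisFun_apply]
  have hmono : ∀ I : Fin q → Fin n, StrictMono I →
      S (fun a => Pi.single (I a) 1) = φ fun a => Pi.single (I a) 1 := by
    intro I hI
    rw [hS, Finset.sum_eq_single I]
    · have h1 : (fun i a => ((Pi.single (I i) (1 : ℝ) : Model n) (I a) : ℂ))
          = (1 : Matrix (Fin q) (Fin q) ℂ) := by
        funext i a
        rw [Matrix.one_apply, Pi.single_apply]
        rw [apply_ite Complex.ofReal]
        simp [hI.injective.eq_iff, eq_comm]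
      rw [h1]
      exact (congrArg _ Matrix.det_one).trans (mul_one _)
    · intro I' hI' hne
      have hI'm : StrictMono I' := (Finset.mem_filter.1 hI').2
      -- Distinct increasing multi-indices of equal length have distinct ranges, so the minor of
      -- `I'` on the basis vectors of `I` has a zero row.
      have h2 : ∃ i, ∀ a, I i ≠ I' a := by
        by_contra hcon
        push Not at hcon
        apply hne
        have h3 : Set.range I ⊆ Set.range I' := by
          rintro _ ⟨i, rfl⟩
          obtain ⟨a, ha⟩ := hcon i
          exact ⟨a, ha.symm⟩
        have h4 : Set.range I = Set.range I' := by
          apply Set.eq_of_subset_of_ncard_le h3 _ (Set.finite_range _)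
          rw [← Set.image_univ, ← Set.image_univ, Set.ncard_image_of_injective _ hI.injective,
            Set.ncard_image_of_injective _ hI'm.injective]
        exact (StrictMono.range_inj hI'm hI).1 h4.symm
      obtain ⟨i, hi⟩ := h2
      have h5 : realDet q (fun i a => ((Pi.single (I i) (1 : ℝ) : Model n) (I' a) : ℂ)) = 0 := by
        refine Matrix.det_eq_zero_of_row_eq_zero i fun a => ?_
        rw [Pi.single_apply, if_neg (hi a).symm, Complex.ofReal_zero]
      rw [h5, mul_zero]
    · intro h
      exact (h (Finset.mem_filter.2 ⟨Finset.mem_univ _, hI⟩)).elim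
  -- Sorting an injective multi-index changes both sides by the same sign.
  have hsort : StrictMono (J ∘ Tuple.sort J) :=
    (Tuple.monotone_sort J).strictMono_of_injective (hJ.comp (Equiv.injective _))
  have h6 : (fun a => (Pi.single (J a) 1 : Model n))
      = (fun a => (Pi.single ((J ∘ Tuple.sort J) a) 1 : Model n)) ∘ ((Tuple.sort J)⁻¹ : Equiv.Perm (Fin q)) := by
    funext a
    simp
  rw [h6, AlternatingMap.map_perm, AlternatingMap.map_perm, hmono _ hsort]

end BasisExpansion

/-! ### Extension of vertical forms to forms of type `(0, q)` -/

section Extension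

variable {n q : ℕ} {ħ : ℝ}

/-- The form `dz̄ʲ` on the model `ℝⁿ × ℝⁿ` of a tangent space of `X̌`. -/
def dzbarCoord (ħ : ℝ) (j : Fin n) : Model n × Model n →ₗ[ℝ] ℂ where
  toFun w := (w.2 j : ℂ) - Complex.I * (ħ : ℂ)⁻¹ * (w.1 j : ℂ)
  map_add' v w := by simp; ring
  map_smul' c w := by simp; ring

/-- The form `dz̄^I` on the model `ℝⁿ × ℝⁿ` of a tangent space of `X̌`. -/
def dzbarModel (ħ : ℝ) (I : Fin q → Fin n) :
    (Model n × Model n) [⋀^Fin q]→ₗ[ℝ] ℂ :=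
  (realDet q).compLinearMap (LinearMap.pi fun a => dzbarCoord ħ (I a))

theorem dzbarModel_vertical (I : Fin q → Fin n) (v : Fin q → Model n) :
    dzbarModel ħ I (fun i => (0, v i)) = realDet q (fun i a => (v i (I a) : ℂ)) := by
  rw [dzbarModel, AlternatingMap.compLinearMap_apply]
  congr 1
  funext i a
  simp [dzbarCoord]

/-- Each row of the determinant satisfies `dz̄ʲ ∘ J = -i dz̄ʲ`. -/
theorem isConjLinear_dzbarModel (hħ : ħ ≠ 0) (I : Fin q → Fin n) :
    IsConjLinear ħ (dzbarModel ħ I) := by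
  intro w i
  have h1 : ∀ x : Model n × Model n, (LinearMap.pi fun a => dzbarCoord ħ (I a))
      (complexStructure ħ (Model n) x)
        = -Complex.I • (LinearMap.pi fun a => dzbarCoord ħ (I a) : _ →ₗ[ℝ] (Fin q → ℂ)) x := by
    intro x
    funext a
    have hħ' : (ħ : ℂ) ≠ 0 := by exact_mod_cast hħ
    simp only [LinearMap.pi_apply, dzbarCoord, complexStructure_apply, LinearMap.coe_mk,
      AddHom.coe_mk, Pi.smul_apply, Pi.neg_apply, smul_eq_mul, Complex.ofReal_mul,
      Complex.ofReal_neg, Complex.ofReal_inv]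
    field_simp
    ring_nf
    rw [Complex.I_sq]
    ring
  have h2 : (fun j => (LinearMap.pi fun a => dzbarCoord ħ (I a))
      (Function.update w i (complexStructure ħ (Model n) (w i)) j))
      = Function.update (fun j => (LinearMap.pi fun a => dzbarCoord ħ (I a) :
        _ →ₗ[ℝ] (Fin q → ℂ)) (w j)) i
        (-Complex.I • (LinearMap.pi fun a => dzbarCoord ħ (I a) : _ →ₗ[ℝ] (Fin q → ℂ)) (w i)) := by
    funext j
    by_cases hj : j = i
    · subst hj
      rw [Function.update_self, Function.update_self, h1]
    · rw [Function.update_of_ne hj, Function.update_of_ne hj]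
  rw [dzbarModel, AlternatingMap.compLinearMap_apply, AlternatingMap.compLinearMap_apply]
  change Matrix.detRowAlternating (R := ℂ) (n := Fin q) _ = _ • Matrix.detRowAlternating _
  rw [h2, AlternatingMap.map_update_smul, Function.update_eq_self]

open Classical in
/-- The `(0, q)`-form on `ℝⁿ × ℝⁿ` with given restriction to vertical vectors. -/
def extForm (ħ : ℝ) (n q : ℕ) : (Model n [⋀^Fin q]→L[ℝ] ℂ) →L[ℝ]
    (Model n × Model n) [⋀^Fin q]→L[ℝ] ℂ :=
  ∑ I : Fin q → Fin n with StrictMono I,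
    (ContinuousAlternatingMap.apply ℝ (Model n) ℂ
      (fun a => (Pi.single (I a) 1 : Model n))).smulRight
        (toContinuousAlternating (dzbarModel ħ I))

open Classical in
theorem extForm_toAlternatingMap (φ : Model n [⋀^Fin q]→L[ℝ] ℂ) :
    (extForm ħ n q φ).toAlternatingMap = ∑ I : Fin q → Fin n with StrictMono I,
      φ (fun a => Pi.single (I a) 1) • dzbarModel ħ I := by
  ext w
  change extForm ħ n q φ w = _
  rw [extForm, _root_.sum_apply, ContinuousAlternatingMap.sum_apply,
    alternatingMap_sum_apply]
  rfl

theorem isConjLinear_extForm (hħ : ħ ≠ 0) (φ : Model n [⋀^Fin q]→L[ℝ] ℂ) :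
    IsConjLinear ħ (extForm ħ n q φ).toAlternatingMap := by
  rw [extForm_toAlternatingMap]
  exact IsConjLinear.sum _ fun I _ => (isConjLinear_dzbarModel hħ I).smul _

theorem extForm_vertical (φ : Model n [⋀^Fin q]→L[ℝ] ℂ) (v : Fin q → Model n) :
    extForm ħ n q φ (fun i => (0, v i)) = φ v := by
  classical
  have h := congrArg (fun f => f fun i => ((0 : Model n), v i)) (extForm_toAlternatingMap (ħ := ħ) φ)
  refine h.trans ?_
  simp only [alternatingMap_sum_apply, AlternatingMap.smul_apply, dzbarModel_vertical, smul_eq_mul]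
  exact sum_strictMono_eq φ.toAlternatingMap v

end Extension

/-! ### Type `(0, q)` and vertical restriction under alternatization -/

section Alternatize

variable {n q : ℕ} {ħ : ℝ}

open ContinuousAlternatingMap

theorem isConjLinear_alternatizeUncurryFin
    {D : Model n × Model n →L[ℝ] (Model n × Model n) [⋀^Fin q]→L[ℝ] ℂ}
    (hD : ∀ x, D (complexStructure ħ (Model n) x) = -Complex.I • D x)
    (hD' : ∀ x, IsConjLinear ħ (D x).toAlternatingMap) :
    IsConjLinear ħ (alternatizeUncurryFin D).toAlternatingMap := by
  intro w j
  change alternatizeUncurryFin D _ = -Complex.I • alternatizeUncurryFin D w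
  rw [alternatizeUncurryFin_apply, alternatizeUncurryFin_apply, Finset.smul_sum]
  refine Finset.sum_congr rfl fun i _ => ?_
  rw [smul_comm]
  congr 1
  -- The rotated vector is either the direction of differentiation or an argument of the form; each
  -- hypothesis covers one case.
  rcases eq_or_ne j i with rfl | hne
  · rw [Function.update_self, Fin.removeNth_update, hD]
    rfl
  · obtain ⟨k, rfl⟩ := Fin.exists_succAbove_eq hne
    rw [Function.update_of_ne hne.symm, Fin.removeNth_update_succAbove]
    exact hD' (w i) (i.removeNth w) k

theorem alternatizeUncurryFin_vertical
    (D : Model n × Model n →L[ℝ] (Model n × Model n) [⋀^Fin q]→L[ℝ] ℂ)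
    (D' : Model n →L[ℝ] Model n [⋀^Fin q]→L[ℝ] ℂ)
    (h : ∀ a (v : Fin q → Model n), D (0, a) (fun i => (0, v i)) = D' a v)
    (v : Fin (q + 1) → Model n) :
    alternatizeUncurryFin D (fun i => (0, v i)) = alternatizeUncurryFin D' v := by
  rw [alternatizeUncurryFin_apply, alternatizeUncurryFin_apply]
  refine Finset.sum_congr rfl fun i _ => ?_
  rw [← h]
  rfl

end Alternatize

/-! ## The line bundles -/

section Bundle

variable {n : ℕ} {B : Type*} [TopologicalSpace B] [ChartedSpace (Model n) B]

section Poincare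

variable {x : B} {η : Fiber n x} {v : MirrorFiber n x}

theorem coframe_frame (y y' : Lift η) (w : MirrorLift v) :
    coframe y w (frame v y')
      = Complex.exp (2 * Real.pi * Complex.I * ((y'.1 - y.1) w.1 : ℝ)) := by
  change Complex.exp _ * Complex.exp _ = _
  rw [← Complex.exp_add]
  congr 1
  simp
  ring

theorem coframe_frame_self (y : Lift η) (w : MirrorLift v) : coframe y w (frame v y) = 1 := by
  rw [coframe_frame]
  simp

/-- The two transformation laws determine an element of the fibre from its value at a single pair of
lifts. -/
theorem coframe_smul_frame (y : Lift η) (w : MirrorLift v) (f : poincareFiber η v) :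
    coframe y w f • frame v y = f := by
  have h1 : ∀ (f f' : poincareFiber η v), f.1 y w = f'.1 y w → f = f' := by
    intro f f' h
    ext y' w'
    rw [f.2.2 y' w w', f.2.1 y y' w, h, ← f'.2.1 y y' w, ← f'.2.2 y' w w']
  refine h1 _ _ ?_
  change (Complex.exp _ * f.1 y w) * (frame v y).1 y w = f.1 y w
  rw [frame_apply, mul_right_comm, ← Complex.exp_add, neg_add_cancel, Complex.exp_zero, one_mul]

/-- The frame spans the line and does not involve `w`; the functional equal to one on it is
therefore unique. -/
theorem coframe_eq (y : Lift η) (w w' : MirrorLift v) : coframe y w = coframe y w' := by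
  refine LinearMap.ext fun f => ?_
  conv_rhs => rw [← coframe_smul_frame y w f]
  rw [map_smul, coframe_frame_self, smul_eq_mul, mul_one]

end Poincare

variable {ħ : ℝ} {ξ₁ ξ₂ : LagrangianSection n B ħ} {z : Mirror n B}
  (y₁ : Lift (ξ₁.toFun z.base)) (y₂ : Lift (ξ₂.toFun z.base)) (w : MirrorLift z.fib)

theorem homCoeff_tmul (φ : Module.Dual ℂ (mirrorBundle ξ₁ z)) (s : mirrorBundle ξ₂ z) :
    homCoeff y₁ y₂ w (φ ⊗ₜ[ℂ] s) = φ (frame z.fib y₁) * coframe y₂ w s := by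
  rw [homCoeff, TensorProduct.lift.tmul]
  rfl

theorem homCoeff_homFrame : homCoeff y₁ y₂ w (homFrame y₁ y₂ w) = 1 := by
  rw [homFrame, homCoeff_tmul, coframe_frame_self, coframe_frame_self, one_mul]

theorem homCoeff_smul_self (c : ℂ) : homCoeff y₁ y₂ w (c • homFrame y₁ y₂ w) = c := by
  rw [map_smul, homCoeff_homFrame, smul_eq_mul, mul_one]

theorem homCoeff_smul_homFrame (t : homBundle ξ₁ ξ₂ z) :
    homCoeff y₁ y₂ w t • homFrame y₁ y₂ w = t := by
  induction t using TensorProduct.induction_on with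
  | zero => rw [map_zero, zero_smul]
  | add s t hs ht => rw [map_add, add_smul, hs, ht]
  | tmul φ s =>
    have h1 : φ = φ (frame z.fib y₁) • (coframe y₁ w : Module.Dual ℂ (mirrorBundle ξ₁ z)) := by
      refine LinearMap.ext fun f => ?_
      conv_lhs => rw [← coframe_smul_frame y₁ w f]
      rw [map_smul, LinearMap.smul_apply, smul_eq_mul, smul_eq_mul, mul_comm]
    conv_rhs => rw [h1, ← coframe_smul_frame y₂ w s]
    rw [homCoeff_tmul, homFrame, TensorProduct.smul_tmul_smul]

theorem homCoeff_eq (w' : MirrorLift z.fib) : homCoeff y₁ y₂ w = homCoeff y₁ y₂ w' := by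
  refine TensorProduct.ext' fun φ s => ?_
  rw [homCoeff_tmul, homCoeff_tmul, coframe_eq y₂ w w']

/-- The exponential is the character of the lattice element `liftShift`, by which the index of the
Fourier series moves under the same change of lifts. -/
theorem homFrame_eq_smul (y₁' : Lift (ξ₁.toFun z.base)) (y₂' : Lift (ξ₂.toFun z.base))
    (w' : MirrorLift z.fib) :
    homFrame y₁' y₂' w' = Complex.exp (2 * Real.pi * Complex.I
      * (((y₂'.1 - y₂.1) - (y₁'.1 - y₁.1)) w.1 : ℝ)) • homFrame y₁ y₂ w := by
  conv_lhs => rw [← homCoeff_smul_homFrame y₁ y₂ w (homFrame y₁' y₂' w')]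
  rw [homFrame, homCoeff_tmul, coframe_eq y₁' w' w, coframe_frame, coframe_frame,
    ← Complex.exp_add]
  congr 2
  simp
  ring

end Bundle

/-! ## The SYZ transform at a point -/

section Pointwise

variable {n : ℕ} {B : Type*} [TopologicalSpace B] [ChartedSpace (Model n) B] {ħ : ℝ}
  {ξ₁ ξ₂ : LagrangianSection n B ħ} {q : ℕ}

theorem PathForm.apply_congr (α : PathForm ξ₁ ξ₂ q) {x : B} {η η' : Cotan n x}
    (h : ξ₁.toFun x + QuotientAddGroup.mk η = ξ₂.toFun x)
    (h' : ξ₁.toFun x + QuotientAddGroup.mk η' = ξ₂.toFun x) (hη : η = η') (v : Fin q → Tan n x) :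
    α ⟨x, η, h⟩ v = α ⟨x, η', h'⟩ v := by
  subst hη
  rfl

/-- The value of `α` at a path given by lifts of its end points. -/
def PathForm.onFiber (α : PathForm ξ₁ ξ₂ q) {x : B} (y₁ : Lift (ξ₁.toFun x))
    (y₂ : Lift (ξ₂.toFun x)) (m : dualLattice n x) : Tan n x [⋀^Fin q]→L[ℝ] ℂ :=
  α (pathOf y₁ y₂ m)

/-- The values of `α` along the fibre over `x` form a summable family. -/
def PathForm.FiberSummable (α : PathForm ξ₁ ξ₂ q) (x : B) : Prop :=
  ∀ (y₁ : Lift (ξ₁.toFun x)) (y₂ : Lift (ξ₂.toFun x)) (v : Fin q → Tan n x),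
    Summable fun m : dualLattice n x => α.onFiber y₁ y₂ m v

/-- The element of `Λ_x^*` that relates two pairs of lifts. -/
def liftShift {x : B} (y₁ y₁' : Lift (ξ₁.toFun x)) (y₂ y₂' : Lift (ξ₂.toFun x)) :
    dualLattice n x :=
  ⟨(y₂'.1 - y₂.1) - (y₁'.1 - y₁.1),
    sub_mem (mem_dualLattice_of_lifts y₂ y₂') (mem_dualLattice_of_lifts y₁ y₁')⟩

theorem PathForm.onFiber_eq (α : PathForm ξ₁ ξ₂ q) {x : B} (y₁ y₁' : Lift (ξ₁.toFun x))
    (y₂ y₂' : Lift (ξ₂.toFun x)) (m : dualLattice n x) (v : Fin q → Tan n x) :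
    α.onFiber y₁' y₂' m v = α.onFiber y₁ y₂ (liftShift y₁ y₁' y₂ y₂' + m) v := by
  refine α.apply_congr _ _ ?_ v
  change y₂'.1 - y₁'.1 + m.1 = y₂.1 - y₁.1 + ((y₂'.1 - y₂.1) - (y₁'.1 - y₁.1) + m.1)
  abel

theorem PathForm.fiberSummable_of_lifts (α : PathForm ξ₁ ξ₂ q) {x : B} (y₁ : Lift (ξ₁.toFun x))
    (y₂ : Lift (ξ₂.toFun x))
    (h : ∀ v : Fin q → Tan n x, Summable fun m : dualLattice n x => α.onFiber y₁ y₂ m v) :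
    α.FiberSummable x := by
  intro y₁' y₂' v
  simp only [α.onFiber_eq y₁ y₁' y₂ y₂']
  exact (Equiv.addLeft (liftShift y₁ y₁' y₂ y₂')).summable_iff.2 (h v)

theorem norm_exp_two_pi_mul (r : ℝ) : ‖Complex.exp (2 * Real.pi * Complex.I * (r : ℝ))‖ = 1 := by
  rw [show 2 * (Real.pi : ℂ) * Complex.I * (r : ℝ) = ((2 * Real.pi * r : ℝ) : ℂ) * Complex.I by
    push_cast; ring]
  exact Complex.norm_exp_ofReal_mul_I _

theorem PathForm.FiberSummable.summable_mul {α : PathForm ξ₁ ξ₂ q} {x : B}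
    (hα : α.FiberSummable x) (y₁ : Lift (ξ₁.toFun x)) (y₂ : Lift (ξ₂.toFun x)) (w : Tan n x)
    (v : Fin q → Tan n x) : Summable fun m : dualLattice n x =>
      α.onFiber y₁ y₂ m v * Complex.exp (2 * Real.pi * Complex.I * (m.1 w : ℝ)) := by
  refine Summable.of_norm ?_
  simp only [norm_mul, norm_exp_two_pi_mul, mul_one]
  exact (hα y₁ y₂ v).norm

theorem PathForm.FiberSummable.summable_fourierTerm {α : PathForm ξ₁ ξ₂ q} {x : B}
    (hα : α.FiberSummable x) (y₁ : Lift (ξ₁.toFun x)) (y₂ : Lift (ξ₂.toFun x)) (w : Tan n x)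
    (I : Fin q → Fin n) : Summable (fourierTerm α y₁ y₂ w I) :=
  hα.summable_mul y₁ y₂ w _

theorem tensorFrame_apply {V W : Type*} [AddCommGroup V] [Module ℝ V] [AddCommGroup W] [Module ℂ W]
    (c : V [⋀^Fin q]→ₗ[ℝ] ℂ) (s : W) (v : Fin q → V) : tensorFrame c s v = c v • s := rfl

theorem dzbarForm_eq (z : Mirror n B) (I : Fin q → Fin n) :
    dzbarForm ħ z I = (dzbarModel ħ I).compLinearMap
      ((toChart (chartAt (Model n) z.base) z.base).toLinearMap.prodMap
        (toChart (chartAt (Model n) z.base) z.base).toLinearMap) := rfl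

theorem isConjLinear_syzFormula (hħ : ħ ≠ 0) (α : PathForm ξ₁ ξ₂ q) (z : Mirror n B)
    (y₁ : Lift (ξ₁.toFun z.base)) (y₂ : Lift (ξ₂.toFun z.base)) (w : MirrorLift z.fib) :
    IsConjLinear ħ (syzFormula α z y₁ y₂ w) := by
  refine isConjLinear_tensorFrame ((IsConjLinear.sum _ fun I _ => ?_).smul _) _
  rw [dzbarForm_eq]
  exact ((isConjLinear_dzbarModel hħ I).compLinearMap _).smul _

variable [HasGroupoid B (integralAffineGroupoid n)]

/-- On vertical vectors `dz̄^I` is `dy̌^I`, so the sum over multi-indices reassembles the values of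
`α`. The result is a scalar Fourier series without reference to coordinates. -/
theorem syzFormula_vertical {α : PathForm ξ₁ ξ₂ q} {z : Mirror n B}
    (hα : α.FiberSummable z.base) (y₁ : Lift (ξ₁.toFun z.base)) (y₂ : Lift (ξ₂.toFun z.base))
    (w : MirrorLift z.fib) (v : Fin q → Tan n z.base) :
    syzFormula α z y₁ y₂ w (fun i => (0, v i)) = ((-((ħ : ℂ) / (2 * Complex.I))) ^ q
      * ∑' m : dualLattice n z.base, α.onFiber y₁ y₂ m v
        * Complex.exp (2 * Real.pi * Complex.I * (m.1 w.1 : ℝ))) • homFrame y₁ y₂ w := by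
  classical
  refine (tensorFrame_apply _ _ _).trans ?_
  congr 1
  rw [AlternatingMap.smul_apply, smul_eq_mul, alternatingMap_sum_apply]
  congr 1
  simp only [AlternatingMap.smul_apply, smul_eq_mul]
  simp only [← tsum_mul_right]
  rw [← Summable.tsum_finsetSum fun I _ => (hα.summable_fourierTerm y₁ y₂ w.1 I).mul_right _]
  refine tsum_congr fun m => ?_
  let c := chartAt (Model n) z.base
  have hc : c ∈ atlas (Model n) B := chart_mem_atlas _ _
  have hx : z.base ∈ c.source := mem_chart_source _ _
  have h1 := sum_strictMono_eq ((α.onFiber y₁ y₂ m).toAlternatingMap.compLinearMap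
    (fromChart c z.base).toLinearMap) fun i => toChart c z.base (v i)
  have h2 : ((α.onFiber y₁ y₂ m).toAlternatingMap.compLinearMap
    (fromChart c z.base).toLinearMap) (fun i => toChart c z.base (v i))
      = α.onFiber y₁ y₂ m v := by
    change α.onFiber y₁ y₂ m (fun i => fromChart c z.base (toChart c z.base (v i))) = _
    simp only [fromChart_toChart hc hx]
  rw [h2] at h1
  rw [← h1, Finset.sum_mul]
  refine Finset.sum_congr (by congr) fun I _ => ?_
  have h3 : dzbarForm ħ z I (fun i => (0, v i))
      = realDet q fun i a => (toChart c z.base (v i) (I a) : ℂ) := by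
    rw [dzbarForm_eq, AlternatingMap.compLinearMap_apply, ← dzbarModel_vertical (ħ := ħ)]
    congr 1
    funext i
    exact Prod.ext (map_zero (toChart c z.base)) rfl
  rw [h3, fourierTerm, mul_right_comm]
  rfl

/-- New lifts translate the summation index by `liftShift`, and the character of the shift is the
factor relating the frames. It suffices to compare vertical vectors. -/
theorem syzFormula_eq (hħ : ħ ≠ 0) {α : PathForm ξ₁ ξ₂ q} {z : Mirror n B}
    (hα : α.FiberSummable z.base) (y₁ y₁' : Lift (ξ₁.toFun z.base))
    (y₂ y₂' : Lift (ξ₂.toFun z.base)) (w w' : MirrorLift z.fib) :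
    syzFormula α z y₁' y₂' w' = syzFormula α z y₁ y₂ w := by
  refine (isConjLinear_syzFormula hħ α z _ _ _).ext hħ (isConjLinear_syzFormula hħ α z _ _ _)
    fun v => ?_
  refine (syzFormula_vertical hα y₁' y₂' w' v).trans
    (Eq.trans ?_ (syzFormula_vertical hα y₁ y₂ w v).symm)
  rw [homFrame_eq_smul y₁ y₂ w, smul_smul]
  congr 1
  rw [mul_assoc]
  congr 1
  have h := (Equiv.addLeft (liftShift y₁ y₁' y₂ y₂')).tsum_eq fun m => α.onFiber y₁ y₂ m v
    * Complex.exp (2 * Real.pi * Complex.I * (m.1 w.1 : ℝ))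
  rw [← h, ← tsum_mul_right]
  refine tsum_congr fun m => ?_
  rw [Equiv.coe_addLeft, α.onFiber_eq y₁ y₁' y₂ y₂', mul_assoc, ← Complex.exp_add]
  congr 1
  -- Elements of the dual lattice pair integrally with differences of lifts of the same point, so
  -- passing from `w` to `w'` leaves the exponential unchanged.
  obtain ⟨k, hk⟩ := m.2 _ (mem_lattice_of_lifts w w')
  have hk' : ((m.1 w'.1 : ℝ) : ℂ) = m.1 w.1 + k := by
    have h4 : m.1 w'.1 = m.1 w.1 + k := by rw [← hk, map_sub]; ring
    exact_mod_cast h4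
  rw [Complex.exp_eq_exp_iff_exists_int]
  refine ⟨k, ?_⟩
  change 2 * (Real.pi : ℂ) * Complex.I * ((m.1 w'.1 : ℝ) : ℂ)
    + 2 * Real.pi * Complex.I * (((y₂'.1 - y₂.1 - (y₁'.1 - y₁.1)) w.1 : ℝ) : ℂ)
    = 2 * Real.pi * Complex.I * ((((y₂'.1 - y₂.1 - (y₁'.1 - y₁.1)) + m.1) w.1 : ℝ) : ℂ)
      + k * (2 * Real.pi * Complex.I)
  rw [hk', _root_.add_apply (_ : Cotan n z.base) m.1]
  push_cast
  ring

theorem syzTransform_eq (hħ : ħ ≠ 0) {α : PathForm ξ₁ ξ₂ q} {z : Mirror n B}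
    (hα : α.FiberSummable z.base) (y₁ : Lift (ξ₁.toFun z.base)) (y₂ : Lift (ξ₂.toFun z.base))
    (w : MirrorLift z.fib) : syzTransform α z = syzFormula α z y₁ y₂ w :=
  syzFormula_eq hħ hα _ _ _ _ _ _

omit [HasGroupoid B (integralAffineGroupoid n)] in
theorem isZeroQ_syzTransform (hħ : ħ ≠ 0) (α : PathForm ξ₁ ξ₂ q) : (syzTransform α).IsZeroQ :=
  fun z => isConjLinear_syzFormula hħ α z _ _ _

end Pointwise

/-! ## The SYZ transform in affine coordinates -/

section Coordinates

variable {n : ℕ} {B : Type*} [TopologicalSpace B] [ChartedSpace (Model n) B] {ħ : ℝ}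
  {ξ₁ ξ₂ : LagrangianSection n B ħ} {q : ℕ} {e : OpenPartialHomeomorph B (Model n)}
  {U : Set (Model n)} {η₁ η₂ : Model n → (Model n →L[ℝ] ℝ)}

/-- The value at a point of a local lift. -/
def IsLocalLift.at {ξ : ∀ x : B, Fiber n x} {η : Model n → (Model n →L[ℝ] ℝ)}
    (h : IsLocalLift ξ e U η) {u : Model n} (hu : u ∈ U) : Lift (ξ (e.symm u)) :=
  ⟨covector e (e.symm u) (η u), h.lift u hu⟩

/-- The point of `X̌` with coordinates `(x, y̌)`. -/
def mirrorPoint (e : OpenPartialHomeomorph B (Model n)) (p : Model n × Model n) : Mirror n B :=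
  ⟨e.symm p.1, QuotientAddGroup.mk (fromChart e (e.symm p.1) p.2)⟩

/-- The lift to the tangent bundle of `mirrorPoint e p`. -/
def mirrorPointLift (e : OpenPartialHomeomorph B (Model n)) (p : Model n × Model n) :
    MirrorLift (mirrorPoint e p).fib :=
  ⟨fromChart e (e.symm p.1) p.2, rfl⟩

theorem localCoeff_apply (β : MirrorForm ξ₁ ξ₂ q) (h₁ : IsLocalLift ξ₁.toFun e U η₁)
    (h₂ : IsLocalLift ξ₂.toFun e U η₂) {p : Model n × Model n} (hp : p.1 ∈ U)
    (w : Fin q → Model n × Model n) :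
    β.localCoeff e η₁ η₂ p w = homCoeff (z := mirrorPoint e p) (h₁.at hp) (h₂.at hp)
      (mirrorPointLift e p) (β (mirrorPoint e p) fun i =>
        (fromChart e (e.symm p.1) (w i).1, fromChart e (e.symm p.1) (w i).2)) := by
  rw [MirrorForm.localCoeff, dif_pos ⟨h₁.lift _ hp, h₂.lift _ hp⟩]
  rfl

theorem isConjLinear_localCoeff {β : MirrorForm ξ₁ ξ₂ q} (hβ : β.IsZeroQ)
    (h₁ : IsLocalLift ξ₁.toFun e U η₁) (h₂ : IsLocalLift ξ₂.toFun e U η₂)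
    {p : Model n × Model n} (hp : p.1 ∈ U) :
    IsConjLinear ħ (β.localCoeff e η₁ η₂ p).toAlternatingMap := by
  have h1 : IsConjLinear ħ (β (mirrorPoint e p)) := hβ _
  have h2 := (h1.compAlternatingMap (homCoeff (z := mirrorPoint e p) (h₁.at hp) (h₂.at hp)
      (mirrorPointLift e p))).compLinearMap (fromChart e (e.symm p.1)).toLinearMap
  intro w i
  have h3 := h2 w i
  change β.localCoeff e η₁ η₂ p _ = -Complex.I • β.localCoeff e η₁ η₂ p w
  rw [localCoeff_apply β h₁ h₂ hp, localCoeff_apply β h₁ h₂ hp]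
  exact h3

variable [HasGroupoid B (integralAffineGroupoid n)]

/-- `Λ_x^* ≅ ℤⁿ`, in affine coordinates. -/
def latticeEquiv (he : e ∈ atlas (Model n) B) {x : B} (hx : x ∈ e.source) :
    (Fin n → ℤ) ≃ dualLattice n x :=
  Equiv.ofBijective (fun m => ⟨covector e x (icov m), covector_icov_mem he hx m⟩)
    ⟨fun _ _ h => icov_injective (covector_injective he hx (congrArg Subtype.val h)),
      fun η => (mem_dualLattice_iff he hx).1 η.2 |>.imp fun _ h => Subtype.ext h.symm⟩

theorem PathForm.family_apply (α : PathForm ξ₁ ξ₂ q) (he : e ∈ atlas (Model n) B)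
    (h₁ : IsLocalLift ξ₁.toFun e U η₁) (h₂ : IsLocalLift ξ₂.toFun e U η₂) {u : Model n}
    (hu : u ∈ U) (m : Fin n → ℤ) (v : Fin q → Model n) :
    α.family e η₁ η₂ m u v = α.onFiber (h₁.at hu) (h₂.at hu)
      (latticeEquiv he (e.map_target (h₁.subset hu)) m)
        fun i => fromChart e (e.symm u) (v i) := by
  have hs := e.map_target (h₁.subset hu)
  rw [PathForm.family, α.localRep_eq he (h₁.subset hu)
    (pathOf (h₁.at hu) (h₂.at hu) (latticeEquiv he hs m)) rfl ?_]
  · rfl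
  · change (covector e (e.symm u) (η₂ u) - covector e (e.symm u) (η₁ u)
      + covector e (e.symm u) (icov m)).comp (fromChart e (e.symm u)) = _
    rw [← covector_sub, ← covector_add, covector_comp_fromChart he hs]

theorem fiberSummable_of_family {α : PathForm ξ₁ ξ₂ q} (he : e ∈ atlas (Model n) B)
    (h₁ : IsLocalLift ξ₁.toFun e U η₁) (h₂ : IsLocalLift ξ₂.toFun e U η₂) {u : Model n}
    (hu : u ∈ U) (h : ∀ v, Summable fun m => α.family e η₁ η₂ m u v) :
    α.FiberSummable (e.symm u) := by
  have hs := e.map_target (h₁.subset hu)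
  refine α.fiberSummable_of_lifts (h₁.at hu) (h₂.at hu) fun v => ?_
  rw [← (latticeEquiv he hs).summable_iff]
  refine (h fun i => toChart e (e.symm u) (v i)).congr fun m => ?_
  rw [α.family_apply he h₁ h₂ hu]
  simp only [fromChart_toChart he hs]
  rfl

theorem summable_family_apply {f : (Fin n → ℤ) → Model n → Model n [⋀^Fin q]→L[ℝ] ℂ}
    (hf : DecayFamily U f) {u : Model n} (hu : u ∈ U) (v : Fin q → Model n) :
    Summable fun m => f m u v :=
  (hf.summable_norm hu).of_norm.map (ContinuousAlternatingMap.apply ℝ (Model n) ℂ v)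
    (ContinuousAlternatingMap.apply ℝ (Model n) ℂ v).continuous

theorem fiberSummable_of_mem {g : HessianMetric n B} {α : PathForm ξ₁ ξ₂ q}
    (hα : α ∈ rapidForms ξ₁ ξ₂ g q) (x : B) : α.FiberSummable x := by
  have he := chart_mem_atlas (Model n) x
  have hx := mem_chart_source (Model n) x
  obtain ⟨W, η₁, η₂, hu, h₁, h₂⟩ := exists_lifts ξ₁ ξ₂ he (OpenPartialHomeomorph.map_source _ hx)
  have h := fiberSummable_of_family he h₁ h₂ hu fun v =>
    summable_family_apply (decayFamily_of_mem_rapidForms hα he h₁ h₂) hu v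
  rwa [OpenPartialHomeomorph.left_inv _ hx] at h

theorem localCoeff_syzTransform_vertical (hħ : ħ ≠ 0) {α : PathForm ξ₁ ξ₂ q}
    (he : e ∈ atlas (Model n) B) (h₁ : IsLocalLift ξ₁.toFun e U η₁)
    (h₂ : IsLocalLift ξ₂.toFun e U η₂) {p : Model n × Model n} (hp : p.1 ∈ U)
    (hα : α.FiberSummable (e.symm p.1)) (v : Fin q → Model n) :
    (syzTransform α).localCoeff e η₁ η₂ p (fun i => (0, v i))
      = (-((ħ : ℂ) / (2 * Complex.I))) ^ q * ∑' m, chi m p.2 * α.family e η₁ η₂ m p.1 v := by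
  have hs := e.map_target (h₁.subset hp)
  rw [localCoeff_apply _ h₁ h₂ hp, syzTransform_eq (z := mirrorPoint e p) hħ hα (h₁.at hp)
    (h₂.at hp) (mirrorPointLift e p)]
  simp only [map_zero]
  have h := syzFormula_vertical (z := mirrorPoint e p) hα (h₁.at hp) (h₂.at hp)
    (mirrorPointLift e p) fun i => fromChart e (e.symm p.1) (v i)
  refine (congrArg _ h).trans ((homCoeff_smul_self (z := mirrorPoint e p) (h₁.at hp) (h₂.at hp)
    (mirrorPointLift e p) _).trans ?_)
  congr 1
  refine ((latticeEquiv he hs).tsum_eq _).symm.trans (tsum_congr fun m => ?_)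
  rw [α.family_apply he h₁ h₂ hp, mul_comm]
  congr 1
  change Complex.exp (2 * Real.pi * Complex.I
    * ((covector e (e.symm p.1) (icov m) (fromChart e (e.symm p.1) p.2) : ℝ) : ℂ)) = chi m p.2
  rw [chi, covector, ContinuousLinearMap.comp_apply, toChart_fromChart he hs]

theorem fourierSum_apply {f : (Fin n → ℤ) → Model n → Model n [⋀^Fin q]→L[ℝ] ℂ}
    (hf : DecayFamily U f) {p : Model n × Model n} (hp : p.1 ∈ U) (v : Fin q → Model n) :
    fourierSum f p v = ∑' m, chi m p.2 * f m p.1 v := by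
  have h := (hf.hasSum hp).mapL (ContinuousAlternatingMap.apply ℝ (Model n) ℂ v)
  exact h.tsum_eq.symm

/-- Both sides are of type `(0, q)` and agree on vertical vectors. Since `extForm` is a constant
linear map, smoothness and derivatives of the transform reduce to those of the Fourier series. -/
theorem localCoeff_syzTransform (hħ : ħ ≠ 0) {g : HessianMetric n B} {α : PathForm ξ₁ ξ₂ q}
    (hα : α ∈ rapidForms ξ₁ ξ₂ g q) (he : e ∈ atlas (Model n) B)
    (h₁ : IsLocalLift ξ₁.toFun e U η₁) (h₂ : IsLocalLift ξ₂.toFun e U η₂)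
    {p : Model n × Model n} (hp : p.1 ∈ U) :
    (syzTransform α).localCoeff e η₁ η₂ p = (-((ħ : ℂ) / (2 * Complex.I))) ^ q •
      extForm ħ n q (fourierSum (α.family e η₁ η₂) p) := by
  have hf := decayFamily_of_mem_rapidForms hα he h₁ h₂
  refine ContinuousAlternatingMap.toAlternatingMap_injective
    ((isConjLinear_localCoeff (isZeroQ_syzTransform hħ α) h₁ h₂ hp).ext hħ
      ((isConjLinear_extForm hħ _).smul _) fun v => ?_)
  refine (localCoeff_syzTransform_vertical hħ he h₁ h₂ hp (fiberSummable_of_mem hα _) v).trans ?_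
  rw [← fourierSum_apply hf hp, ← extForm_vertical (ħ := ħ)]
  rfl

theorem syzTransform_mem_dolbeaultForms (hħ : ħ ≠ 0) {g : HessianMetric n B}
    {α : PathForm ξ₁ ξ₂ q} (hα : α ∈ rapidForms ξ₁ ξ₂ g q) :
    syzTransform α ∈ dolbeaultForms ξ₁ ξ₂ q := by
  refine ⟨fun e he U η₁ η₂ h₁ h₂ => ?_, isZeroQ_syzTransform hħ α⟩
  have hf := decayFamily_of_mem_rapidForms hα he h₁ h₂
  exact (((extForm ħ n q).contDiff.comp_contDiffOn
    (hf.contDiffOn_fourierSum h₁.isOpen)).const_smul _).congr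
      fun p hp => localCoeff_syzTransform hħ hα he h₁ h₂ hp.1

end Coordinates

/-! ## The SYZ transform is a chain map -/

section ModelDolbeault

open ContinuousAlternatingMap

variable {n q : ℕ} {ħ : ℝ}

/-- The `(0,1)`-part of the covariant derivative in coordinates. -/
def dbarPart (ħ : ℝ) (a : Model n →L[ℝ] ℝ)
    (b : Model n × Model n → (Model n × Model n) [⋀^Fin q]→L[ℝ] ℂ) (p : Model n × Model n) :
    Model n × Model n →L[ℝ] (Model n × Model n) [⋀^Fin q]→L[ℝ] ℂ :=
  let θ : Model n × Model n →L[ℝ] ℂ := (2 * Real.pi * Complex.I : ℂ) •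
    (Complex.ofRealCLM.comp (a.comp (ContinuousLinearMap.snd ℝ _ _)))
  let D := fderiv ℝ b p + θ.smulRight (b p)
  (1 / 2 : ℂ) • (D + Complex.I • D.comp (complexStructure ħ (Model n)))

variable {a : Model n →L[ℝ] ℝ} {b : Model n × Model n → (Model n × Model n) [⋀^Fin q]→L[ℝ] ℂ}
  {p : Model n × Model n}

theorem dbarPart_apply (x : Model n × Model n) :
    dbarPart ħ a b p x = (1 / 2 : ℂ) • ((fderiv ℝ b p x + (2 * Real.pi * Complex.I * (a x.2 : ℝ) : ℂ) • b p)
      + Complex.I • (fderiv ℝ b p (complexStructure ħ (Model n) x)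
        + (2 * Real.pi * Complex.I * (a (complexStructure ħ (Model n) x).2 : ℝ) : ℂ) • b p)) := rfl

theorem complexStructure_sq (hħ : ħ ≠ 0) (x : Model n × Model n) :
    complexStructure ħ (Model n) (complexStructure ħ (Model n) x) = -x := by
  ext <;> simp [complexStructure_apply, hħ]

/-- The combination `D + i D ∘ J` is conjugate-linear in the direction because `J² = -1`. -/
theorem dbarPart_complexStructure (hħ : ħ ≠ 0) (x : Model n × Model n) :
    dbarPart ħ a b p (complexStructure ħ (Model n) x) = -Complex.I • dbarPart ħ a b p x := by
  have hI : Complex.I * Complex.I = -1 := Complex.I_mul_I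
  rw [dbarPart_apply, dbarPart_apply, complexStructure_sq hħ, smul_comm (-Complex.I)]
  congr 1
  simp only [map_neg, Prod.snd_neg, smul_add, smul_smul, neg_mul, Complex.ofReal_neg, mul_neg,
    neg_smul, smul_neg, hI, neg_neg, one_smul, ← mul_assoc]
  module

theorem IsConjLinear.dbarPart {x : Model n × Model n}
    (h0 : IsConjLinear ħ (b p).toAlternatingMap)
    (h : ∀ x, IsConjLinear ħ (fderiv ℝ b p x).toAlternatingMap) :
    IsConjLinear ħ (dbarPart ħ a b p x).toAlternatingMap := by
  intro w i
  have h1 : b p (Function.update w i (complexStructure ħ (Model n) (w i)))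
    = -Complex.I * b p w := h0 w i
  have h2 : ∀ x, fderiv ℝ b p x (Function.update w i (complexStructure ħ (Model n) (w i)))
    = -Complex.I * fderiv ℝ b p x w := fun x => h x w i
  change SYZ.dbarPart ħ a b p x _ = -Complex.I * SYZ.dbarPart ħ a b p x w
  rw [dbarPart_apply]
  simp only [ContinuousAlternatingMap.smul_apply, ContinuousAlternatingMap.add_apply, h1, h2,
    smul_eq_mul]
  ring

variable {U : Set (Model n)} {f : (Fin n → ℤ) → Model n → Model n [⋀^Fin q]→L[ℝ] ℂ} {c : ℂ}

theorem hasFDerivAt_extForm_fourierSum (hU : IsOpen U) (hf : DecayFamily U f) (hp : p.1 ∈ U)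
    (hb : ∀ p : Model n × Model n, p.1 ∈ U → b p = c • extForm ħ n q (fourierSum f p)) :
    HasFDerivAt b (c • (extForm ħ n q).comp (fourierSum (twist f) p)) p := by
  have h1 := ((extForm ħ n q).hasFDerivAt.comp p (hf.hasFDerivAt_fourierSum hU hp)).const_smul c
  refine h1.congr_of_eventuallyEq ?_
  filter_upwards [continuousAt_fst.eventually (hU.mem_nhds hp)] with p' hp'
  exact hb p' hp'

theorem isConjLinear_dbarPart (hħ : ħ ≠ 0) (hU : IsOpen U) (hf : DecayFamily U f) (hp : p.1 ∈ U)
    (hb : ∀ p : Model n × Model n, p.1 ∈ U → b p = c • extForm ħ n q (fourierSum f p)) :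
    IsConjLinear ħ (alternatizeUncurryFin (dbarPart ħ a b p)).toAlternatingMap := by
  refine isConjLinear_alternatizeUncurryFin (dbarPart_complexStructure hħ) fun x =>
    IsConjLinear.dbarPart ?_ fun x => ?_
  · rw [hb p hp]
    exact (isConjLinear_extForm hħ _).smul c
  · rw [(hasFDerivAt_extForm_fourierSum hU hf hp hb).fderiv]
    exact (isConjLinear_extForm hħ (fourierSum (twist f) p x)).smul c

/-- The analytic heart of the chain map property. Since `J(0, x) = (ħx, 0)`, the operator combines
the fibre derivative `2πi(m, x)` and the connection term `2πi(η, x)` with `iħ` times the base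
derivative; extracting `iħ/2 = -ħ/(2i)` leaves the Witten derivative of each coefficient. -/
theorem dbarPart_vertical (hħ : ħ ≠ 0) (hU : IsOpen U) (hf : DecayFamily U f) (hp : p.1 ∈ U)
    (hb : ∀ p : Model n × Model n, p.1 ∈ U → b p = c • extForm ħ n q (fourierSum f p))
    {η : Model n → (Model n →L[ℝ] ℝ)} (hη : ContDiffOn ℝ ∞ η U) (x : Model n)
    (v : Fin q → Model n) :
    dbarPart ħ (η p.1) b p (0, x) (fun i => (0, v i)) = ((c * -((ħ : ℂ) / (2 * Complex.I))) •
      fourierSum (fun m u => fderiv ℝ (f m) u + (wittenForm ħ (η u + icov m)).smulRight (f m u)) p)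
        x v := by
  have hbv : b p (fun i => (0, v i)) = c * fourierSum f p v := by
    rw [hb p hp, ← extForm_vertical (ħ := ħ)]
    rfl
  have hdv : ∀ y, fderiv ℝ b p y (fun i => (0, v i)) = c * fourierSum (twist f) p y v := by
    intro y
    rw [(hasFDerivAt_extForm_fourierSum hU hf hp hb).fderiv, ← extForm_vertical (ħ := ħ)]
    rfl
  have hs0 : HasSum (fun m => chi m p.2 * f m p.1 v) (fourierSum f p v) :=
    (hf.hasSum hp).mapL (ContinuousAlternatingMap.apply ℝ (Model n) ℂ v)
  have hs1 : ∀ y, HasSum (fun m => chi m p.2 * (fderiv ℝ (f m) p.1 y.1 v + dchi m y * f m p.1 v))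
      (fourierSum (twist f) p y v) :=
    fun y => ((hf.twisted hU).hasSum hp).mapL
      ((ContinuousAlternatingMap.apply ℝ (Model n) ℂ v).comp (ContinuousLinearMap.apply ℝ _ y))
  have hs2 : HasSum (fun m => chi m p.2 * (fderiv ℝ (f m) p.1 x v
      + wittenForm ħ (η p.1 + icov m) x * f m p.1 v)) (fourierSum (fun m u => fderiv ℝ (f m) u
        + (wittenForm ħ (η u + icov m)).smulRight (f m u)) p x v) :=
    ((hf.witten hU ħ hη).hasSum hp).mapL
      ((ContinuousAlternatingMap.apply ℝ (Model n) ℂ v).comp (ContinuousLinearMap.apply ℝ _ x))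
  have hħ' : (ħ : ℂ) ≠ 0 := by exact_mod_cast hħ
  have hI : -((ħ : ℂ) / (2 * Complex.I)) = ħ * Complex.I / 2 := by
    have hI2 := Complex.I_mul_I
    field_simp
    rw [pow_two, hI2]
  have key : (1 / 2 : ℂ) * ((fourierSum (twist f) p (0, x) v
      + 2 * Real.pi * Complex.I * (η p.1 x : ℝ) * fourierSum f p v)
      + Complex.I * fourierSum (twist f) p (ħ • x, 0) v)
      = -((ħ : ℂ) / (2 * Complex.I)) * fourierSum (fun m u => fderiv ℝ (f m) u
        + (wittenForm ħ (η u + icov m)).smulRight (f m u)) p x v := by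
    -- The identity of series is checked mode by mode.
    refine HasSum.unique ((((hs1 (0, x)).add (hs0.mul_left _)).add
      ((hs1 (ħ • x, 0)).mul_left _)).mul_left _) ?_
    convert hs2.mul_left (-((ħ : ℂ) / (2 * Complex.I))) using 1
    funext m
    have h1 : fderiv ℝ (f m) p.1 (ħ • x) v = ħ * fderiv ℝ (f m) p.1 x v := by
      rw [_root_.map_smul]
      rfl
    have h2 : fderiv ℝ (f m) p.1 0 v = 0 := by
      rw [_root_.map_zero]
      rfl
    rw [h1, h2, dchi_apply, dchi_apply, wittenForm_apply, hI]
    simp only [_root_.add_apply, _root_.map_zero]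
    push_cast
    field_simp
    ring
  rw [dbarPart_apply]
  simp only [ContinuousAlternatingMap.smul_apply, ContinuousAlternatingMap.add_apply, hbv, hdv,
    smul_eq_mul, complexStructure_apply, smul_zero, neg_zero, _root_.map_zero, Complex.ofReal_zero]
  refine Eq.trans ?_ ((congrArg (c * ·) key).trans (mul_assoc c _ _).symm)
  ring

end ModelDolbeault

/-! ### Comparison of the two differentials on the manifold -/

section ChainMap

open ContinuousAlternatingMap

variable {n : ℕ} {B : Type*} [TopologicalSpace B] [ChartedSpace (Model n) B] {ħ : ℝ}
  {ξ₁ ξ₂ : LagrangianSection n B ħ} {q : ℕ} {e : OpenPartialHomeomorph B (Model n)}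
  {U : Set (Model n)} {η₁ η₂ : Model n → (Model n →L[ℝ] ℝ)}
  [HasGroupoid B (integralAffineGroupoid n)]

/-- Variant of `family_apply` at a given point `x`, which avoids transport along `e.symm (e x) = x`.
-/
theorem PathForm.family_apply_of_mem_source (α : PathForm ξ₁ ξ₂ q) (he : e ∈ atlas (Model n) B)
    {x : B} (hx : x ∈ e.source) {y₁ : Lift (ξ₁.toFun x)} {y₂ : Lift (ξ₂.toFun x)}
    (hy₁ : y₁.1 = covector e x (η₁ (e x))) (hy₂ : y₂.1 = covector e x (η₂ (e x)))
    (m : Fin n → ℤ) (v : Fin q → Tan n x) :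
    α.family e η₁ η₂ m (e x) (fun i => toChart e x (v i))
      = α.onFiber y₁ y₂ (latticeEquiv he hx m) v := by
  rw [PathForm.family, α.localRep_eq he (e.map_source hx) (pathOf y₁ y₂ (latticeEquiv he hx m))
    (e.left_inv hx).symm ?_]
  · change α.onFiber y₁ y₂ (latticeEquiv he hx m)
      (fun i => fromChart e x (toChart e x (v i))) = _
    simp only [fromChart_toChart he hx]
  · change (y₂.1 - y₁.1 + covector e x (icov m)).comp (fromChart e x) = _
    rw [hy₁, hy₂, ← covector_sub, ← covector_add, covector_comp_fromChart he hx]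

omit [HasGroupoid B (integralAffineGroupoid n)] in
theorem exists_isLocalLift_liftAt (ξ₁ ξ₂ : LagrangianSection n B ħ) (x : B) :
    ∃ W, chartAt (Model n) x x ∈ W ∧
      IsLocalLift ξ₁.toFun (chartAt (Model n) x) W (ξ₁.liftAt x) ∧
      IsLocalLift ξ₂.toFun (chartAt (Model n) x) W (ξ₂.liftAt x) := by
  obtain ⟨U₁, hu₁, h₁⟩ := ξ₁.liftAt_spec x
  obtain ⟨U₂, hu₂, h₂⟩ := ξ₂.liftAt_spec x
  exact ⟨U₁ ∩ U₂, ⟨hu₁, hu₂⟩, h₁.mono (h₁.isOpen.inter h₂.isOpen) Set.inter_subset_left,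
    h₂.mono (h₁.isOpen.inter h₂.isOpen) Set.inter_subset_right⟩

theorem dolbeaultD_syzTransform (hħ : ħ ≠ 0) {g : HessianMetric n B} {α : PathForm ξ₁ ξ₂ q}
    (hα : α ∈ rapidForms ξ₁ ξ₂ g q) :
    dolbeaultD (syzTransform α) = syzTransform (wittenD α) := by
  funext z
  let c := chartAt (Model n) z.base
  have hc : c ∈ atlas (Model n) B := chart_mem_atlas _ _
  have hx : z.base ∈ c.source := mem_chart_source _ _
  obtain ⟨W, hW, h₁, h₂⟩ := exists_isLocalLift_liftAt ξ₁ ξ₂ z.base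
  let y₁ : Lift (ξ₁.toFun z.base) := ⟨_, ξ₁.mk_liftAt z.base⟩
  let y₂ : Lift (ξ₂.toFun z.base) := ⟨_, ξ₂.mk_liftAt z.base⟩
  let w : MirrorLift z.fib := ⟨z.fib.out, Quotient.out_eq _⟩
  let p : Model n × Model n := (c z.base, toChart c z.base w.1)
  have hf := decayFamily_of_mem_rapidForms hα hc h₁ h₂
  have hη := h₂.smooth.sub h₁.smooth
  have hsum := fiberSummable_of_mem (wittenD_mem_rapidForms hα) z.base
  have hb : ∀ p : Model n × Model n, p.1 ∈ W →
      (syzTransform α).localCoeff c (ξ₁.liftAt z.base) (ξ₂.liftAt z.base) p = _ :=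
    fun p hp => localCoeff_syzTransform hħ hα hc h₁ h₂ hp
  rw [syzTransform_eq hħ hsum y₁ y₂ w]
  -- Both forms are of type `(0, q + 1)`, so only vertical vectors need to be compared, and there
  -- `dbarPart_vertical` applies under the alternatization.
  refine IsConjLinear.ext hħ (isConjLinear_tensorFrame (IsConjLinear.compLinearMap
    (isConjLinear_dbarPart hħ h₁.isOpen hf (p := p) hW hb) (toChart c z.base).toLinearMap) _)
    (isConjLinear_syzFormula hħ _ z y₁ y₂ w) fun v => ?_
  refine Eq.trans ?_ (syzFormula_vertical hsum y₁ y₂ w v).symm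
  refine (tensorFrame_apply _ _ _).trans ?_
  congr 1
  have hG : ∀ m, alternatizeUncurryFin (fderiv ℝ (α.family c (ξ₁.liftAt z.base)
      (ξ₂.liftAt z.base) m) p.1 + (wittenForm ħ ((ξ₂.liftAt z.base p.1 - ξ₁.liftAt z.base p.1)
        + icov m)).smulRight (α.family c (ξ₁.liftAt z.base) (ξ₂.liftAt z.base) m p.1))
      = (wittenD α).family c (ξ₁.liftAt z.base) (ξ₂.liftAt z.base) m p.1 := fun m =>
    (wittenD_localRep hα.1 hc (h₁.isBranch hc h₂ m) hW).symm
  have hs := ((hf.witten h₁.isOpen ħ hη).hasSum (p := p) hW).mapL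
    ((ContinuousAlternatingMap.apply ℝ (Model n) ℂ fun i => toChart c z.base (v i)).comp
      (alternatizeUncurryFinCLM (n := q) ℝ (Model n) ℂ))
  have h1 := alternatizeUncurryFin_vertical _ _
    (dbarPart_vertical hħ h₁.isOpen hf (p := p) hW hb hη) fun i => toChart c z.base (v i)
  rw [alternatizeUncurryFin_smul] at h1
  have hv : (fun i => (toChart c z.base 0, toChart c z.base (v i)))
      = fun i => ((0 : Model n), toChart c z.base (v i)) :=
    funext fun i => by rw [_root_.map_zero]
  refine (congrArg (alternatizeUncurryFin
    (dbarPart ħ (ξ₂.liftAt z.base p.1 - ξ₁.liftAt z.base p.1)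
      ((syzTransform α).localCoeff c (ξ₁.liftAt z.base) (ξ₂.liftAt z.base)) p)) hv).trans
    (h1.trans ?_)
  rw [pow_succ]
  refine congrArg (_ * ·) (hs.tsum_eq.symm.trans ?_)
  refine Eq.trans (tsum_congr fun m => ?_) ((latticeEquiv hc hx).tsum_eq _)
  rw [← (wittenD α).family_apply_of_mem_source hc hx (y₁ := y₁) (y₂ := y₂) rfl rfl]
  refine (congrArg (fun ψ : Model n [⋀^Fin (q + 1)]→L[ℝ] ℂ => ψ fun i => toChart c z.base (v i))
    ((alternatizeUncurryFin_smul (chi m p.2) _).trans (congrArg (chi m p.2 • ·) (hG m)))).trans ?_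
  exact mul_comm _ _

end ChainMap

/-! ## The SYZ transform is bijective -/

section Bijective

variable {n : ℕ} {B : Type*} [TopologicalSpace B] [ChartedSpace (Model n) B] {ħ : ℝ}
  {ξ₁ ξ₂ : LagrangianSection n B ħ} {q : ℕ} {e : OpenPartialHomeomorph B (Model n)}
  {U : Set (Model n)} {η₁ η₂ : Model n → (Model n →L[ℝ] ℝ)}

theorem IsConjLinear.add {T W : Type*} [AddCommGroup T] [Module ℝ T] [TopologicalSpace T]
    [IsTopologicalAddGroup T] [ContinuousSMul ℝ T] [AddCommGroup W] [Module ℂ W]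
    {β β' : (T × T) [⋀^Fin q]→ₗ[ℝ] W} (hβ : IsConjLinear ħ β) (hβ' : IsConjLinear ħ β') :
    IsConjLinear ħ (β + β') := by
  intro w i
  rw [AlternatingMap.add_apply, AlternatingMap.add_apply, hβ, hβ', smul_add]

theorem PathForm.FiberSummable.add {α α' : PathForm ξ₁ ξ₂ q} {x : B} (hα : α.FiberSummable x)
    (hα' : α'.FiberSummable x) : (α + α').FiberSummable x :=
  fun y₁ y₂ v => (hα y₁ y₂ v).add (hα' y₁ y₂ v)

theorem PathForm.FiberSummable.smul (c : ℂ) {α : PathForm ξ₁ ξ₂ q} {x : B}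
    (hα : α.FiberSummable x) : (c • α).FiberSummable x :=
  fun y₁ y₂ v => (hα y₁ y₂ v).mul_left c

/-- The element of `Λ_x^*` that corresponds to a path when lifts of its end points are given. -/
def PathSpace.index (γ : PathSpace ξ₁ ξ₂) (y₁ : Lift (ξ₁.toFun γ.base))
    (y₂ : Lift (ξ₂.toFun γ.base)) : dualLattice n γ.base :=
  ⟨γ.velocity - (y₂.1 - y₁.1), by
    rw [← QuotientAddGroup.eq_zero_iff, QuotientAddGroup.mk_sub, QuotientAddGroup.mk_sub, y₁.2,
      y₂.2, ← γ.endpoint]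
    abel⟩

theorem PathForm.onFiber_index (α : PathForm ξ₁ ξ₂ q) (γ : PathSpace ξ₁ ξ₂)
    (y₁ : Lift (ξ₁.toFun γ.base)) (y₂ : Lift (ξ₂.toFun γ.base)) (v : Fin q → Tan n γ.base) :
    α.onFiber y₁ y₂ (γ.index y₁ y₂) v = α γ v :=
  α.apply_congr _ _ (add_sub_cancel _ _) v

theorem index_pathOf {x : B} (y₁ : Lift (ξ₁.toFun x)) (y₂ : Lift (ξ₂.toFun x))
    (m : dualLattice n x) : (pathOf y₁ y₂ m).index y₁ y₂ = m :=
  Subtype.ext (add_sub_cancel_left _ _)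

/-- The point of `X̌` and its lifts are free up to propositional equality, so the coefficients can
be compared at `y̌` and `y̌ + k`, and at points not written as `e.symm u`. -/
theorem localCoeff_eq (β : MirrorForm ξ₁ ξ₂ q) {p : Model n × Model n} {x : B}
    {φ : MirrorFiber n x} (hx : x = e.symm p.1) {y₁ : Lift (ξ₁.toFun x)} {y₂ : Lift (ξ₂.toFun x)}
    {w : MirrorLift φ} (hy₁ : y₁.1 = covector e x (η₁ p.1)) (hy₂ : y₂.1 = covector e x (η₂ p.1))
    (hw : w.1 = fromChart e x p.2) (ws : Fin q → Model n × Model n) :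
    β.localCoeff e η₁ η₂ p ws = homCoeff (z := ⟨x, φ⟩) y₁ y₂ w
      (β ⟨x, φ⟩ fun i => (fromChart e x (ws i).1, fromChart e x (ws i).2)) := by
  obtain ⟨y₁, h₁⟩ := y₁
  obtain ⟨y₂, h₂⟩ := y₂
  obtain ⟨w, hwφ⟩ := w
  simp only at hy₁ hy₂ hw
  subst hx hy₁ hy₂ hw hwφ
  rw [MirrorForm.localCoeff, dif_pos ⟨h₁, h₂⟩]
  rfl

/-- The restriction of the coefficient form to vertical vectors. -/
def MirrorForm.verticalCoeff (β : MirrorForm ξ₁ ξ₂ q) (e : OpenPartialHomeomorph B (Model n))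
    (η₁ η₂ : Model n → (Model n →L[ℝ] ℝ)) (p : Model n × Model n) : Model n [⋀^Fin q]→L[ℝ] ℂ :=
  (β.localCoeff e η₁ η₂ p).compContinuousLinearMap (ContinuousLinearMap.inr ℝ (Model n) (Model n))

variable [HasGroupoid B (integralAffineGroupoid n)]

theorem syzTransform_add (hħ : ħ ≠ 0) {α α' : PathForm ξ₁ ξ₂ q} (hα : ∀ x, α.FiberSummable x)
    (hα' : ∀ x, α'.FiberSummable x) :
    syzTransform (α + α') = syzTransform α + syzTransform α' := by
  funext z
  refine (isConjLinear_syzFormula hħ _ z _ _ _).ext hħ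
    ((isConjLinear_syzFormula hħ _ z _ _ _).add (isConjLinear_syzFormula hħ _ z _ _ _)) fun v => ?_
  refine (syzFormula_vertical ((hα z.base).add (hα' z.base)) _ _ _ v).trans (Eq.trans ?_
    (congrArg₂ (· + ·) (syzFormula_vertical (hα z.base) _ _ _ v)
      (syzFormula_vertical (hα' z.base) _ _ _ v)).symm)
  rw [← add_smul, ← mul_add, ← ((hα z.base).summable_mul _ _ _ v).tsum_add
    ((hα' z.base).summable_mul _ _ _ v)]
  congr 2
  exact tsum_congr fun m => add_mul _ _ _

theorem syzTransform_smul (hħ : ħ ≠ 0) (c : ℂ) {α : PathForm ξ₁ ξ₂ q}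
    (hα : ∀ x, α.FiberSummable x) : syzTransform (c • α) = c • syzTransform α := by
  funext z
  refine (isConjLinear_syzFormula hħ _ z _ _ _).ext hħ
    ((isConjLinear_syzFormula hħ _ z _ _ _).smul c) fun v => ?_
  refine (syzFormula_vertical ((hα z.base).smul c) _ _ _ v).trans (Eq.trans ?_
    (congrArg (c • ·) (syzFormula_vertical (hα z.base) _ _ _ v)).symm)
  rw [smul_smul, mul_left_comm]
  congr 2
  exact (tsum_congr fun m => mul_assoc c (α.onFiber _ _ m v) _).trans tsum_mul_left

theorem scale_ne_zero (hħ : ħ ≠ 0) (q : ℕ) : (-((ħ : ℂ) / (2 * Complex.I))) ^ q ≠ 0 := by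
  have h : (ħ : ℂ) ≠ 0 := by exact_mod_cast hħ
  exact pow_ne_zero _ (neg_ne_zero.2 (div_ne_zero h (mul_ne_zero two_ne_zero Complex.I_ne_zero)))

/-- For fixed `x`, the vanishing holds for every `y̌`, and an absolutely convergent Fourier series
determines its coefficients. -/
theorem eq_zero_of_syzTransform_eq_zero (hħ : ħ ≠ 0) {g : HessianMetric n B}
    {α : PathForm ξ₁ ξ₂ q} (hα : α ∈ rapidForms ξ₁ ξ₂ g q) (h : syzTransform α = 0) : α = 0 := by
  funext γ
  ext v
  have hc := chart_mem_atlas (Model n) γ.base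
  have hx := mem_chart_source (Model n) γ.base
  obtain ⟨W, hW, h₁, h₂⟩ := exists_isLocalLift_liftAt ξ₁ ξ₂ γ.base
  rw [← α.onFiber_index γ ⟨_, ξ₁.mk_liftAt γ.base⟩ ⟨_, ξ₂.mk_liftAt γ.base⟩,
    ← (latticeEquiv hc hx).apply_symm_apply (γ.index _ _),
    ← α.family_apply_of_mem_source hc hx rfl rfl]
  have hf := decayFamily_of_mem_rapidForms hα hc h₁ h₂
  have hsum := summable_family_apply hf hW
    fun i => toChart (chartAt (Model n) γ.base) γ.base (v i)
  refine eq_zero_of_tsum_chi_eq_zero hsum.norm (fun y => ?_) _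
  have h3 := localCoeff_syzTransform_vertical hħ hc h₁ h₂
    (p := (chartAt (Model n) γ.base γ.base, y)) hW (fiberSummable_of_mem hα _)
    fun i => toChart (chartAt (Model n) γ.base) γ.base (v i)
  rw [h] at h3
  have h4 : (0 : MirrorForm ξ₁ ξ₂ q).localCoeff (chartAt (Model n) γ.base) (ξ₁.liftAt γ.base)
      (ξ₂.liftAt γ.base) (chartAt (Model n) γ.base γ.base, y)
      (fun i => (0, toChart (chartAt (Model n) γ.base) γ.base (v i))) = 0 := by
    rw [localCoeff_apply _ h₁ h₂ hW]
    exact map_zero _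
  rw [h4] at h3
  exact (mul_eq_zero.1 h3.symm).resolve_left (scale_ne_zero hħ q)

/-- The points `y̌` and `y̌ + k` are lifts of the same point of the torus, and the coefficient with
respect to the frame is independent of that lift by `homCoeff_eq`. -/
theorem verticalCoeff_periodicSmooth {β : MirrorForm ξ₁ ξ₂ q} (hβ : β ∈ dolbeaultForms ξ₁ ξ₂ q)
    (he : e ∈ atlas (Model n) B) (h₁ : IsLocalLift ξ₁.toFun e U η₁)
    (h₂ : IsLocalLift ξ₂.toFun e U η₂) : PeriodicSmooth U (β.verticalCoeff e η₁ η₂) := by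
  refine ⟨(ContinuousAlternatingMap.compContinuousLinearMapCLM (F := ℂ) (ι := Fin q)
    (ContinuousLinearMap.inr ℝ (Model n) (Model n))).contDiff.comp_contDiffOn
      (hβ.1 e he U η₁ η₂ h₁ h₂), fun u hu y k => ?_⟩
  have hs := e.map_target (h₁.subset hu)
  have hk : fromChart e (e.symm u) (fun j => (k j : ℝ)) ∈ lattice n (e.symm u) :=
    (mem_lattice_iff he hs).2 ⟨k, toChart_fromChart he hs _⟩
  have hz : (QuotientAddGroup.mk (fromChart e (e.symm u) (y + fun j => (k j : ℝ))) :
      MirrorFiber n (e.symm u)) = QuotientAddGroup.mk (fromChart e (e.symm u) y) := by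
    rw [QuotientAddGroup.eq, map_add, neg_add, add_right_comm, neg_add_cancel, zero_add]
    exact neg_mem hk
  ext v
  change β.localCoeff e η₁ η₂ (u, y + fun j => (k j : ℝ)) (fun i => (0, v i))
    = β.localCoeff e η₁ η₂ (u, y) (fun i => (0, v i))
  rw [localCoeff_apply β h₁ h₂ (p := (u, y)) hu,
    localCoeff_eq β (p := (u, y + fun j => (k j : ℝ))) rfl
      (φ := (mirrorPoint e (u, y)).fib) (y₁ := h₁.at hu) (y₂ := h₂.at hu)
      (w := ⟨fromChart e (e.symm u) (y + fun j => (k j : ℝ)), hz⟩) rfl rfl rfl]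
  exact LinearMap.congr_fun (homCoeff_eq (z := mirrorPoint e (u, y)) _ _ _ _) _

theorem PeriodicSmooth.torusCoeff_apply {h : Model n × Model n → Model n [⋀^Fin q]→L[ℝ] ℂ}
    (hU : IsOpen U) (hh : PeriodicSmooth U h) {u : Model n} (hu : u ∈ U) (m : Fin n → ℤ)
    (v : Fin q → Model n) :
    torusCoeff h m u v = ∫ y in unitBox 0, chi (-m) y • h (u, y) v := by
  have hint := integrable_unitBox 0 ((continuous_chi (-m)).smul (hh.continuous hU hu))
  exact (ContinuousLinearMap.integral_comp_comm
    (ContinuousAlternatingMap.apply ℝ (Model n) ℂ v) hint).symm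

theorem PeriodicSmooth.hasSum_torusCoeff {h : Model n × Model n → Model n [⋀^Fin q]→L[ℝ] ℂ}
    (hU : IsOpen U) (hh : PeriodicSmooth U h) {u : Model n} (hu : u ∈ U) (y : Model n)
    (v : Fin q → Model n) :
    HasSum (fun m => chi m y * torusCoeff h m u v) (h (u, y) v) := by
  have h1 : IsPeriodic fun y => h (u, y) v := fun y k => by
    exact congrArg (fun ψ : Model n [⋀^Fin q]→L[ℝ] ℂ => ψ v) (hh.periodic u hu y k)
  have h2 : Continuous fun y => h (u, y) v :=
    (ContinuousAlternatingMap.apply ℝ (Model n) ℂ v).continuous.comp (hh.continuous hU hu)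
  have h3 := summable_family_apply (hh.decayFamily hU) hu v
  simp only [hh.torusCoeff_apply hU hu] at h3 ⊢
  exact h1.hasSum_of_summable h2 h3 y

/-- The inverse of the SYZ transform: fibrewise Fourier coefficients. -/
def inverseSyz (β : MirrorForm ξ₁ ξ₂ q) : PathForm ξ₁ ξ₂ q := fun γ =>
  ((-((ħ : ℂ) / (2 * Complex.I))) ^ q)⁻¹ • (torusCoeff (β.verticalCoeff
    (chartAt (Model n) γ.base) (ξ₁.liftAt γ.base) (ξ₂.liftAt γ.base))
      ((latticeEquiv (chart_mem_atlas (Model n) γ.base) (mem_chart_source (Model n) γ.base)).symm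
        (γ.index ⟨_, ξ₁.mk_liftAt γ.base⟩ ⟨_, ξ₂.mk_liftAt γ.base⟩))
      (chartAt (Model n) γ.base γ.base)).compContinuousLinearMap
        (toChart (chartAt (Model n) γ.base) γ.base)

theorem inverseSyz_onFiber (β : MirrorForm ξ₁ ξ₂ q) (x : B) (m : Fin n → ℤ)
    (v : Fin q → Tan n x) :
    (inverseSyz β).onFiber ⟨_, ξ₁.mk_liftAt x⟩ ⟨_, ξ₂.mk_liftAt x⟩
      (latticeEquiv (chart_mem_atlas (Model n) x) (mem_chart_source (Model n) x) m) v
      = ((-((ħ : ℂ) / (2 * Complex.I))) ^ q)⁻¹ * torusCoeff (β.verticalCoeff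
        (chartAt (Model n) x) (ξ₁.liftAt x) (ξ₂.liftAt x)) m (chartAt (Model n) x x)
          (fun i => toChart (chartAt (Model n) x) x (v i)) := by
  have h : ∀ m' : dualLattice n x,
      (inverseSyz β).onFiber ⟨_, ξ₁.mk_liftAt x⟩ ⟨_, ξ₂.mk_liftAt x⟩ m' v
      = ((-((ħ : ℂ) / (2 * Complex.I))) ^ q)⁻¹ * torusCoeff (β.verticalCoeff
        (chartAt (Model n) x) (ξ₁.liftAt x) (ξ₂.liftAt x)) ((latticeEquiv
          (chart_mem_atlas (Model n) x) (mem_chart_source (Model n) x)).symm m')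
            (chartAt (Model n) x x) (fun i => toChart (chartAt (Model n) x) x (v i)) := fun m' =>
    congrArg (fun k => ((-((ħ : ℂ) / (2 * Complex.I))) ^ q)⁻¹ * torusCoeff (β.verticalCoeff
      (chartAt (Model n) x) (ξ₁.liftAt x) (ξ₂.liftAt x)) ((latticeEquiv
        (chart_mem_atlas (Model n) x) (mem_chart_source (Model n) x)).symm k)
          (chartAt (Model n) x x) (fun i => toChart (chartAt (Model n) x) x (v i)))
      (index_pathOf ⟨_, ξ₁.mk_liftAt x⟩ ⟨_, ξ₂.mk_liftAt x⟩ m')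
  rw [h, Equiv.symm_apply_apply]

theorem inverseSyz_fiberSummable {β : MirrorForm ξ₁ ξ₂ q} (hβ : β ∈ dolbeaultForms ξ₁ ξ₂ q)
    (x : B) : (inverseSyz β).FiberSummable x := by
  obtain ⟨W, hW, h₁, h₂⟩ := exists_isLocalLift_liftAt ξ₁ ξ₂ x
  have hc := chart_mem_atlas (Model n) x
  have hh := (verticalCoeff_periodicSmooth hβ hc h₁ h₂).decayFamily h₁.isOpen
  refine PathForm.fiberSummable_of_lifts _ ⟨_, ξ₁.mk_liftAt x⟩ ⟨_, ξ₂.mk_liftAt x⟩ fun v => ?_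
  rw [← (latticeEquiv hc (mem_chart_source (Model n) x)).summable_iff]
  refine ((summable_family_apply hh hW fun i =>
    toChart (chartAt (Model n) x) x (v i)).mul_left
      ((-((ħ : ℂ) / (2 * Complex.I))) ^ q)⁻¹).congr fun m => ?_
  exact (inverseSyz_onFiber β x m v).symm

/-- At each point this is Fourier inversion for the vertical coefficients in the preferred chart;
forms of type `(0, q)` with equal vertical values coincide. -/
theorem syzTransform_inverseSyz (hħ : ħ ≠ 0) {β : MirrorForm ξ₁ ξ₂ q}
    (hβ : β ∈ dolbeaultForms ξ₁ ξ₂ q) : syzTransform (inverseSyz β) = β := by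
  funext z
  obtain ⟨W, hW, h₁, h₂⟩ := exists_isLocalLift_liftAt ξ₁ ξ₂ z.base
  have hc := chart_mem_atlas (Model n) z.base
  have hx := mem_chart_source (Model n) z.base
  have hh := verticalCoeff_periodicSmooth hβ hc h₁ h₂
  let w : MirrorLift z.fib := ⟨z.fib.out, Quotient.out_eq _⟩
  have hsum := inverseSyz_fiberSummable hβ z.base
  rw [syzTransform_eq hħ hsum ⟨_, ξ₁.mk_liftAt z.base⟩ ⟨_, ξ₂.mk_liftAt z.base⟩ w]
  refine (isConjLinear_syzFormula hħ _ z _ _ _).ext hħ (hβ.2 z) fun v => ?_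
  refine (syzFormula_vertical hsum _ _ _ v).trans ?_
  refine Eq.trans (congrArg (fun c : ℂ => c • homFrame _ _ w) ?_)
    (homCoeff_smul_homFrame ⟨_, ξ₁.mk_liftAt z.base⟩ ⟨_, ξ₂.mk_liftAt z.base⟩ w
      (β z fun i => (0, v i)))
  have h3 := localCoeff_eq β (e := chartAt (Model n) z.base) (η₁ := ξ₁.liftAt z.base)
    (η₂ := ξ₂.liftAt z.base) (p := (chartAt (Model n) z.base z.base,
      toChart (chartAt (Model n) z.base) z.base w.1)) (φ := z.fib)
    (OpenPartialHomeomorph.left_inv _ hx).symm (y₁ := ⟨_, ξ₁.mk_liftAt z.base⟩)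
    (y₂ := ⟨_, ξ₂.mk_liftAt z.base⟩) (w := w) rfl rfl (fromChart_toChart hc hx _).symm
    fun i => (0, toChart (chartAt (Model n) z.base) z.base (v i))
  simp only [map_zero, fromChart_toChart hc hx] at h3
  refine Eq.trans ?_ h3
  have h4 := (hh.hasSum_torusCoeff h₁.isOpen hW
    (toChart (chartAt (Model n) z.base) z.base w.1)
      fun i => toChart (chartAt (Model n) z.base) z.base (v i)).tsum_eq
  refine Eq.trans ?_ h4
  rw [← tsum_mul_left, ← (latticeEquiv hc hx).tsum_eq]
  refine tsum_congr fun m => ?_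
  rw [inverseSyz_onFiber, ← mul_assoc, mul_inv_cancel_left₀ (scale_ne_zero hħ q), mul_comm]
  rfl

/-- `inverseSyz` uses chart and lifts varying with the point, so its regularity is not visible from
the definition. In a fixed chart, the identity `syzTransform_inverseSyz` presents `β` as a Fourier
series in its coefficients; their uniqueness identifies them with `torusCoeff`, up to the constant,
and these decay. -/
theorem inverseSyz_mem_rapidForms (hħ : ħ ≠ 0) (g : HessianMetric n B) {β : MirrorForm ξ₁ ξ₂ q}
    (hβ : β ∈ dolbeaultForms ξ₁ ξ₂ q) : inverseSyz β ∈ rapidForms ξ₁ ξ₂ g q := by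
  refine (mem_rapidForms_iff g).2 fun e he U η₁ η₂ h₁ h₂ => ?_
  have hh := verticalCoeff_periodicSmooth hβ he h₁ h₂
  refine ((hh.decayFamily h₁.isOpen).clm_const h₁.isOpen
    (((-((ħ : ℂ) / (2 * Complex.I))) ^ q)⁻¹ •
      ContinuousLinearMap.id ℝ (Model n [⋀^Fin q]→L[ℝ] ℂ))).congr h₁.isOpen fun m u hu => ?_
  have hs := e.map_target (h₁.subset hu)
  have hsum := inverseSyz_fiberSummable hβ (e.symm u)
  ext v
  have hfam : Summable fun m => (inverseSyz β).family e η₁ η₂ m u v := by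
    simp only [PathForm.family_apply _ he h₁ h₂ hu]
    exact (latticeEquiv he hs).summable_iff.2 (hsum _ _ _)
  have h1 : ∀ y, β.verticalCoeff e η₁ η₂ (u, y) v = (-((ħ : ℂ) / (2 * Complex.I))) ^ q
      * ∑' m, chi m y • (inverseSyz β).family e η₁ η₂ m u v := by
    intro y
    have h2 := localCoeff_syzTransform_vertical hħ he h₁ h₂ (p := (u, y)) hu hsum v
    rw [syzTransform_inverseSyz hħ hβ] at h2
    exact h2
  change _ = ((-((ħ : ℂ) / (2 * Complex.I))) ^ q)⁻¹ * torusCoeff (β.verticalCoeff e η₁ η₂) m u v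
  rw [hh.torusCoeff_apply h₁.isOpen hu]
  simp only [h1, smul_eq_mul, mul_left_comm (chi (-m) _)]
  rw [MeasureTheory.integral_const_mul, inv_mul_cancel_left₀ (scale_ne_zero hħ q)]
  exact (setIntegral_tsum_chi hfam.norm m).symm

end Bijective

/-! ## The isomorphism of complexes -/

section Complexes

variable {n : ℕ} {B : Type*} [TopologicalSpace B] [ChartedSpace (Model n) B]
  [HasGroupoid B (integralAffineGroupoid n)] {ħ : ℝ} (ξ₁ ξ₂ : LagrangianSection n B ħ)
  (g : HessianMetric n B)

/-- The Witten differential on rapidly decaying forms. -/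
def wittenMap (q : ℕ) : rapidForms ξ₁ ξ₂ g q →ₗ[ℂ] rapidForms ξ₁ ξ₂ g (q + 1) where
  toFun α := ⟨wittenD α.1, wittenD_mem_rapidForms α.2⟩
  map_add' α β := Subtype.ext (wittenD_add α.2.1 β.2.1)
  map_smul' c α := Subtype.ext (wittenD_smul c α.2.1)

/-- The SYZ transform on rapidly decaying forms, as a linear map. -/
def syzMap (hħ : ħ ≠ 0) (q : ℕ) : rapidForms ξ₁ ξ₂ g q →ₗ[ℂ] dolbeaultForms ξ₁ ξ₂ q where
  toFun α := ⟨syzTransform α.1, syzTransform_mem_dolbeaultForms hħ α.2⟩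
  map_add' α β := Subtype.ext
    (syzTransform_add hħ (fiberSummable_of_mem α.2) (fiberSummable_of_mem β.2))
  map_smul' c α := Subtype.ext (syzTransform_smul hħ c (fiberSummable_of_mem α.2))

theorem syzMap_bijective (hħ : ħ ≠ 0) (q : ℕ) : Function.Bijective (syzMap ξ₁ ξ₂ g hħ q) := by
  refine ⟨(injective_iff_map_eq_zero _).2 fun α hα => Subtype.ext ?_, fun β =>
    ⟨⟨inverseSyz β.1, inverseSyz_mem_rapidForms hħ g β.2⟩,
      Subtype.ext (syzTransform_inverseSyz hħ β.2)⟩⟩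
  exact eq_zero_of_syzTransform_eq_zero hħ α.2 (congrArg Subtype.val hα)

/-- The SYZ transform as a linear isomorphism. -/
def syzEquiv (hħ : ħ ≠ 0) (q : ℕ) : rapidForms ξ₁ ξ₂ g q ≃ₗ[ℂ] dolbeaultForms ξ₁ ξ₂ q :=
  LinearEquiv.ofBijective (syzMap ξ₁ ξ₂ g hħ q) (syzMap_bijective ξ₁ ξ₂ g hħ q)

end Complexes

end SYZ

end

theorem mainTheorem4 {n : ℕ} {B : Type*} [TopologicalSpace B] [T2Space B]
    [SecondCountableTopology B] [ChartedSpace (SYZ.Model n) B]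
    [HasGroupoid B (SYZ.integralAffineGroupoid n)] (g : SYZ.HessianMetric n B)
    (ħ : ℝ) (hħ : 0 < ħ) (ξ₁ ξ₂ : SYZ.LagrangianSection n B ħ) :
    -- the Fourier series converge, and their sums do not depend on the lifts
    (∀ (q : ℕ), ∀ α ∈ SYZ.rapidForms ξ₁ ξ₂ g q, ∀ (z : SYZ.Mirror n B)
      (y₁ : SYZ.Lift (ξ₁.toFun z.base)) (y₂ : SYZ.Lift (ξ₂.toFun z.base))
      (w : SYZ.MirrorLift z.fib),
      (∀ I : Fin q → Fin n, Summable (SYZ.fourierTerm α y₁ y₂ w.1 I)) ∧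
        SYZ.syzTransform α z = SYZ.syzFormula α z y₁ y₂ w) ∧
    ∃ (dW : ∀ q : ℕ, SYZ.rapidForms ξ₁ ξ₂ g q →ₗ[ℂ] SYZ.rapidForms ξ₁ ξ₂ g (q + 1))
      (db : ∀ q : ℕ, SYZ.dolbeaultForms ξ₁ ξ₂ q →ₗ[ℂ] SYZ.dolbeaultForms ξ₁ ξ₂ (q + 1))
      (F : ∀ q : ℕ, SYZ.rapidForms ξ₁ ξ₂ g q ≃ₗ[ℂ] SYZ.dolbeaultForms ξ₁ ξ₂ q),
      -- the operators are the Witten differential, the Dolbeault operator and the SYZ transform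
      (∀ q α, (dW q α : SYZ.PathForm ξ₁ ξ₂ (q + 1)) = SYZ.wittenD (α : SYZ.PathForm ξ₁ ξ₂ q)) ∧
      (∀ q β, (db q β : SYZ.MirrorForm ξ₁ ξ₂ (q + 1))
        = SYZ.dolbeaultD (β : SYZ.MirrorForm ξ₁ ξ₂ q)) ∧
      (∀ q α, (F q α : SYZ.MirrorForm ξ₁ ξ₂ q) = SYZ.syzTransform (α : SYZ.PathForm ξ₁ ξ₂ q)) ∧
      -- both sides are complexes, and `F` is a chain map
      (∀ q α, dW (q + 1) (dW q α) = 0) ∧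
      (∀ q β, db (q + 1) (db q β) = 0) ∧
      (∀ q α, F (q + 1) (dW q α) = db q (F q α)) := by
  have hħ' : ħ ≠ 0 := hħ.ne'
  -- The Dolbeault map is taken to be the conjugate of the Witten map by `𝓕`, so that its linearity,
  -- its target and its square come from the Witten side.
  refine ⟨fun q α hα z y₁ y₂ w => ?_, SYZ.wittenMap ξ₁ ξ₂ g, fun q =>
    (SYZ.syzEquiv ξ₁ ξ₂ g hħ' (q + 1)).toLinearMap ∘ₗ SYZ.wittenMap ξ₁ ξ₂ g q ∘ₗ
      (SYZ.syzEquiv ξ₁ ξ₂ g hħ' q).symm.toLinearMap, SYZ.syzEquiv ξ₁ ξ₂ g hħ', fun q α => rfl,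
    fun q β => ?_, fun q α => rfl, fun q α => ?_, fun q β => ?_, fun q α => ?_⟩
  · have hsum := SYZ.fiberSummable_of_mem hα z.base
    exact ⟨hsum.summable_fourierTerm y₁ y₂ w.1, SYZ.syzTransform_eq hħ' hsum y₁ y₂ w⟩
  -- Every Dolbeault form is a transform, on which the conjugated map is `dolbeaultD` by the chain
  -- map identity.
  · obtain ⟨α, rfl⟩ := (SYZ.syzEquiv ξ₁ ξ₂ g hħ' q).surjective β
    simp only [LinearMap.comp_apply, LinearEquiv.coe_coe, LinearEquiv.symm_apply_apply]
    exact (SYZ.dolbeaultD_syzTransform hħ' α.2).symm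
  · exact Subtype.ext (SYZ.wittenD_wittenD hħ' α.2.1)
  · simp only [LinearMap.comp_apply, LinearEquiv.coe_coe, LinearEquiv.symm_apply_apply]
    rw [show ∀ α : SYZ.rapidForms ξ₁ ξ₂ g q, SYZ.wittenMap ξ₁ ξ₂ g (q + 1)
      (SYZ.wittenMap ξ₁ ξ₂ g q α) = 0 from fun α =>
        Subtype.ext (SYZ.wittenD_wittenD hħ' α.2.1), map_zero]
  · simp only [LinearMap.comp_apply, LinearEquiv.coe_coe, LinearEquiv.symm_apply_apply]
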